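/- Let $d\in\{2,3\}$ and let $\Gamma\subseteq\partial\Omega$ be a relatively open, polygonal part of the boundary of a bounded, polyhedral Lipschitz domain $\Omega\subset\mathbb R^d$; for $d=3$ assume that the boundary of $\Gamma$ (a polygonal curve) is Lipschitz itself. Let $\gamma>0$ and $s\in(0,1)$. Then there is a constant $C>0$, depending only on $\Gamma$, $\gamma$ and $s$, with the following property. Let $\mathcal T$ be a finite triangulation of $\overline\Gamma$ without hanging nodes into line segments ($d=2$) resp. plane triangles ($d=3$) which is $\gamma$-shape regular, i.e. $$\frac{\operatorname{diam}(T)}{\operatorname{diam}(T')}\le\gamma\ \text{ for all } T,T'\in\mathcal T \text{ with } T\cap T'\ne\emptyset\quad(d=2),\qquad \frac{\operatorname{diam}(T)^2}{|T|}\le\gamma\ \text{ for all } T\in\mathcal T\quad(d=3),$$ where $|T|$ is the surface measure of $T$. For a node $z$ of $\mathcal T$ let $\omega(z):=\bigcup\{T\in\mathcal T: z\in T\}$ be the node patch. Then $$|v|_{H^s(\omega(z))}\le C\,\operatorname{diam}(\omega(z))^{1-s}\,\|\nabla_\Gamma v\|_{L^2(\omega(z))}\qquad\text{for all } v\in H^1(\omega(z)),$$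 where $\nabla_\Gamma$ is the (weak) surface gradient and $$|v|_{H^s(\omega)}^2=\int_\omega\int_\omega\frac{|v(x)-v(y)|^2}{|x-y|^{d-1+2s}}\,d\Gamma(x)\,d\Gamma(y)$$ is the Sobolev--Slobodeckij seminorm. -/

import Mathlib

open MeasureTheory Set Filter Topology
open scoped ENNReal NNReal

noncomputable section

namespace BEM

/-- Euclidean space `ℝᵈ`. -/
abbrev E (d : ℕ) : Type := EuclideanSpace ℝ (Fin d)

/-! ### The geometry: polyhedral Lipschitz domains and polygonal parts of their boundary -/

/-- Near the point `x`, the set `Ω` is the strict subgraph, in the direction of the unit vector `e`,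
of the Lipschitz function `φ` (which is evaluated at the component of `y` orthogonal to `e`). -/
def IsLipschitzSubgraphAt {d : ℕ} (Ω : Set (E d)) (x e : E d) (φ : E d → ℝ) : Prop :=
  ‖e‖ = 1 ∧ (∃ L : ℝ≥0, LipschitzWith L φ) ∧
    ∀ᶠ y in 𝓝 x, (y ∈ Ω ↔ inner ℝ e y < φ (y - inner ℝ e y • e))

/-- A bounded open set whose boundary is locally the graph of a Lipschitz function, the set lying
on one side of it. -/
structure IsBoundedLipschitzDomain {d : ℕ} (Ω : Set (E d)) : Prop where
  isOpen : IsOpen Ω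
  isBounded : Bornology.IsBounded Ω
  lipschitz : ∀ x ∈ frontier Ω, ∃ e φ, IsLipschitzSubgraphAt Ω x e φ

/-- `S` is a finite union of nondegenerate flat simplices of dimension `d - 1` in `ℝᵈ`
(line segments for `d = 2`, plane triangles for `d = 3`). -/
def IsPolyhedralSurface {d : ℕ} (S : Set (E d)) : Prop :=
  ∃ F : Finset (Finset (E d)),
    (∀ t ∈ F, t.card = d ∧ AffineIndependent ℝ ((↑) : t → E d)) ∧
    S = ⋃ t ∈ F, convexHull ℝ (t : Set (E d))

/-- The relative boundary `closure Γ \ Γ` of the relatively open set `Γ ⊆ ∂Ω` is Lipschitz: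
near each of its points, `∂Ω` is the graph of a Lipschitz function over the hyperplane orthogonal
to `e`, and in the coordinates of this hyperplane the set `Γ` is the strict subgraph, in the
direction of a unit vector `e'`, of a Lipschitz function `ψ`. -/
def HasLipschitzRelBoundary {d : ℕ} (Ω Γ : Set (E d)) : Prop :=
  ∀ x ∈ closure Γ \ Γ, ∃ (e e' : E d) (φ ψ : E d → ℝ),
    IsLipschitzSubgraphAt Ω x e φ ∧ ‖e'‖ = 1 ∧ inner ℝ e e' = 0 ∧
    (∃ L : ℝ≥0, LipschitzWith L ψ) ∧
    ∀ᶠ y in 𝓝 x, y ∈ frontier Ω →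
      (y ∈ Γ ↔ inner ℝ e' y < ψ (y - inner ℝ e y • e - inner ℝ e' y • e'))

/-- `Γ` is a relatively open, polygonal part of the boundary of the bounded polyhedral Lipschitz
domain `Ω ⊆ ℝᵈ`, the boundary of `Γ` being Lipschitz itself if `d = 3`. -/
structure IsPolygonalBoundaryPart {d : ℕ} (Ω Γ : Set (E d)) : Prop where
  lipschitz_domain : IsBoundedLipschitzDomain Ω
  polyhedral_domain : IsPolyhedralSurface (frontier Ω)
  relatively_open : ∃ U, IsOpen U ∧ Γ = U ∩ frontier Ω
  polygonal : IsPolyhedralSurface (closure Γ)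
  lipschitz_boundary : d = 3 → HasLipschitzRelBoundary Ω Γ

/-! ### Triangulations -/

/-- The surface measure on `(d-1)`-dimensional subsets of `ℝᵈ`: the `(d-1)`-dimensional Hausdorff
measure, normalized to agree with the Lebesgue measure on hyperplanes. -/
def surfaceMeasure (d : ℕ) : Measure (E d) := μHE[d - 1]

/-- `K` triangulates `Γ`: it is a finite simplicial complex (so there are no hanging nodes), it
covers the closure of `Γ`, and all its faces are faces of elements, i.e. of simplices with
`d` vertices. -/
structure IsTriangulation {d : ℕ} (K : Geometry.SimplicialComplex ℝ (E d)) (Γ : Set (E d)) :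
    Prop where
  finite : K.faces.Finite
  pure : ∀ t ∈ K.faces, ∃ t' ∈ K.faces, t ⊆ t' ∧ t'.card = d
  space_eq : K.space = closure Γ

/-- The elements of the triangulation `K` as compact subsets of `ℝᵈ`: line segments for `d = 2`,
plane triangles for `d = 3`. -/
def elements {d : ℕ} (K : Geometry.SimplicialComplex ℝ (E d)) : Set (Set (E d)) :=
  {T | ∃ t ∈ K.faces, t.card = d ∧ T = convexHull ℝ (t : Set (E d))}

/-- `γ`-shape regularity: a bound on `diam(T)² / |T|` for all elements if `d = 3`, and on the ratio
of the diameters of any two touching elements if `d = 2`. -/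
def IsShapeRegular {d : ℕ} (K : Geometry.SimplicialComplex ℝ (E d)) (γ : ℝ) : Prop :=
  (d = 3 → ∀ T ∈ elements K, Metric.diam T ^ 2 / (surfaceMeasure d).real T ≤ γ) ∧
  (d = 2 → ∀ T ∈ elements K, ∀ T' ∈ elements K, (T ∩ T').Nonempty →
    Metric.diam T / Metric.diam T' ≤ γ)

/-- The node patch `ω(z)`: the union of all elements that contain `z`. -/
def nodePatch {d : ℕ} (K : Geometry.SimplicialComplex ℝ (E d)) (z : E d) : Set (E d) :=
  ⋃₀ {T ∈ elements K | z ∈ T}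

/-! ### Sobolev spaces on (patches of) the surface -/

/-- The Sobolev–Slobodeckij seminorm `|v|_{H^s(S)}` on a `(d-1)`-dimensional set `S ⊆ ℝᵈ`, as an
extended nonnegative number. -/
def slobodeckijSeminorm {d : ℕ} (s : ℝ) (S : Set (E d)) (v : E d → ℝ) : ℝ≥0∞ :=
  (∫⁻ x in S, ∫⁻ y in S,
    ENNReal.ofReal (|v x - v y| ^ 2 / ‖x - y‖ ^ ((d : ℝ) - 1 + 2 * s))
      ∂(surfaceMeasure d) ∂(surfaceMeasure d)) ^ (1 / 2 : ℝ)

/-- `κ : O → S` is a bi-Lipschitz parametrization of a piece of the `(d-1)`-dimensional set `S` over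
the open set `O ⊆ ℝᵈ⁻¹`. -/
structure IsBiLipschitzChart {d : ℕ} (S : Set (E d)) (O : Set (E (d - 1)))
    (κ : E (d - 1) → E d) : Prop where
  isOpen : IsOpen O
  mapsTo : MapsTo κ O S
  biLipschitz : ∃ L₁ > (0 : ℝ), ∃ L₂ > (0 : ℝ), ∀ x ∈ O, ∀ y ∈ O,
    L₁ * ‖x - y‖ ≤ ‖κ x - κ y‖ ∧ ‖κ x - κ y‖ ≤ L₂ * ‖x - y‖

/-- The vector field `g` is the weak surface gradient of `v` on `S`: it is tangential and, in every
bi-Lipschitz chart `κ`, the function `v ∘ κ` has the weak gradient `Dκᵀ (g ∘ κ)`. (By Rademacher's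
theorem, `κ` is differentiable almost everywhere.) -/
def HasWeakSurfaceGradient {d : ℕ} (S : Set (E d)) (v : E d → ℝ) (g : E d → E d) : Prop :=
  ∀ (O : Set (E (d - 1))) (κ : E (d - 1) → E d), IsBiLipschitzChart S O κ →
    (∀ᵐ y ∂(volume.restrict O), ∃ w, g (κ y) = fderiv ℝ κ y w) ∧
    ∀ η : E (d - 1) → ℝ, ContDiff ℝ (⊤ : ℕ∞) η → HasCompactSupport η → tsupport η ⊆ O →
      ∀ w : E (d - 1),
        ∫ y in O, v (κ y) * fderiv ℝ η y w =
          - ∫ y in O, inner ℝ (g (κ y)) (fderiv ℝ κ y w) * η y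

/-- `v ∈ H¹(S)` with surface gradient `∇_Γ v = g`. -/
structure MemH1WithGradient {d : ℕ} (S : Set (E d)) (v : E d → ℝ) (g : E d → E d) : Prop where
  memLp : MemLp v 2 ((surfaceMeasure d).restrict S)
  memLp_gradient : MemLp g 2 ((surfaceMeasure d).restrict S)
  hasGradient : HasWeakSurfaceGradient S v g

end BEM

end

/-!
# A Poincaré-type inequality for the Sobolev–Slobodeckij seminorm on node patches

Write `n = d - 1`. On a bounded convex open set `D ⊆ ℝⁿ`, the seminorm of order `s < 1` is bounded by
the `L²`-norm of the gradient: write `v x - v y` as an integral of the gradient along a segment, use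
the Cauchy–Schwarz inequality and substitute `ξ = x - y`, which leaves the kernel `|ξ|^(2-n-2s)`,
integrable near `0` because of `s < 1`. Weakly differentiable functions are reached by mollification
on slightly smaller domains and Fatou's lemma (`lintegral_slobodeckij_le_of_weak`). A bi-Lipschitz
chart of size `H` transports this estimate to the surface, with the factor `H^(2-2s)`
(`slobodeckijIntegral_chart_le`); only Hausdorff measures of Lipschitz images are compared, so that
no area formula is needed.

A node patch is treated as a family of elements of comparable size (`IsRegularPatch`). Two elements
that share a facet lie in one chart. Two elements `T`, `T'` which only meet in the node `z` satisfy
`c (|x - z| + |y - z|) ≤ |x - y|`; inserting a point of a third element with the averaged reference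
coordinates, the integral over `T × T'` is bounded by the ones over `T × T''` and `T'' × T'`
(`slobodeckijIntegral_chain_le`). Following a path of neighbouring elements around the node proves
the inequality (`slobodeckijSeminorm_patch_le`).

The constants must not depend on the triangulation. For `d = 2`, the elements at a node lie on the
finitely many lines of the sides of `Γ`, so the angles between them are bounded below, and any two of
them form one chart. For `d = 3` the shape regularity bounds the angles of each element, but not the
angles between two elements that meet in `z` only. The decomposition of `closure Γ` into finitely
many triangles, which does not depend on the triangulation, is used here: the planes of all elements
belong to a finite set `𝒱` (`span_mem_directions`), and unless the line of an edge at `z` belongs to a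
finite set `ℰ`, the triangulation continues across this edge in the same plane
(`exists_continuation`). Finitely many subspaces meet under angles bounded below
(`exists_angleBound`). A point of an element `T'` close to an element `T` is therefore close to a
point of the plane of `T`; such a point leaves the triangle `T` either through an edge in `ℰ`, where
the angle bound applies again, or into a coplanar neighbour of `T`, where shape regularity applies.
This gives the separation estimate `IsFan.separated_left`, the charts of two neighbours (`IsFan.fold`),
and a bound for the number of elements at a node (`exists_isRegularPatch_of_isFan`).

That the elements at a node are connected via common edges is a topological fact about the surface:
around `z`, the set `Γ` without `z` is a Lipschitz image of a punctured disc or, at the boundary of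
`Γ`, of a rectangle, hence connected, and two groups of elements that meet only in `z` would
disconnect it (`nodeElements_connected`).
-/

open MeasureTheory Set Filter Topology
open scoped ENNReal NNReal Convolution

namespace BEM

/-! ### Convex domains in Euclidean space -/

/-- Jensen's inequality for the square, in extended nonnegative numbers. -/
lemma sq_lintegral_le {α : Type*} [MeasurableSpace α] (μ : Measure α) [IsProbabilityMeasure μ]
    {f : α → ℝ≥0∞} (hf : AEMeasurable f μ) : (∫⁻ a, f a ∂μ) ^ 2 ≤ ∫⁻ a, f a ^ 2 ∂μ := by
  have h := ENNReal.lintegral_mul_le_Lp_mul_Lq μ Real.HolderConjugate.two_two hf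
    (aemeasurable_const (b := (1 : ℝ≥0∞)))
  simp only [Pi.mul_apply, mul_one, ENNReal.one_rpow, lintegral_const, measure_univ] at h
  calc (∫⁻ a, f a ∂μ) ^ 2 ≤ ((∫⁻ a, f a ^ (2 : ℝ) ∂μ) ^ (1 / 2 : ℝ)) ^ 2 := by gcongr
    _ = ∫⁻ a, f a ^ 2 ∂μ := by
      rw [← ENNReal.rpow_natCast, ← ENNReal.rpow_mul]
      norm_num

/-- The integral of `‖ξ‖ ^ (2 - p)` over a ball, which is the constant in the estimate of the
Sobolev–Slobodeckij integral with exponent `p` by the Dirichlet integral on a convex domain. -/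
noncomputable def kernelMass (n : ℕ) (p : ℝ) : ℝ≥0∞ :=
  ∫⁻ ξ in Metric.ball (0 : E n) 4, ENNReal.ofReal (‖ξ‖ ^ (2 - p))

lemma kernelMass_lt_top {n : ℕ} (hn : 1 ≤ n) {p : ℝ} (hp : p < n + 2) : kernelMass n p < ∞ := by
  have h : IntegrableOn (fun ξ : E n => ‖ξ‖ ^ (2 - p)) (Metric.ball (0 : E n) 4) := by
    refine integrableOn_ball_of_norm_le_rpow (C := 1) (α := p - 2) (by simpa using hn)
      (by simp; linarith) (Eventually.of_forall fun x => ?_) ?_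
    · rw [Real.norm_of_nonneg (by positivity), one_mul, neg_sub]
    · exact (measurable_norm.pow_const _).aestronglyMeasurable
  have := h.lintegral_lt_top
  exact this

/-- The Taylor estimate `|w x - w y|² ≤ ‖x - y‖² ∫₀¹ ‖Dw‖²` along the segment from `y` to `x`. -/
lemma sq_enorm_sub_le_lintegral_fderiv {n : ℕ} {w : E n → ℝ} (hw : ContDiff ℝ 1 w) (y ξ : E n) :
    ‖w (y + ξ) - w y‖ₑ ^ 2 ≤
      ‖ξ‖ₑ ^ 2 * ∫⁻ t in Ioc (0 : ℝ) 1, ‖fderiv ℝ w (y + t • ξ)‖ₑ ^ 2 := by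
  have hc : Continuous fun t : ℝ => fderiv ℝ w (y + t • ξ) :=
    (hw.continuous_fderiv one_ne_zero).comp (by fun_prop)
  have h1 : w (y + ξ) - w y = ∫ t in (0 : ℝ)..1, fderiv ℝ w (y + t • ξ) ξ := by
    have hd : ∀ t ∈ uIcc (0 : ℝ) 1,
        HasDerivAt (fun t : ℝ => w (y + t • ξ)) (fderiv ℝ w (y + t • ξ) ξ) t := fun t _ => by
      have h2 : HasDerivAt (fun t : ℝ => y + t • ξ) ξ t := by
        simpa using ((hasDerivAt_id t).smul_const ξ).const_add y
      exact ((hw.differentiable one_ne_zero) _).hasFDerivAt.comp_hasDerivAt t h2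
    rw [intervalIntegral.integral_eq_sub_of_hasDerivAt hd
      ((hc.clm_apply continuous_const).intervalIntegrable _ _)]
    simp
  have h3 : ‖w (y + ξ) - w y‖ₑ ≤ ‖ξ‖ₑ * ∫⁻ t in Ioc (0 : ℝ) 1, ‖fderiv ℝ w (y + t • ξ)‖ₑ := by
    rw [h1, intervalIntegral.integral_of_le zero_le_one, ← lintegral_const_mul _ hc.enorm.measurable]
    refine (enorm_integral_le_lintegral_enorm _).trans (lintegral_mono fun t => ?_)
    rw [mul_comm]
    exact ContinuousLinearMap.le_opENorm _ _
  have : IsProbabilityMeasure (volume.restrict (Ioc (0 : ℝ) 1)) := ⟨by simp⟩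
  calc _ ≤ (‖ξ‖ₑ * ∫⁻ t in Ioc (0 : ℝ) 1, ‖fderiv ℝ w (y + t • ξ)‖ₑ) ^ 2 := by gcongr
    _ ≤ _ := by
      rw [mul_pow]
      gcongr
      exact sq_lintegral_le _ hc.enorm.measurable.aemeasurable

lemma ofReal_slobodeckij_le {r a p : ℝ} {m : ℝ≥0∞} (hr : 0 ≤ r)
    (h : ENNReal.ofReal (a ^ 2) ≤ ENNReal.ofReal (r ^ 2) * m) :
    ENNReal.ofReal (a ^ 2 / r ^ p) ≤ ENNReal.ofReal (r ^ (2 - p)) * m := by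
  rcases hr.eq_or_lt with rfl | hr
  · have : ENNReal.ofReal (a ^ 2) = 0 := by simpa using h
    rw [ENNReal.ofReal_eq_zero] at this
    rw [ENNReal.ofReal_of_nonpos (div_nonpos_of_nonpos_of_nonneg this (by positivity))]
    exact zero_le
  · calc ENNReal.ofReal (a ^ 2 / r ^ p) = ENNReal.ofReal (a ^ 2) * ENNReal.ofReal ((r ^ p)⁻¹) := by
          rw [← ENNReal.ofReal_mul (by positivity), div_eq_mul_inv]
      _ ≤ ENNReal.ofReal (r ^ 2) * m * ENNReal.ofReal ((r ^ p)⁻¹) := by gcongr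
      _ = ENNReal.ofReal (r ^ 2 * (r ^ p)⁻¹) * m := by
          rw [ENNReal.ofReal_mul (by positivity)]; ring
      _ = _ := by rw [Real.rpow_sub hr, Real.rpow_two, div_eq_mul_inv]

/-- On a convex set, the Sobolev–Slobodeckij integral of a continuously differentiable function is
controlled by its Dirichlet integral. After the Taylor estimate, the substitution `ξ = x - y`
decouples the kernel from the gradient, because Lebesgue measure is translation invariant. -/
lemma lintegral_slobodeckij_le_of_contDiff {n : ℕ} {w : E n → ℝ} (hw : ContDiff ℝ 1 w) {O : Set (E n)}
    (hO : Convex ℝ O) (hOm : MeasurableSet O) (hOb : O ⊆ Metric.ball 0 2) (p : ℝ) :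
    ∫⁻ x in O, ∫⁻ y in O, ENNReal.ofReal (|w x - w y| ^ 2 / ‖x - y‖ ^ p) ≤
      kernelMass n p * ∫⁻ u in O, ‖fderiv ℝ w u‖ₑ ^ 2 := by
  set h : E n → ℝ≥0∞ := O.indicator fun u => ‖fderiv ℝ w u‖ₑ ^ 2 with hh
  have hmeas : Measurable h :=
    ((hw.continuous_fderiv one_ne_zero).enorm.measurable.pow_const 2).indicator hOm
  set k : E n → ℝ≥0∞ := (Metric.ball 0 4).indicator fun ξ => ENNReal.ofReal (‖ξ‖ ^ (2 - p)) with hk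
  have hkm : Measurable k :=
    ((measurable_norm.pow_const _).ennreal_ofReal).indicator measurableSet_ball
  have key : ∀ x ∈ O, ∀ y ∈ O, ENNReal.ofReal (|w x - w y| ^ 2 / ‖x - y‖ ^ p) ≤
      k (x - y) * ∫⁻ t in Ioc (0 : ℝ) 1, h (y + t • (x - y)) := by
    intro x hx y hy
    have hxy : x - y ∈ Metric.ball (0 : E n) 4 := by
      have h1 := hOb hx
      have h2 := hOb hy
      rw [mem_ball_zero_iff] at *
      linarith [norm_sub_le x y]
    have hI : ∫⁻ t in Ioc (0 : ℝ) 1, h (y + t • (x - y)) =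
        ∫⁻ t in Ioc (0 : ℝ) 1, ‖fderiv ℝ w (y + t • (x - y))‖ₑ ^ 2 := by
      refine setLIntegral_congr_fun measurableSet_Ioc fun t ht => ?_
      rw [hh, indicator_of_mem]
      exact hO.add_smul_sub_mem hy hx ⟨ht.1.le, ht.2⟩
    rw [hI, hk, indicator_of_mem hxy]
    refine ofReal_slobodeckij_le (norm_nonneg _) ?_
    have := sq_enorm_sub_le_lintegral_fderiv hw y (x - y)
    rw [add_sub_cancel] at this
    rw [ENNReal.ofReal_pow (abs_nonneg _), ENNReal.ofReal_pow (norm_nonneg _), ofReal_norm,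
      ← Real.norm_eq_abs, ofReal_norm]
    exact this
  have hm3 : Measurable fun q : (E n × E n) × ℝ => h (q.1.2 + q.2 • q.1.1) :=
    hmeas.comp (by fun_prop)
  calc _ ≤ ∫⁻ x in O, ∫⁻ y in O, k (x - y) * ∫⁻ t in Ioc (0 : ℝ) 1, h (y + t • (x - y)) :=
        setLIntegral_mono' hOm fun x hx => setLIntegral_mono' hOm fun y hy => key x hx y hy
    _ ≤ ∫⁻ x, ∫⁻ y, k (x - y) * ∫⁻ t in Ioc (0 : ℝ) 1, h (y + t • (x - y)) :=
        (setLIntegral_le_lintegral _ _).trans (lintegral_mono fun x => setLIntegral_le_lintegral _ _)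
    _ = ∫⁻ y, ∫⁻ x, k (x - y) * ∫⁻ t in Ioc (0 : ℝ) 1, h (y + t • (x - y)) := by
        refine lintegral_lintegral_swap (Measurable.aemeasurable ?_)
        refine (hkm.comp (by fun_prop)).mul ?_
        have : Measurable fun q : (E n × E n) × ℝ => h (q.1.2 + q.2 • (q.1.1 - q.1.2)) :=
          hmeas.comp (by fun_prop)
        exact this.lintegral_prod_right'
    _ = ∫⁻ y, ∫⁻ ξ, k ξ * ∫⁻ t in Ioc (0 : ℝ) 1, h (y + t • ξ) :=
        lintegral_congr fun y => lintegral_sub_right_eq_self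
          (fun ξ => k ξ * ∫⁻ t in Ioc (0 : ℝ) 1, h (y + t • ξ)) y
    _ = ∫⁻ ξ, ∫⁻ y, k ξ * ∫⁻ t in Ioc (0 : ℝ) 1, h (y + t • ξ) := by
        refine lintegral_lintegral_swap (Measurable.aemeasurable ?_)
        have : Measurable fun q : (E n × E n) × ℝ => h (q.1.1 + q.2 • q.1.2) :=
          hmeas.comp (by fun_prop)
        exact (hkm.comp measurable_snd).mul this.lintegral_prod_right'
    _ = ∫⁻ ξ, k ξ * ∫⁻ u, h u := by
        refine lintegral_congr fun ξ => ?_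
        have hm2 : Measurable fun q : E n × ℝ => h (q.1 + q.2 • ξ) := hmeas.comp (by fun_prop)
        rw [lintegral_const_mul _ hm2.lintegral_prod_right',
          lintegral_lintegral_swap hm2.aemeasurable]
        congr 1
        calc _ = ∫⁻ t in Ioc (0 : ℝ) 1, ∫⁻ u, h u :=
              lintegral_congr fun t => lintegral_add_right_eq_self h (t • ξ)
          _ = _ := by simp
    _ = _ := by
        rw [lintegral_mul_const _ hkm, hk, hh, lintegral_indicator measurableSet_ball,
          lintegral_indicator hOm, kernelMass]

lemma convex_setOf_ball_subset {n : ℕ} {O : Set (E n)} (hO : Convex ℝ O) (r : ℝ) :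
    Convex ℝ {x | Metric.ball x r ⊆ O} := by
  have : {x | Metric.ball x r ⊆ O} = ⋂ v ∈ Metric.ball (0 : E n) r, (fun x => x + v) ⁻¹' O := by
    ext x
    simp only [mem_ofPred_eq, mem_iInter, mem_preimage, mem_ball_zero_iff]
    constructor
    · intro h v hv
      exact h (by simpa using hv)
    · intro h y hy
      have := h (y - x) (by simpa [dist_eq_norm] using hy)
      simpa using this
  rw [this]
  exact convex_iInter₂ fun v _ => hO.translate_preimage_left v

lemma isClosed_setOf_ball_subset {n : ℕ} (O : Set (E n)) (r : ℝ) :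
    IsClosed {x | Metric.ball x r ⊆ O} := by
  have : {x | Metric.ball x r ⊆ O}ᶜ = ⋃ y ∈ Oᶜ, Metric.ball y r := by
    ext x
    simp only [mem_compl_iff, mem_ofPred_eq, not_subset, mem_iUnion, Metric.mem_ball, exists_prop]
    constructor
    · rintro ⟨y, hy, h⟩
      exact ⟨y, h, by rwa [dist_comm]⟩
    · rintro ⟨y, h, hy⟩
      exact ⟨y, by rwa [dist_comm], h⟩
  rw [← isOpen_compl_iff, this]
  exact isOpen_biUnion fun _ _ => Metric.isOpen_ball

/-- If the distributional derivative of `u` on `O` is bounded by `N` in the weak sense, then the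
derivative of a mollification `ρ ⋆ u` is bounded pointwise by `ρ ⋆ N`, away from the boundary. -/
lemma enorm_fderiv_convolution_le {n : ℕ} {O : Set (E n)} (hO : IsOpen O) {u : E n → ℝ}
    (hu : IntegrableOn u O) {N : E n → ℝ≥0∞}
    (hw : ∀ η : E n → ℝ, ContDiff ℝ (⊤ : ℕ∞) η → HasCompactSupport η → tsupport η ⊆ O →
      ∀ w : E n, ‖∫ y in O, u y * fderiv ℝ η y w‖ₑ ≤ ‖w‖ₑ * ∫⁻ y in O, N y * ‖η y‖ₑ)
    (φ : ContDiffBump (0 : E n)) {x : E n} (hx : Metric.ball x (2 * φ.rOut) ⊆ O) :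
    ‖fderiv ℝ (φ.normed volume ⋆[ContinuousLinearMap.lsmul ℝ ℝ, volume] O.indicator u) x‖ₑ ≤
      ∫⁻ y in O, N y * ‖φ.normed volume (x - y)‖ₑ := by
  set ρ : E n → ℝ := φ.normed volume with hρ
  have hρc : HasCompactSupport ρ := φ.hasCompactSupport_normed
  have hρd : ContDiff ℝ (⊤ : ℕ∞) ρ := φ.contDiff_normed
  have hρ1 : ContDiff ℝ 1 ρ := φ.contDiff_normed (n := 1)
  have hU : LocallyIntegrable (O.indicator u) volume :=
    ((integrable_indicator_iff hO.measurableSet).2 hu).locallyIntegrable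
  set η : E n → ℝ := fun y => ρ (x - y) with hη
  have hηd : ContDiff ℝ (⊤ : ℕ∞) η := hρd.comp (contDiff_const.sub contDiff_id)
  have hηt : tsupport η ⊆ Metric.closedBall x φ.rOut := by
    refine closure_minimal (fun y hy => ?_) Metric.isClosed_closedBall
    have : x - y ∈ Function.support ρ := hy
    rw [hρ, φ.support_normed_eq, mem_ball_zero_iff] at this
    rw [Metric.mem_closedBall, dist_comm, dist_eq_norm]
    exact this.le
  have hηc : HasCompactSupport η :=
    (isCompact_closedBall x φ.rOut).of_isClosed_subset (isClosed_tsupport _) hηt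
  have hηO : tsupport η ⊆ O := hηt.trans
    ((Metric.closedBall_subset_ball (by linarith [φ.rOut_pos])).trans hx)
  have hfη : ∀ y w, fderiv ℝ η y w = - fderiv ℝ ρ (x - y) w := by
    intro y w
    have h1 : HasFDerivAt η ((fderiv ℝ ρ (x - y)).comp (-(ContinuousLinearMap.id ℝ (E n)))) y := by
      have h2 : HasFDerivAt (fun y : E n => x - y) (-(ContinuousLinearMap.id ℝ (E n))) y :=
        (hasFDerivAt_id y).const_sub x
      exact ((hρ1.differentiable one_ne_zero) _).hasFDerivAt.comp y h2
    rw [h1.fderiv]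
    simp
  have hD := hρc.hasFDerivAt_convolution_left (ContinuousLinearMap.lsmul ℝ ℝ) hρ1 hU x
  rw [hD.fderiv, enorm_eq_nnnorm]
  have main : ∀ w : E n, ‖(fderiv ℝ ρ ⋆[(ContinuousLinearMap.lsmul ℝ ℝ).precompL (E n), volume]
      O.indicator u) x w‖ₑ ≤ ‖w‖ₑ * ∫⁻ y in O, N y * ‖ρ (x - y)‖ₑ := by
    intro w
    refine le_trans (le_of_eq ?_) (hw η hηd hηc hηO w)
    rw [← convolution_flip, convolution_def, ContinuousLinearMap.integral_apply]
    · simp_rw [hfη]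
      rw [← integral_indicator hO.measurableSet, ← enorm_neg, ← integral_neg]
      congr 1
      refine integral_congr_ae (Eventually.of_forall fun y => ?_)
      by_cases hy : y ∈ O
      · simp [hy, ContinuousLinearMap.precompL_apply, mul_comm]
      · simp [hy]
    · exact (hρc.fderiv ℝ).convolutionExists_right _ hU (hρ1.continuous_fderiv one_ne_zero) x
  set M := ∫⁻ y in O, N y * ‖ρ (x - y)‖ₑ with hM
  by_cases htop : M = ∞
  · rw [htop]; exact le_top
  · lift M to ℝ≥0 using htop with M' hM'
    rw [ENNReal.coe_le_coe]
    refine ContinuousLinearMap.opNNNorm_le_bound _ _ fun w => ?_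
    have := main w
    rw [enorm_eq_nnnorm, enorm_eq_nnnorm, ← ENNReal.coe_mul, ENNReal.coe_le_coe] at this
    rwa [mul_comm]

lemma lintegral_enorm_normed {n : ℕ} (φ : ContDiffBump (0 : E n)) :
    ∫⁻ y, ‖φ.normed volume y‖ₑ = 1 := by
  rw [← ofReal_integral_norm_eq_lintegral_enorm φ.integrable_normed]
  simp_rw [Real.norm_of_nonneg (φ.nonneg_normed _)]
  rw [φ.integral_normed, ENNReal.ofReal_one]

lemma lintegral_sq_lintegral_normed_le {n : ℕ} {O A : Set (E n)} (hO : MeasurableSet O)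
    {N : E n → ℝ≥0∞} (hN : Measurable N) (φ : ContDiffBump (0 : E n)) :
    ∫⁻ x in A, (∫⁻ y in O, N y * ‖φ.normed volume (x - y)‖ₑ) ^ 2 ≤ ∫⁻ y in O, N y ^ 2 := by
  have hc : Measurable fun y => ‖φ.normed volume y‖ₑ := φ.continuous_normed.enorm.measurable
  have hJ : ∀ x, (∫⁻ y in O, N y * ‖φ.normed volume (x - y)‖ₑ) ^ 2 ≤
      ∫⁻ y in O, N y ^ 2 * ‖φ.normed volume (x - y)‖ₑ := by
    intro x
    have hcx : Measurable fun y => ‖φ.normed volume (x - y)‖ₑ := hc.comp (by fun_prop)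
    have : IsProbabilityMeasure (volume.withDensity fun y => ‖φ.normed volume (x - y)‖ₑ) := by
      refine ⟨?_⟩
      rw [withDensity_apply _ MeasurableSet.univ, Measure.restrict_univ,
        lintegral_sub_left_eq_self (fun y => ‖φ.normed volume y‖ₑ) x]
      exact lintegral_enorm_normed φ
    have h := sq_lintegral_le (volume.withDensity fun y => ‖φ.normed volume (x - y)‖ₑ)
      (hN.indicator hO).aemeasurable
    rw [lintegral_withDensity_eq_lintegral_mul _ hcx (hN.indicator hO),
      lintegral_withDensity_eq_lintegral_mul _ hcx ((hN.indicator hO).pow_const 2)] at h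
    rw [← lintegral_indicator hO, ← lintegral_indicator hO]
    refine (le_of_eq ?_).trans (h.trans (le_of_eq ?_))
    · congr 1
      refine lintegral_congr fun y => ?_
      by_cases hy : y ∈ O <;> simp [hy, mul_comm]
    · refine lintegral_congr fun y => ?_
      by_cases hy : y ∈ O <;> simp [hy, mul_comm]
  calc _ ≤ ∫⁻ x, ∫⁻ y in O, N y ^ 2 * ‖φ.normed volume (x - y)‖ₑ :=
        (setLIntegral_le_lintegral _ _).trans (lintegral_mono hJ)
    _ = ∫⁻ y in O, ∫⁻ x, N y ^ 2 * ‖φ.normed volume (x - y)‖ₑ := by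
        refine lintegral_lintegral_swap (Measurable.aemeasurable ?_)
        exact ((hN.comp measurable_snd).pow_const 2).mul (hc.comp (by fun_prop))
    _ = _ := by
        refine lintegral_congr fun y => ?_
        have hcy : Measurable fun x => ‖φ.normed volume (x - y)‖ₑ := hc.comp (by fun_prop)
        rw [lintegral_const_mul _ hcy,
          lintegral_sub_right_eq_self (fun x => ‖φ.normed volume x‖ₑ) y, lintegral_enorm_normed,
          mul_one]

/-- The Sobolev–Slobodeckij integral of a function on a bounded convex domain is controlled by any
square integrable weak bound of its distributional gradient: mollify, apply the estimate for smooth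
functions on the eroded (still convex) domains and pass to the limit with Fatou's lemma. -/
theorem lintegral_slobodeckij_le_of_weak {n : ℕ} {O : Set (E n)} (hO : IsOpen O)
    (hOc : Convex ℝ O) (hOb : O ⊆ Metric.ball 0 2) {u : E n → ℝ} (hum : Measurable u)
    (hu : IntegrableOn u O) {N : E n → ℝ≥0∞} (hN : Measurable N)
    (hw : ∀ η : E n → ℝ, ContDiff ℝ (⊤ : ℕ∞) η → HasCompactSupport η → tsupport η ⊆ O →
      ∀ w : E n, ‖∫ y in O, u y * fderiv ℝ η y w‖ₑ ≤ ‖w‖ₑ * ∫⁻ y in O, N y * ‖η y‖ₑ) (p : ℝ) :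
    ∫⁻ x in O, ∫⁻ y in O, ENNReal.ofReal (|u x - u y| ^ 2 / ‖x - y‖ ^ p) ≤
      kernelMass n p * ∫⁻ y in O, N y ^ 2 := by
  let φ : ℕ → ContDiffBump (0 : E n) := fun k =>
    ⟨1 / (k + 2 : ℝ) / 2, 1 / (k + 2 : ℝ), by positivity, half_lt_self (by positivity)⟩
  have hφ : Tendsto (fun k => (φ k).rOut) atTop (𝓝 0) := by
    have := (tendsto_one_div_add_atTop_nhds_zero_nat (𝕜 := ℝ)).comp (tendsto_add_atTop_nat 1)
    refine this.congr fun k => ?_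
    simp only [Function.comp, φ]
    push_cast
    ring_nf
  have hU : LocallyIntegrable (O.indicator u) volume :=
    ((integrable_indicator_iff hO.measurableSet).2 hu).locallyIntegrable
  let U : ℕ → E n → ℝ := fun k =>
    (φ k).normed volume ⋆[ContinuousLinearMap.lsmul ℝ ℝ, volume] O.indicator u
  have hUd : ∀ k, ContDiff ℝ 1 (U k) := fun k =>
    (φ k).hasCompactSupport_normed.contDiff_convolution_left _ ((φ k).contDiff_normed (n := 1)) hU
  have hconv : ∀ᵐ x, Tendsto (fun k => U k x) atTop (𝓝 (O.indicator u x)) :=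
    ContDiffBump.ae_convolution_tendsto_right_of_locallyIntegrable hφ (K := 2)
      (Eventually.of_forall fun k => by simp only [φ]; linarith) hU
  -- where the mollification only sees `O`; the factor `2` leaves room for the closed support
  let A : ℕ → Set (E n) := fun k => {x | Metric.ball x (2 * (φ k).rOut) ⊆ O}
  have hAm : ∀ k, MeasurableSet (A k) := fun k => (isClosed_setOf_ball_subset _ _).measurableSet
  have hAO : ∀ k, A k ⊆ O := fun k x hx =>
    hx (Metric.mem_ball_self (by have := (φ k).rOut_pos; positivity))
  have hAev : ∀ x ∈ O, ∀ᶠ k in atTop, x ∈ A k := by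
    intro x hx
    obtain ⟨ε, hε, hεO⟩ := Metric.isOpen_iff.1 hO x hx
    have : ∀ᶠ k in atTop, (φ k).rOut < ε / 2 := hφ.eventually (gt_mem_nhds (by positivity))
    filter_upwards [this] with k hk
    exact (Metric.ball_subset_ball (by linarith)).trans hεO
  let F : (E n → ℝ) → E n × E n → ℝ≥0∞ := fun f q =>
    ENNReal.ofReal (|f q.1 - f q.2| ^ 2 / ‖q.1 - q.2‖ ^ p)
  have hFm : ∀ f, Measurable f → Measurable (F f) := fun f hf => by
    refine Measurable.ennreal_ofReal (Measurable.div ?_ ?_)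
    · exact (((hf.comp measurable_fst).sub (hf.comp measurable_snd)).abs).pow_const 2
    · exact (measurable_fst.sub measurable_snd).norm.pow_const p
  let G : ℕ → E n × E n → ℝ≥0∞ := fun k => (A k ×ˢ A k).indicator (F (U k))
  have hGm : ∀ k, Measurable (G k) := fun k =>
    (hFm _ (hUd k).continuous.measurable).indicator ((hAm k).prod (hAm k))
  have hGint : ∀ k, ∫⁻ q, G k q ∂((volume.restrict O).prod (volume.restrict O)) ≤
      kernelMass n p * ∫⁻ y in O, N y ^ 2 := by
    intro k
    have h1 : ∫⁻ q, G k q ∂((volume.restrict O).prod (volume.restrict O)) =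
        ∫⁻ x in A k, ∫⁻ y in A k, ENNReal.ofReal (|U k x - U k y| ^ 2 / ‖x - y‖ ^ p) := by
      rw [lintegral_indicator ((hAm k).prod (hAm k)), Measure.prod_restrict, Measure.restrict_restrict
        ((hAm k).prod (hAm k)), prod_inter_prod, inter_eq_self_of_subset_left (hAO k),
        ← Measure.prod_restrict, lintegral_prod _ (hFm _ (hUd k).continuous.measurable).aemeasurable]
    rw [h1]
    refine (lintegral_slobodeckij_le_of_contDiff (hUd k) (convex_setOf_ball_subset hOc _) (hAm k)
      ((hAO k).trans hOb) p).trans (mul_le_mul' le_rfl ?_)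
    refine le_trans ?_ (lintegral_sq_lintegral_normed_le (A := A k) hO.measurableSet hN (φ k))
    refine setLIntegral_mono' (hAm k) fun x hx => ?_
    gcongr
    exact enorm_fderiv_convolution_le hO hu hw (φ k) hx
  have hlim : ∀ᵐ q ∂((volume.restrict O).prod (volume.restrict O)),
      F u q ≤ liminf (fun k => G k q) atTop := by
    have hm : ∀ᵐ x ∂(volume.restrict O), x ∈ O ∧ Tendsto (fun k => U k x) atTop (𝓝 (u x)) := by
      filter_upwards [ae_restrict_mem hO.measurableSet, ae_restrict_of_ae hconv] with x hx h
      rw [indicator_of_mem hx] at h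
      exact ⟨hx, h⟩
    filter_upwards [Measure.quasiMeasurePreserving_fst.ae hm,
      Measure.quasiMeasurePreserving_snd.ae hm] with q h1 h2
    have ht : Tendsto (fun k => G k q) atTop (𝓝 (F u q)) := by
      have : Tendsto (fun k => F (U k) q) atTop (𝓝 (F u q)) := by
        refine (ENNReal.continuous_ofReal.tendsto _).comp ?_
        exact (((h1.2.sub h2.2).abs).pow 2).div_const _
      refine this.congr' ?_
      filter_upwards [hAev _ h1.1, hAev _ h2.1] with k hk1 hk2
      exact (indicator_of_mem (show q ∈ A k ×ˢ A k from ⟨hk1, hk2⟩) (F (U k))).symm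
    exact ht.liminf_eq.ge
  calc _ = ∫⁻ q, F u q ∂((volume.restrict O).prod (volume.restrict O)) :=
        (lintegral_prod _ (hFm u hum).aemeasurable).symm
    _ ≤ ∫⁻ q, liminf (fun k => G k q) atTop ∂((volume.restrict O).prod (volume.restrict O)) :=
        lintegral_mono_ae hlim
    _ ≤ liminf (fun k => ∫⁻ q, G k q ∂((volume.restrict O).prod (volume.restrict O))) atTop :=
        lintegral_liminf_le hGm
    _ ≤ _ := by
        refine liminf_le_of_frequently_le' (Frequently.of_forall hGint)

/-! ### Bi-Lipschitz parametrizations and surface integrals -/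

/-- `Φ` is bi-Lipschitz with lower constant `a` and upper constant `b`. -/
structure IsBiLipschitz {n k : ℕ} (Φ : E n → E k) (a b : ℝ) : Prop where
  pos : 0 < a
  lower : ∀ x y, a * ‖x - y‖ ≤ ‖Φ x - Φ y‖
  upper : ∀ x y, ‖Φ x - Φ y‖ ≤ b * ‖x - y‖

namespace IsBiLipschitz

variable {n k : ℕ} {Φ : E n → E k} {a b : ℝ}

lemma lipschitzWith (h : IsBiLipschitz Φ a b) : LipschitzWith b.toNNReal Φ := by
  refine LipschitzWith.of_dist_le_mul fun x y => ?_
  rw [dist_eq_norm, dist_eq_norm]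
  exact (h.upper x y).trans (by gcongr; exact Real.le_coe_toNNReal b)

lemma antilipschitzWith (h : IsBiLipschitz Φ a b) : AntilipschitzWith (a⁻¹).toNNReal Φ := by
  refine AntilipschitzWith.of_le_mul_dist fun x y => ?_
  rw [dist_eq_norm, dist_eq_norm, Real.coe_toNNReal _ (inv_nonneg.2 h.pos.le), inv_mul_eq_div,
    le_div_iff₀ h.pos, mul_comm]
  exact h.lower x y

lemma measurable (h : IsBiLipschitz Φ a b) : Measurable Φ := h.lipschitzWith.continuous.measurable

lemma measure_image_le (h : IsBiLipschitz Φ a b) (A : Set (E n)) :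
    μHE[n] (Φ '' A) ≤ ENNReal.ofReal b ^ n * volume A := by
  rw [← EuclideanSpace.euclideanHausdorffMeasure_eq_volume, Measure.euclideanHausdorffMeasure_def,
    Measure.euclideanHausdorffMeasure_def, Measure.smul_apply, Measure.smul_apply,
    ENNReal.smul_def, ENNReal.smul_def, smul_eq_mul, smul_eq_mul, mul_left_comm]
  gcongr
  have := h.lipschitzWith.hausdorffMeasure_image_le (d := n) (by positivity) A
  rwa [ENNReal.rpow_natCast] at this

lemma volume_le (h : IsBiLipschitz Φ a b) (A : Set (E n)) :
    volume A ≤ ENNReal.ofReal a⁻¹ ^ n * μHE[n] (Φ '' A) := by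
  rw [← EuclideanSpace.euclideanHausdorffMeasure_eq_volume, Measure.euclideanHausdorffMeasure_def,
    Measure.euclideanHausdorffMeasure_def, Measure.smul_apply, Measure.smul_apply,
    ENNReal.smul_def, ENNReal.smul_def, smul_eq_mul, smul_eq_mul, mul_left_comm]
  gcongr
  have := h.antilipschitzWith.le_hausdorffMeasure_image (d := n) (by positivity) A
  rwa [ENNReal.rpow_natCast] at this

lemma lintegral_image_le (h : IsBiLipschitz Φ a b) {A : Set (E n)}
    {f : E k → ℝ≥0∞} (hf : Measurable f) :
    ∫⁻ y in Φ '' A, f y ∂μHE[n] ≤ ENNReal.ofReal b ^ n * ∫⁻ x in A, f (Φ x) := by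
  have hm : (μHE[n] : Measure (E k)).restrict (Φ '' A) ≤
      (ENNReal.ofReal b ^ n) • (volume.restrict A).map Φ := by
    refine Measure.le_iff.2 fun s hs => ?_
    rw [Measure.restrict_apply hs, Measure.smul_apply, Measure.map_apply h.measurable hs,
      Measure.restrict_apply (h.measurable hs), smul_eq_mul, inter_comm,
      ← image_inter_preimage, inter_comm]
    exact h.measure_image_le _
  refine (lintegral_mono' hm le_rfl).trans ?_
  rw [lintegral_smul_measure, lintegral_map hf h.measurable, smul_eq_mul]

lemma lintegral_comp_le (h : IsBiLipschitz Φ a b) {A : Set (E n)}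
    {f : E k → ℝ≥0∞} (hf : Measurable f) :
    ∫⁻ x in A, f (Φ x) ≤ ENNReal.ofReal a⁻¹ ^ n * ∫⁻ y in Φ '' A, f y ∂μHE[n] := by
  have hm : (volume.restrict A).map Φ ≤
      (ENNReal.ofReal a⁻¹ ^ n) • (μHE[n] : Measure (E k)).restrict (Φ '' A) := by
    refine Measure.le_iff.2 fun s hs => ?_
    rw [Measure.smul_apply, Measure.map_apply h.measurable hs,
      Measure.restrict_apply (h.measurable hs), Measure.restrict_apply hs, smul_eq_mul,
      inter_comm s, ← image_inter_preimage, inter_comm A]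
    exact h.volume_le _
  rw [← lintegral_map hf h.measurable]
  refine (lintegral_mono' hm le_rfl).trans ?_
  rw [lintegral_smul_measure, smul_eq_mul]

lemma ae_comp (h : IsBiLipschitz Φ a b) {A : Set (E n)} {S : Set (E k)} (hA : MeasurableSet A)
    (hAS : MapsTo Φ A S) {P : E k → Prop} (hP : ∀ᵐ y ∂((μHE[n] : Measure (E k)).restrict S), P y) :
    ∀ᵐ x ∂(volume.restrict A), P (Φ x) := by
  rw [ae_iff] at hP ⊢
  have h1 : (μHE[n] : Measure (E k)) ({y | ¬ P y} ∩ S) = 0 :=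
    le_antisymm ((Measure.le_restrict_apply _ _).trans hP.le) zero_le
  rw [Measure.restrict_apply' hA]
  refine le_antisymm ((h.volume_le _).trans ?_) zero_le
  have : Φ '' ({x | ¬ P (Φ x)} ∩ A) ⊆ {y | ¬ P y} ∩ S := by
    rintro _ ⟨x, ⟨hx, hxA⟩, rfl⟩
    exact ⟨hx, hAS hxA⟩
  rw [measure_mono_null this h1, mul_zero]

lemma upper_nonneg (h : IsBiLipschitz Φ a b) (hn : 1 ≤ n) : 0 < b := by
  have : Nontrivial (E n) := Module.nontrivial_of_finrank_pos (R := ℝ) (by simpa using Nat.lt_of_lt_of_le one_pos hn)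
  obtain ⟨x, hx⟩ := exists_ne (0 : E n)
  have h1 := h.lower x 0
  have h2 := h.upper x 0
  have h3 : 0 < ‖x - 0‖ := by simpa using hx
  have h4 : 0 < a * ‖x - 0‖ := mul_pos h.pos h3
  exact pos_of_mul_pos_left (h4.trans_le (h1.trans h2)) h3.le

end IsBiLipschitz

/-- The double integral of the Sobolev–Slobodeckij kernel with exponent `p` over `A × B`, where
`A` and `B` are `n`-dimensional subsets of `ℝᵏ`. -/
noncomputable def slobodeckijIntegral {k : ℕ} (n : ℕ) (p : ℝ) (v : E k → ℝ) (A B : Set (E k)) :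
    ℝ≥0∞ :=
  ∫⁻ x in A, ∫⁻ y in B, ENNReal.ofReal (|v x - v y| ^ 2 / ‖x - y‖ ^ p) ∂μHE[n] ∂μHE[n]

lemma measurable_slobodeckij {k : ℕ} {α : Type*} [MeasurableSpace α] {v w : E k → ℝ}
    (hv : Measurable v) (hw : Measurable w) {f g : α → E k} (hf : Measurable f) (hg : Measurable g)
    (p : ℝ) : Measurable fun q => ENNReal.ofReal (|v (f q) - w (g q)| ^ 2 / ‖f q - g q‖ ^ p) := by
  refine Measurable.ennreal_ofReal (Measurable.div ?_ ?_)
  · exact (((hv.comp hf).sub (hw.comp hg)).abs).pow_const 2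
  · exact (hf.sub hg).norm.pow_const p

lemma slobodeckijIntegral_image_le {n k : ℕ} {Φ Ψ : E n → E k} {a b : ℝ}
    (hΦ : IsBiLipschitz Φ a b) (hΨ : IsBiLipschitz Ψ a b) {A B : Set (E n)}
    {v : E k → ℝ} (hv : Measurable v) (p : ℝ) :
    slobodeckijIntegral n p v (Φ '' A) (Ψ '' B) ≤ ENNReal.ofReal b ^ (2 * n) *
      ∫⁻ x in A, ∫⁻ y in B, ENNReal.ofReal (|v (Φ x) - v (Ψ y)| ^ 2 / ‖Φ x - Ψ y‖ ^ p) := by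
  have h1 : Measurable fun x => ∫⁻ y in B, ENNReal.ofReal (|v x - v (Ψ y)| ^ 2 / ‖x - Ψ y‖ ^ p) :=
    (measurable_slobodeckij hv hv measurable_fst (hΨ.measurable.comp measurable_snd)
      p).lintegral_prod_right'
  calc _ ≤ ∫⁻ x in Φ '' A, (ENNReal.ofReal b ^ n *
        ∫⁻ y in B, ENNReal.ofReal (|v x - v (Ψ y)| ^ 2 / ‖x - Ψ y‖ ^ p)) ∂μHE[n] := by
        refine lintegral_mono fun x => ?_
        exact hΨ.lintegral_image_le
          (measurable_slobodeckij hv hv measurable_const measurable_id p)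
    _ ≤ _ := by
        rw [lintegral_const_mul _ h1, two_mul, pow_add, mul_assoc]
        gcongr
        exact hΦ.lintegral_image_le h1

lemma isFiniteMeasure_restrict_image {n k : ℕ} {Φ : E n → E k} {a b : ℝ}
    (hΦ : IsBiLipschitz Φ a b) {A : Set (E n)} (hA : volume A ≠ ∞) :
    IsFiniteMeasure ((μHE[n] : Measure (E k)).restrict (Φ '' A)) := by
  refine ⟨?_⟩
  rw [Measure.restrict_apply_univ]
  exact (hΦ.measure_image_le A).trans_lt
    (ENNReal.mul_lt_top (ENNReal.pow_lt_top ENNReal.ofReal_lt_top) hA.lt_top)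

lemma le_slobodeckijIntegral_image {n k : ℕ} {Φ Ψ : E n → E k} {a b : ℝ}
    (hΦ : IsBiLipschitz Φ a b) (hΨ : IsBiLipschitz Ψ a b) {A B : Set (E n)}
    (hBf : volume B ≠ ∞) {v : E k → ℝ} (hv : Measurable v) (p : ℝ) :
    ∫⁻ x in A, ∫⁻ y in B, ENNReal.ofReal (|v (Φ x) - v (Ψ y)| ^ 2 / ‖Φ x - Ψ y‖ ^ p) ≤
      ENNReal.ofReal a⁻¹ ^ (2 * n) * slobodeckijIntegral n p v (Φ '' A) (Ψ '' B) := by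
  have := isFiniteMeasure_restrict_image hΨ hBf
  have h1 : Measurable fun x =>
      ∫⁻ y in Ψ '' B, ENNReal.ofReal (|v x - v y| ^ 2 / ‖x - y‖ ^ p) ∂μHE[n] :=
    (measurable_slobodeckij hv hv measurable_fst measurable_snd p).lintegral_prod_right'
  calc _ ≤ ∫⁻ x in A, ENNReal.ofReal a⁻¹ ^ n * ∫⁻ y in Ψ '' B,
        ENNReal.ofReal (|v (Φ x) - v y| ^ 2 / ‖Φ x - y‖ ^ p) ∂μHE[n] := by
        refine lintegral_mono fun x => ?_
        exact hΨ.lintegral_comp_le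
          (f := fun y => ENNReal.ofReal (|v (Φ x) - v y| ^ 2 / ‖Φ x - y‖ ^ p))
          (measurable_slobodeckij hv hv measurable_const measurable_id p)
    _ ≤ _ := by
        have h2 : Measurable fun x =>
            ∫⁻ y in Ψ '' B, ENNReal.ofReal (|v (Φ x) - v y| ^ 2 / ‖Φ x - y‖ ^ p) ∂μHE[n] :=
          h1.comp hΦ.measurable
        rw [lintegral_const_mul _ h2, two_mul, pow_add, mul_assoc]
        gcongr
        exact hΦ.lintegral_comp_le h1

lemma slobodeckijIntegral_mono {k n : ℕ} {p : ℝ} {v : E k → ℝ} {A A' B B' : Set (E k)}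
    (hA : A ⊆ A') (hB : B ⊆ B') :
    slobodeckijIntegral n p v A B ≤ slobodeckijIntegral n p v A' B' :=
  (lintegral_mono_set hA).trans (lintegral_mono fun _ => lintegral_mono_set hB)

lemma slobodeckijIntegral_biUnion_le {k n : ℕ} {p : ℝ} {v : E k → ℝ} (hv : Measurable v)
    {ι : Type*} (I : Finset ι) (T : ι → Set (E k))
    (hT : ∀ i ∈ I, IsFiniteMeasure ((μHE[n] : Measure (E k)).restrict (T i))) :
    slobodeckijIntegral n p v (⋃ i ∈ I, T i) (⋃ i ∈ I, T i) ≤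
      ∑ i ∈ I, ∑ j ∈ I, slobodeckijIntegral n p v (T i) (T j) := by
  have hu : ∀ f : E k → ℝ≥0∞, ∫⁻ x in ⋃ i ∈ I, T i, f x ∂μHE[n] ≤
      ∑ i ∈ I, ∫⁻ x in T i, f x ∂μHE[n] := by
    intro f
    classical
    induction I using Finset.induction_on with
    | empty => simp
    | insert i I hi ih =>
      rw [Finset.set_biUnion_insert, Finset.sum_insert hi]
      exact (lintegral_union_le _ _ _).trans
        (by gcongr; exact ih fun j hj => hT j (Finset.mem_insert_of_mem hj))
  refine (hu _).trans (Finset.sum_le_sum fun i hi => ?_)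
  refine (lintegral_mono fun x => hu _).trans ?_
  rw [lintegral_finsetSum']
  · rfl
  · intro j hj
    have := hT j hj
    exact Measurable.aemeasurable
      (measurable_slobodeckij hv hv measurable_fst measurable_snd p).lintegral_prod_right'

lemma slobodeckij_kernel_le {r t q p : ℝ} (hp : 0 ≤ p) (hr : 0 ≤ r) {c : ℝ} (hc : 0 < c)
    (h : c * t ≤ r) (h0 : r = 0 → q = 0) (ht : 0 ≤ t) (h1 : t = 0 → q = 0) :
    ENNReal.ofReal (q ^ 2 / r ^ p) ≤
      ENNReal.ofReal ((c ^ p)⁻¹) * ENNReal.ofReal (q ^ 2 / t ^ p) := by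
  rcases hr.eq_or_lt with hr | hr
  · rw [h0 hr.symm]; simp
  rcases ht.eq_or_lt with ht | ht
  · rw [h1 ht.symm]; simp
  rw [← ENNReal.ofReal_mul (by positivity)]
  apply ENNReal.ofReal_le_ofReal
  have h2 : c ^ p * t ^ p ≤ r ^ p := by
    rw [← Real.mul_rpow hc.le ht.le]
    exact Real.rpow_le_rpow (by positivity) h hp
  calc q ^ 2 / r ^ p ≤ q ^ 2 / (c ^ p * t ^ p) := by
        have : 0 < c ^ p := by positivity
        have : 0 < t ^ p := by positivity
        gcongr
    _ = _ := by field_simp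

/-- The Sobolev–Slobodeckij integral over the image of a convex domain under a bi-Lipschitz chart of
the surface `S` is controlled by the surface gradient. -/
lemma slobodeckijIntegral_chart_le {d : ℕ} {S : Set (E d)} {v : E d → ℝ} {g : E d → E d}
    (hvg : MemH1WithGradient S v g) {v' : E d → ℝ} (hv' : Measurable v')
    (hv : v =ᵐ[(surfaceMeasure d).restrict S] v') {g' : E d → E d} (hg' : Measurable g')
    (hg : g =ᵐ[(surfaceMeasure d).restrict S] g') {Φ : E (d - 1) → E d} {a b : ℝ}
    (hΦ : IsBiLipschitz Φ a b) {D : Set (E (d - 1))} (hD : IsOpen D) (hDc : Convex ℝ D)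
    (hDb : D ⊆ Metric.ball 0 2) (hDS : MapsTo Φ D S) (hd : 1 ≤ d - 1) {A : Set (E d)}
    (hA : A ⊆ Φ '' closure D) {p : ℝ} (hp : 0 ≤ p) :
    slobodeckijIntegral (d - 1) p v' A A ≤ ENNReal.ofReal b ^ (2 * (d - 1)) *
      (ENNReal.ofReal ((a ^ p)⁻¹) * (kernelMass (d - 1) p * (ENNReal.ofReal b ^ 2 *
        (ENNReal.ofReal a⁻¹ ^ (d - 1) * ∫⁻ y in S, ‖g' y‖ₑ ^ 2 ∂(surfaceMeasure d))))) := by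
  have hb : 0 < b := hΦ.upper_nonneg hd
  have hDm : MeasurableSet D := hD.measurableSet
  have hv2 : ∀ᵐ x ∂(volume.restrict D), v (Φ x) = v' (Φ x) := hΦ.ae_comp hDm hDS hv
  have hg2 : ∀ᵐ x ∂(volume.restrict D), g (Φ x) = g' (Φ x) := hΦ.ae_comp hDm hDS hg
  have hDf : volume D < ∞ := (measure_mono hDb).trans_lt measure_ball_lt_top
  have hcomp : ∀ f : E d → ℝ≥0∞, Measurable f → ∫⁻ x in D, f (Φ x) ≤
      ENNReal.ofReal a⁻¹ ^ (d - 1) * ∫⁻ y in S, f y ∂(surfaceMeasure d) := fun f hf =>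
    (hΦ.lintegral_comp_le hf).trans (by
      gcongr
      · exact hDS.image_subset
      · exact le_rfl)
  set u : E (d - 1) → ℝ := fun x => v' (Φ x) with hu
  have hum : Measurable u := hv'.comp hΦ.measurable
  have hui : IntegrableOn u D := by
    have : IsFiniteMeasure (volume.restrict D) := ⟨by simpa using hDf⟩
    have h2 : MemLp u 2 (volume.restrict D) := by
      refine ⟨hum.aestronglyMeasurable, ?_⟩
      have h3 := ((memLp_congr_ae hv).1 hvg.memLp).2
      rw [eLpNorm_lt_top_iff_lintegral_rpow_enorm_lt_top two_ne_zero ENNReal.ofNat_ne_top] at h3 ⊢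
      simp only [ENNReal.toReal_ofNat, ENNReal.rpow_ofNat] at h3 ⊢
      exact (hcomp _ (hv'.enorm.pow_const 2)).trans_lt
        (ENNReal.mul_lt_top (ENNReal.pow_lt_top ENNReal.ofReal_lt_top) h3)
    exact h2.integrable (by norm_num)
  set N : E (d - 1) → ℝ≥0∞ := fun x => ENNReal.ofReal b * ‖g' (Φ x)‖ₑ with hN
  have hNm : Measurable N := ((hg'.comp hΦ.measurable).enorm).const_mul _
  have hchart : IsBiLipschitzChart S D Φ :=
    ⟨hD, hDS, a, hΦ.pos, b, hb, fun x _ y _ => ⟨hΦ.lower x y, hΦ.upper x y⟩⟩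
  have hweak : ∀ η : E (d - 1) → ℝ, ContDiff ℝ (⊤ : ℕ∞) η → HasCompactSupport η → tsupport η ⊆ D →
      ∀ w, ‖∫ y in D, u y * fderiv ℝ η y w‖ₑ ≤ ‖w‖ₑ * ∫⁻ y in D, N y * ‖η y‖ₑ := by
    intro η h1 h2 h3 w
    have h4 := (hvg.hasGradient D Φ hchart).2 η h1 h2 h3 w
    have h5 : ∫ y in D, u y * fderiv ℝ η y w = ∫ y in D, v (Φ y) * fderiv ℝ η y w := by
      refine integral_congr_ae ?_
      filter_upwards [hv2] with y hy
      rw [hy]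
    rw [h5, h4, enorm_neg]
    refine (enorm_integral_le_lintegral_enorm _).trans ?_
    have hNη : Measurable fun y => N y * ‖η y‖ₑ := hNm.mul h1.continuous.enorm.measurable
    rw [← lintegral_const_mul _ hNη]
    refine lintegral_mono_ae ?_
    filter_upwards [hg2] with y hy
    rw [hy, enorm_mul, hN]
    have h6 : ‖fderiv ℝ Φ y w‖ₑ ≤ ENNReal.ofReal b * ‖w‖ₑ := by
      have h7 : ‖fderiv ℝ Φ y‖ₑ ≤ ENNReal.ofReal b := by
        rw [← ofReal_norm]
        apply ENNReal.ofReal_le_ofReal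
        have := norm_fderiv_le_of_lipschitz ℝ hΦ.lipschitzWith (x₀ := y)
        rwa [Real.coe_toNNReal _ hb.le] at this
      exact (ContinuousLinearMap.le_opENorm _ _).trans (by gcongr)
    have h8 : ‖inner ℝ (g' (Φ y)) (fderiv ℝ Φ y w)‖ₑ ≤ ‖g' (Φ y)‖ₑ * ‖fderiv ℝ Φ y w‖ₑ := by
      rw [← ofReal_norm, ← ofReal_norm, ← ofReal_norm, ← ENNReal.ofReal_mul (norm_nonneg _)]
      exact ENNReal.ofReal_le_ofReal (norm_inner_le_norm _ _)
    calc _ ≤ ‖g' (Φ y)‖ₑ * (ENNReal.ofReal b * ‖w‖ₑ) * ‖η y‖ₑ := by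
          gcongr
          exact h8.trans (by gcongr)
      _ = _ := by ring
  have hmain := lintegral_slobodeckij_le_of_weak hD hDc hDb hum hui hNm hweak p
  -- the boundary of a convex set is a null set
  have hcl : closure D =ᵐ[volume] D := by
    refine Filter.EventuallyLE.antisymm ?_ (LE.le.eventuallyLE (subset_closure (s := D)))
    rw [ae_le_set]
    refine measure_mono_null ?_ (hDc.addHaar_frontier volume)
    intro x hx
    exact ⟨hx.1, fun h => hx.2 (interior_subset h)⟩
  have hN2 : ∫⁻ y in D, N y ^ 2 ≤ ENNReal.ofReal b ^ 2 *
      (ENNReal.ofReal a⁻¹ ^ (d - 1) * ∫⁻ y in S, ‖g' y‖ₑ ^ 2 ∂(surfaceMeasure d)) := by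
    simp_rw [hN, mul_pow]
    rw [lintegral_const_mul' _ _ (ENNReal.pow_ne_top ENNReal.ofReal_ne_top)]
    gcongr
    exact hcomp _ (hg'.enorm.pow_const 2)
  refine (slobodeckijIntegral_mono hA hA).trans ?_
  refine (slobodeckijIntegral_image_le hΦ hΦ hv' p).trans (mul_le_mul' le_rfl ?_)
  rw [Measure.restrict_congr_set hcl]
  calc _ ≤ ∫⁻ x in D, ENNReal.ofReal ((a ^ p)⁻¹) * ∫⁻ y in D,
        ENNReal.ofReal (|u x - u y| ^ 2 / ‖x - y‖ ^ p) := by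
        refine lintegral_mono fun x => ?_
        rw [← lintegral_const_mul' _ _ ENNReal.ofReal_ne_top]
        refine lintegral_mono fun y => ?_
        refine slobodeckij_kernel_le hp (norm_nonneg _) hΦ.pos (hΦ.lower x y) ?_ (norm_nonneg _) ?_
        · intro h
          rw [norm_eq_zero, sub_eq_zero] at h
          simp [h]
        · intro h
          rw [norm_eq_zero, sub_eq_zero] at h
          simp [h]
    _ ≤ _ := by
        rw [lintegral_const_mul' _ _ ENNReal.ofReal_ne_top]
        exact mul_le_mul' le_rfl (hmain.trans (mul_le_mul' le_rfl hN2))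

lemma isBiLipschitz_midpoint {n : ℕ} (x : E n) :
    IsBiLipschitz (fun y : E n => (1 / 2 : ℝ) • (x + y)) (1 / 2) (1 / 2) := by
  have h : ∀ y z : E n, ‖(1 / 2 : ℝ) • (x + y) - (1 / 2 : ℝ) • (x + z)‖ = 1 / 2 * ‖y - z‖ := by
    intro y z
    rw [← smul_sub, norm_smul, add_sub_add_left_eq_sub]
    norm_num
  exact ⟨by norm_num, fun y z => (h y z).ge, fun y z => (h y z).le⟩

lemma setLIntegral_midpoint_le {n : ℕ} {Δ : Set (E n)} (hΔ : Convex ℝ Δ) {x : E n} (hx : x ∈ Δ)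
    {f : E n → ℝ≥0∞} (hf : Measurable f) :
    ∫⁻ y in Δ, f ((1 / 2 : ℝ) • (x + y)) ≤ 2 ^ n * ∫⁻ y in Δ, f y := by
  refine ((isBiLipschitz_midpoint x).lintegral_comp_le hf).trans ?_
  rw [EuclideanSpace.euclideanHausdorffMeasure_eq_volume]
  gcongr
  · norm_num
  · rintro _ ⟨y, hy, rfl⟩
    simp only [smul_add]
    exact hΔ hx hy (by norm_num) (by norm_num) (by norm_num)

lemma sq_sub_div_le (a b m : ℝ) {r : ℝ} (hr : 0 ≤ r) :
    ENNReal.ofReal (|a - b| ^ 2 / r) ≤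
      2 * ENNReal.ofReal (|a - m| ^ 2 / r) + 2 * ENNReal.ofReal (|b - m| ^ 2 / r) := by
  have h2 : (2 : ℝ≥0∞) = ENNReal.ofReal 2 := by simp
  rw [h2, ← ENNReal.ofReal_mul (by norm_num), ← ENNReal.ofReal_mul (by norm_num),
    ← ENNReal.ofReal_add (by positivity) (by positivity)]
  apply ENNReal.ofReal_le_ofReal
  rw [← mul_div_assoc, ← mul_div_assoc, ← add_div]
  gcongr
  simp only [sq_abs]
  nlinarith [sq_nonneg (a - m + (b - m))]

/-- Half of the chaining estimate: the values of `v` on `Φ '' Δ` are compared with its values at the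
midpoints of the reference coordinates, transported to `Ψ '' Δ`. -/
lemma lintegral_midpoint_le {n k : ℕ} {Φ Ψ : E n → E k} {a b : ℝ} (hn : 1 ≤ n)
    (hΦ : IsBiLipschitz Φ a b) (hΨ : IsBiLipschitz Ψ a b) (h0 : Φ 0 = Ψ 0) {Δ : Set (E n)}
    (hΔ : Convex ℝ Δ) (hΔm : MeasurableSet Δ) (hΔf : volume Δ ≠ ∞) {v : E k → ℝ}
    (hv : Measurable v) {p : ℝ} (hp : 0 ≤ p) :
    ∫⁻ x in Δ, ∫⁻ y in Δ, ENNReal.ofReal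
        (|v (Φ x) - v (Ψ ((1 / 2 : ℝ) • (x + y)))| ^ 2 / (‖x‖ + ‖y‖) ^ p) ≤
      ENNReal.ofReal ((2 * b) ^ p) * 2 ^ n * ENNReal.ofReal a⁻¹ ^ (2 * n) *
        slobodeckijIntegral n p v (Φ '' Δ) (Ψ '' Δ) := by
  have hb : 0 < b := hΦ.upper_nonneg hn
  have hpt : ∀ x y : E n, ENNReal.ofReal
      (|v (Φ x) - v (Ψ ((1 / 2 : ℝ) • (x + y)))| ^ 2 / (‖x‖ + ‖y‖) ^ p) ≤
      ENNReal.ofReal ((2 * b) ^ p) * ENNReal.ofReal (|v (Φ x) - v (Ψ ((1 / 2 : ℝ) • (x + y)))| ^ 2 /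
        ‖Φ x - Ψ ((1 / 2 : ℝ) • (x + y))‖ ^ p) := by
    intro x y
    set m := (1 / 2 : ℝ) • (x + y) with hmdef
    have hmn : ‖m‖ ≤ (‖x‖ + ‖y‖) / 2 := by
      rw [hmdef, norm_smul]
      have := norm_add_le x y
      norm_num
      linarith
    have h1 : ‖Φ x - Ψ m‖ ≤ b * (‖x‖ + ‖m‖) := by
      have h2 := hΦ.upper x 0
      have h3 := hΨ.upper 0 m
      rw [sub_zero] at h2
      rw [zero_sub, norm_neg, ← h0] at h3
      have := norm_sub_le_norm_sub_add_norm_sub (Φ x) (Φ 0) (Ψ m)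
      linarith
    have h2 : (2 * b)⁻¹ * ‖Φ x - Ψ m‖ ≤ ‖x‖ + ‖y‖ := by
      rw [inv_mul_le_iff₀ (by positivity)]
      refine h1.trans ?_
      have : ‖x‖ + ‖m‖ ≤ 2 * (‖x‖ + ‖y‖) := by linarith [norm_nonneg x, norm_nonneg y]
      nlinarith
    have h3 := slobodeckij_kernel_le (q := |v (Φ x) - v (Ψ m)|) hp
      (add_nonneg (norm_nonneg x) (norm_nonneg y)) (inv_pos.2 (by positivity)) h2 ?_ (norm_nonneg _) ?_
    · rwa [Real.inv_rpow (by positivity), inv_inv] at h3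
    · intro h
      have hx : x = 0 := norm_eq_zero.1 (by linarith [norm_nonneg x, norm_nonneg y])
      have hy : y = 0 := norm_eq_zero.1 (by linarith [norm_nonneg x, norm_nonneg y])
      simp [hmdef, hx, hy, h0]
    · intro h
      rw [norm_eq_zero, sub_eq_zero] at h
      simp [h]
  calc _ ≤ ∫⁻ x in Δ, ENNReal.ofReal ((2 * b) ^ p) * (2 ^ n * ∫⁻ y in Δ, ENNReal.ofReal
        (|v (Φ x) - v (Ψ y)| ^ 2 / ‖Φ x - Ψ y‖ ^ p)) := by
        refine setLIntegral_mono' hΔm fun x hx => ?_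
        refine (lintegral_mono fun y => hpt x y).trans ?_
        rw [lintegral_const_mul' _ _ ENNReal.ofReal_ne_top]
        refine mul_le_mul' le_rfl ?_
        exact setLIntegral_midpoint_le hΔ hx (f := fun y => ENNReal.ofReal
          (|v (Φ x) - v (Ψ y)| ^ 2 / ‖Φ x - Ψ y‖ ^ p)) (measurable_slobodeckij hv hv measurable_const hΨ.measurable p)
    _ ≤ _ := by
        rw [lintegral_const_mul' _ _ ENNReal.ofReal_ne_top,
          lintegral_const_mul' _ _ (ENNReal.pow_ne_top ENNReal.ofNat_ne_top), mul_assoc, mul_assoc]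
        gcongr
        exact le_slobodeckijIntegral_image hΦ hΨ hΔf hv p

lemma lintegral_add_swap {n : ℕ} {Δ : Set (E n)} {F G : E n × E n → ℝ≥0∞} (hF : Measurable F)
    (hG : Measurable G) {c : ℝ≥0∞} (hc : c ≠ ∞) :
    ∫⁻ x in Δ, ∫⁻ y in Δ, c * (2 * F (x, y) + 2 * G (y, x)) =
      c * (2 * ((∫⁻ x in Δ, ∫⁻ y in Δ, F (x, y)) + ∫⁻ x in Δ, ∫⁻ y in Δ, G (x, y))) := by
  have h1 : Measurable fun x => ∫⁻ y in Δ, F (x, y) := hF.lintegral_prod_right'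
  have h2 : ∀ x, Measurable fun y => F (x, y) := fun x => hF.comp measurable_prodMk_left
  rw [lintegral_lintegral_swap (f := fun x y => G (x, y)) hG.aemeasurable, ← lintegral_add_left h1,
    ← lintegral_const_mul' _ _ ENNReal.ofNat_ne_top, ← lintegral_const_mul' _ _ hc]
  refine lintegral_congr fun x => ?_
  rw [← lintegral_add_left (h2 x), ← lintegral_const_mul' _ _ ENNReal.ofNat_ne_top,
    ← lintegral_const_mul' _ _ hc]
  refine lintegral_congr fun y => ?_
  rw [mul_add 2]

/-- The chaining estimate: if two elements `Φ '' Δ` and `Ψ '' Δ` meet in the node `Φ 0` only, under a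
positive angle, then the interaction between them is controlled by their interactions with a third
element `Θ '' Δ` at this node. For this, `v (Φ x)` and `v (Ψ y)` are compared with the value of `v` at
the point of the third element with reference coordinates `(x + y) / 2`, whose distance to the node is
at most of the order `‖x‖ + ‖y‖`. -/
lemma slobodeckijIntegral_chain_le {n k : ℕ} {Φ Ψ Θ : E n → E k} {a b c : ℝ} (hn : 1 ≤ n)
    (hΦ : IsBiLipschitz Φ a b) (hΨ : IsBiLipschitz Ψ a b) (hΘ : IsBiLipschitz Θ a b)
    (h1 : Φ 0 = Θ 0) (h2 : Ψ 0 = Θ 0) {Δ : Set (E n)} (hΔ : Convex ℝ Δ) (hΔm : MeasurableSet Δ)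
    (hΔf : volume Δ ≠ ∞) {v : E k → ℝ} (hv : Measurable v) {p : ℝ} (hp : 0 ≤ p) (hc : 0 < c)
    (hsep : ∀ x ∈ Δ, ∀ y ∈ Δ, c * (‖Φ x - Φ 0‖ + ‖Ψ y - Ψ 0‖) ≤ ‖Φ x - Ψ y‖) :
    slobodeckijIntegral n p v (Φ '' Δ) (Ψ '' Δ) ≤
      ENNReal.ofReal b ^ (2 * n) * (ENNReal.ofReal (((c * a) ^ p)⁻¹) * (2 *
        (ENNReal.ofReal ((2 * b) ^ p) * 2 ^ n * ENNReal.ofReal a⁻¹ ^ (2 * n)))) *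
      (slobodeckijIntegral n p v (Φ '' Δ) (Θ '' Δ) +
        slobodeckijIntegral n p v (Ψ '' Δ) (Θ '' Δ)) := by
  have ha := hΦ.pos
  have hmid : Measurable fun q : E n × E n => Θ ((1 / 2 : ℝ) • (q.1 + q.2)) :=
    hΘ.measurable.comp (by fun_prop)
  have hm : ∀ {f : E n × E n → E k}, Measurable f → Measurable fun q : E n × E n => ENNReal.ofReal
      (|v (f q) - v (Θ ((1 / 2 : ℝ) • (q.1 + q.2)))| ^ 2 / (‖q.1‖ + ‖q.2‖) ^ p) := by
    intro f hf
    refine Measurable.ennreal_ofReal (Measurable.div ?_ ?_)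
    · exact (((hv.comp hf).sub (hv.comp hmid)).abs).pow_const 2
    · exact ((measurable_fst.norm).add (measurable_snd.norm)).pow_const p
  let F : E n × E n → ℝ≥0∞ := fun q => ENNReal.ofReal
    (|v (Φ q.1) - v (Θ ((1 / 2 : ℝ) • (q.1 + q.2)))| ^ 2 / (‖q.1‖ + ‖q.2‖) ^ p)
  let G : E n × E n → ℝ≥0∞ := fun q => ENNReal.ofReal
    (|v (Ψ q.1) - v (Θ ((1 / 2 : ℝ) • (q.1 + q.2)))| ^ 2 / (‖q.1‖ + ‖q.2‖) ^ p)
  have hF : Measurable F := hm (f := fun q => Φ q.1) (hΦ.measurable.comp measurable_fst)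
  have hG : Measurable G := hm (f := fun q => Ψ q.1) (hΨ.measurable.comp measurable_fst)
  refine (slobodeckijIntegral_image_le hΦ hΨ hv p).trans ?_
  rw [mul_assoc]
  refine mul_le_mul' le_rfl ?_
  calc _ ≤ ∫⁻ x in Δ, ∫⁻ y in Δ, ENNReal.ofReal (((c * a) ^ p)⁻¹) *
        (2 * F (x, y) + 2 * G (y, x)) := by
        refine setLIntegral_mono' hΔm fun x hx => setLIntegral_mono' hΔm fun y hy => ?_
        have hG' : G (y, x) = ENNReal.ofReal
            (|v (Ψ y) - v (Θ ((1 / 2 : ℝ) • (x + y)))| ^ 2 / (‖x‖ + ‖y‖) ^ p) := by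
          simp only [G, add_comm y x, add_comm ‖y‖ ‖x‖]
        rw [hG']
        refine le_trans ?_ (mul_le_mul' le_rfl (sq_sub_div_le _ _ _ (by positivity)))
        refine slobodeckij_kernel_le hp (norm_nonneg _) (by positivity) ?_ ?_ (by positivity) ?_
        · refine le_trans ?_ (hsep x hx y hy)
          have h3 := hΦ.lower x 0
          have h4 := hΨ.lower y 0
          rw [sub_zero] at h3 h4
          rw [mul_assoc, mul_add]
          gcongr
        · intro h
          rw [norm_eq_zero, sub_eq_zero] at h
          simp [h]
        · intro h
          have hx : x = 0 := norm_eq_zero.1 (by linarith [norm_nonneg x, norm_nonneg y])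
          have hy : y = 0 := norm_eq_zero.1 (by linarith [norm_nonneg x, norm_nonneg y])
          simp [hx, hy, h1, h2]
    _ = ENNReal.ofReal (((c * a) ^ p)⁻¹) * (2 *
        ((∫⁻ x in Δ, ∫⁻ y in Δ, F (x, y)) + ∫⁻ x in Δ, ∫⁻ y in Δ, G (x, y))) :=
        lintegral_add_swap hF hG ENNReal.ofReal_ne_top
    _ ≤ _ := by
        rw [mul_assoc, mul_assoc]
        refine mul_le_mul' le_rfl (mul_le_mul' le_rfl ?_)
        rw [mul_add]
        exact add_le_add (lintegral_midpoint_le hn hΦ hΘ h1 hΔ hΔm hΔf hv hp)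
          (lintegral_midpoint_le hn hΨ hΘ h2 hΔ hΔm hΔf hv hp)

/-! ### Patches of parametrized elements -/

lemma chain_constant_eq {n : ℕ} {a b c H p : ℝ} (ha : 0 < a) (hb : 0 < b) (hc : 0 < c) (hH : 0 < H) :
    ENNReal.ofReal (b * H) ^ (2 * n) * (ENNReal.ofReal (((c * (a * H)) ^ p)⁻¹) * (2 *
        (ENNReal.ofReal ((2 * (b * H)) ^ p) * 2 ^ n * ENNReal.ofReal (a * H)⁻¹ ^ (2 * n)))) =
      ENNReal.ofReal (b ^ (2 * n) * ((c * a) ^ p)⁻¹ * 2 * (2 * b) ^ p * 2 ^ n * a⁻¹ ^ (2 * n)) := by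
  have h2 : (2 : ℝ≥0∞) = ENNReal.ofReal 2 := by simp
  rw [h2]
  simp only [← ENNReal.ofReal_pow (show 0 ≤ b * H by positivity),
    ← ENNReal.ofReal_pow (show 0 ≤ (a * H)⁻¹ by positivity),
    ← ENNReal.ofReal_pow (show (0 : ℝ) ≤ 2 by norm_num)]
  rw [← ENNReal.ofReal_mul (by positivity), ← ENNReal.ofReal_mul (by positivity),
    ← ENNReal.ofReal_mul (by positivity), ← ENNReal.ofReal_mul (by positivity),
    ← ENNReal.ofReal_mul (by positivity)]
  congr 1
  rw [← mul_assoc c a H, ← mul_assoc 2 b H, Real.mul_rpow (by positivity) hH.le,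
    Real.mul_rpow (by positivity) hH.le, mul_inv, mul_inv, mul_pow, mul_pow]
  have h3 : H ^ p ≠ 0 := by positivity
  field_simp
  rw [← mul_pow, mul_one_div_cancel hH.ne', one_pow]

lemma chart_constant_eq {n : ℕ} {a b H p : ℝ} (ha : 0 < a) (hb : 0 < b) (hH : 0 < H) {K Y : ℝ≥0∞}
    (hK : K ≠ ∞) :
    ENNReal.ofReal (b * H) ^ (2 * n) * (ENNReal.ofReal (((a * H) ^ p)⁻¹) * (K *
      (ENNReal.ofReal (b * H) ^ 2 * (ENNReal.ofReal (a * H)⁻¹ ^ n * Y)))) =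
      ENNReal.ofReal (b ^ (2 * n) * (a ^ p)⁻¹ * K.toReal * b ^ 2 * a⁻¹ ^ n *
        H ^ ((n : ℝ) + 2 - p)) * Y := by
  have h2 : K = ENNReal.ofReal K.toReal := (ENNReal.ofReal_toReal hK).symm
  rw [h2, ENNReal.toReal_ofReal ENNReal.toReal_nonneg]
  simp only [← ENNReal.ofReal_pow (show 0 ≤ b * H by positivity),
    ← ENNReal.ofReal_pow (show 0 ≤ (a * H)⁻¹ by positivity)]
  rw [← mul_assoc, ← mul_assoc, ← mul_assoc, ← mul_assoc, ← ENNReal.ofReal_mul (by positivity),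
    ← ENNReal.ofReal_mul (by positivity), ← ENNReal.ofReal_mul (by positivity),
    ← ENNReal.ofReal_mul (by positivity)]
  congr 2
  have h3 : H ^ ((n : ℝ) + 2 - p) = H ^ n * H ^ 2 * (H ^ p)⁻¹ := by
    rw [Real.rpow_sub hH, Real.rpow_add hH, Real.rpow_natCast, Real.rpow_two, div_eq_mul_inv]
  rw [h3, Real.mul_rpow ha.le hH.le, mul_inv, mul_inv, mul_pow, mul_pow, mul_pow, inv_pow, inv_pow]
  have h4 : H ^ p ≠ 0 := by positivity
  field_simp
  ring

/-- `T` is a family of elements at the node `z`, all of size `H`, on which the two mechanisms of the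
patch estimate apply: related elements lie in a common bi-Lipschitz chart over a convex domain,
unrelated ones see each other from the node `z` under a positive angle, and any two elements are
joined by a path of `N` related ones. The constants `a`, `b`, `c` and `N` measure the regularity of
the patch. -/
structure IsRegularPatch {d : ℕ} {ι : Type*} (a b c : ℝ) (N : ℕ) (Δ : Set (E (d - 1))) (z : E d)
    (H : ℝ) (I : Finset ι) (T : ι → Set (E d)) (R : ι → ι → Prop) : Prop where
  card_le : I.card ≤ N
  refl : ∀ i ∈ I, R i i
  chart : ∀ i ∈ I, ∀ j ∈ I, R i j → ∃ (D : Set (E (d - 1))) (Φ : E (d - 1) → E d), IsOpen D ∧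
    Convex ℝ D ∧ D ⊆ Metric.ball 0 2 ∧ MapsTo Φ D (⋃ i ∈ I, T i) ∧
    IsBiLipschitz Φ (a * H) (b * H) ∧ T i ∪ T j ⊆ Φ '' closure D
  param : ∀ i ∈ I, ∃ Φ : E (d - 1) → E d, IsBiLipschitz Φ (a * H) (b * H) ∧ Φ 0 = z ∧ T i = Φ '' Δ
  separated : ∀ i ∈ I, ∀ j ∈ I, ¬ R i j → ∀ x ∈ T i, ∀ y ∈ T j,
    c * (‖x - z‖ + ‖y - z‖) ≤ ‖x - y‖
  path : ∀ i ∈ I, ∀ j ∈ I, ∃ f : ℕ → ι, f 0 = i ∧ f N = j ∧ (∀ k, f k ∈ I) ∧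
    ∀ k, R (f k) (f (k + 1))

/-- The Sobolev–Slobodeckij integral over a regular patch is controlled by the surface gradient. For
a pair of unrelated elements the chaining estimate is iterated along a path of related ones. -/
theorem slobodeckijIntegral_patch_le {d : ℕ} (hd : 1 ≤ d - 1) {p : ℝ} (hp : 0 ≤ p)
    (hp' : p < (d - 1 : ℕ) + 2) {a b c : ℝ} (ha : 0 < a) (hb : 0 < b) (hc : 0 < c) (N : ℕ)
    {Δ : Set (E (d - 1))} (hΔ : Convex ℝ Δ) (hΔm : MeasurableSet Δ) (hΔf : volume Δ ≠ ∞) :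
    ∃ C : ℝ, 0 ≤ C ∧ ∀ (H : ℝ) (z : E d) (ι : Type) (I : Finset ι) (T : ι → Set (E d))
      (R : ι → ι → Prop), 0 < H → IsRegularPatch a b c N Δ z H I T R →
      ∀ (v v' : E d → ℝ) (g g' : E d → E d), MemH1WithGradient (⋃ i ∈ I, T i) v g → Measurable v' →
      v =ᵐ[(surfaceMeasure d).restrict (⋃ i ∈ I, T i)] v' → Measurable g' →
      g =ᵐ[(surfaceMeasure d).restrict (⋃ i ∈ I, T i)] g' →
      slobodeckijIntegral (d - 1) p v' (⋃ i ∈ I, T i) (⋃ i ∈ I, T i) ≤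
        ENNReal.ofReal (C * H ^ (((d - 1 : ℕ) : ℝ) + 2 - p)) *
          ∫⁻ y in ⋃ i ∈ I, T i, ‖g' y‖ₑ ^ 2 ∂(surfaceMeasure d) := by
  set n := d - 1 with hn
  set K := kernelMass n p with hK
  have hKf : K ≠ ∞ := (kernelMass_lt_top hd hp').ne
  set Cch : ℝ := b ^ (2 * n) * ((c * a) ^ p)⁻¹ * 2 * (2 * b) ^ p * 2 ^ n * a⁻¹ ^ (2 * n) with hCch
  have hCch0 : 0 ≤ Cch := by positivity
  set C1 : ℝ := b ^ (2 * n) * (a ^ p)⁻¹ * K.toReal * b ^ 2 * a⁻¹ ^ n with hC1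
  have hC10 : 0 ≤ C1 := by
    have := ENNReal.toReal_nonneg (a := K)
    positivity
  -- one step along a path multiplies the bound by at most this factor
  set M : ℝ := 2 * Cch + 1 with hM
  refine ⟨N * N * (M ^ N * C1), by positivity, ?_⟩
  intro H z ι I T R hH hP v v' g g' hvg hv' hv hg' hg
  set S := ⋃ i ∈ I, T i with hS
  set Y := ∫⁻ y in S, ‖g' y‖ₑ ^ 2 ∂(surfaceMeasure d) with hY
  set X : ℝ≥0∞ := ENNReal.ofReal (C1 * H ^ ((n : ℝ) + 2 - p)) * Y with hX
  have hadj : ∀ i ∈ I, ∀ j ∈ I, R i j →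
      slobodeckijIntegral n p v' (T i ∪ T j) (T i ∪ T j) ≤ X := by
    intro i hi j hj hR
    obtain ⟨D, Φ, h1, h2, h3, h4, h5, h6⟩ := hP.chart i hi j hj hR
    refine (slobodeckijIntegral_chart_le hvg hv' hv hg' hg h5 h1 h2 h3 h4 hd h6 hp).trans_eq ?_
    exact chart_constant_eq ha hb hH hKf
  have hadj1 : ∀ i ∈ I, ∀ j ∈ I, R i j → slobodeckijIntegral n p v' (T i) (T j) ≤ X :=
    fun i hi j hj hR =>
      (slobodeckijIntegral_mono subset_union_left subset_union_right).trans (hadj i hi j hj hR)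
  have hadj2 : ∀ i ∈ I, ∀ j ∈ I, R i j → slobodeckijIntegral n p v' (T j) (T i) ≤ X :=
    fun i hi j hj hR =>
      (slobodeckijIntegral_mono subset_union_right subset_union_left).trans (hadj i hi j hj hR)
  have hpath : ∀ i ∈ I, ∀ f : ℕ → ι, f 0 = i → (∀ k, f k ∈ I) → (∀ k, R (f k) (f (k + 1))) →
      ∀ k, slobodeckijIntegral n p v' (T i) (T (f k)) ≤ ENNReal.ofReal (M ^ k) * X := by
    intro i hi f h0 hI hR k
    induction k with
    | zero =>
      rw [h0]
      simpa using hadj1 i hi i hi (hP.refl i hi)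
    | succ k ih =>
      have hMk : 1 ≤ M ^ k := one_le_pow₀ (by linarith)
      by_cases h : R i (f (k + 1))
      · refine (hadj1 i hi _ (hI _) h).trans (le_mul_of_one_le_left zero_le ?_)
        rw [ENNReal.one_le_ofReal]
        exact one_le_pow₀ (by linarith)
      · obtain ⟨Φ, hΦ, hΦ0, hΦT⟩ := hP.param i hi
        obtain ⟨Ψ, hΨ, hΨ0, hΨT⟩ := hP.param _ (hI (k + 1))
        obtain ⟨Θ, hΘ, hΘ0, hΘT⟩ := hP.param _ (hI k)
        have hch := slobodeckijIntegral_chain_le hd hΦ hΨ hΘ (hΦ0.trans hΘ0.symm)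
          (hΨ0.trans hΘ0.symm) hΔ hΔm hΔf hv' hp hc (fun x hx y hy => by
            have := hP.separated i hi _ (hI (k + 1)) h (Φ x) (hΦT ▸ mem_image_of_mem Φ hx) (Ψ y)
              (hΨT ▸ mem_image_of_mem Ψ hy)
            rwa [hΦ0, hΨ0])
        rw [← hΦT, ← hΨT, ← hΘT, chain_constant_eq ha hb hc hH] at hch
        refine hch.trans ?_
        calc ENNReal.ofReal Cch * (slobodeckijIntegral n p v' (T i) (T (f k)) +
              slobodeckijIntegral n p v' (T (f (k + 1))) (T (f k)))
            ≤ ENNReal.ofReal Cch * (ENNReal.ofReal (M ^ k) * X + ENNReal.ofReal (M ^ k) * X) := by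
              gcongr
              refine (hadj2 _ (hI k) _ (hI (k + 1)) (hR k)).trans
                (le_mul_of_one_le_left zero_le ?_)
              rwa [ENNReal.one_le_ofReal]
          _ = ENNReal.ofReal (Cch * (M ^ k + M ^ k)) * X := by
              rw [← add_mul, ← ENNReal.ofReal_add (by positivity) (by positivity), ← mul_assoc,
                ← ENNReal.ofReal_mul hCch0]
          _ ≤ ENNReal.ofReal (M ^ (k + 1)) * X := by
              gcongr
              rw [pow_succ, hM]
              nlinarith
  have hpair : ∀ i ∈ I, ∀ j ∈ I, slobodeckijIntegral n p v' (T i) (T j) ≤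
      ENNReal.ofReal (M ^ N) * X := by
    intro i hi j hj
    obtain ⟨f, h0, hN, hI, hR⟩ := hP.path i hi j hj
    exact hN ▸ hpath i hi f h0 hI hR N
  have hfin : ∀ i ∈ I, IsFiniteMeasure ((μHE[n] : Measure (E d)).restrict (T i)) := by
    intro i hi
    obtain ⟨Φ, hΦ, -, hΦT⟩ := hP.param i hi
    rw [hΦT]
    exact isFiniteMeasure_restrict_image hΦ hΔf
  calc _ ≤ ∑ i ∈ I, ∑ j ∈ I, slobodeckijIntegral n p v' (T i) (T j) :=
        slobodeckijIntegral_biUnion_le hv' I T hfin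
    _ ≤ ∑ i ∈ I, ∑ j ∈ I, ENNReal.ofReal (M ^ N) * X :=
        Finset.sum_le_sum fun i hi => Finset.sum_le_sum fun j hj => hpair i hi j hj
    _ = (I.card * I.card : ℝ≥0∞) * (ENNReal.ofReal (M ^ N) * X) := by
        rw [Finset.sum_const, Finset.sum_const, nsmul_eq_mul, nsmul_eq_mul, mul_assoc]
    _ ≤ (N * N : ℝ≥0∞) * (ENNReal.ofReal (M ^ N) * X) := by
        have : (I.card : ℝ≥0∞) ≤ N := by exact_mod_cast hP.card_le
        gcongr
    _ = _ := by
        rw [hX, ← mul_assoc, ← mul_assoc]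
        congr 1
        rw [← ENNReal.ofReal_natCast, ← ENNReal.ofReal_mul (by positivity),
          ← ENNReal.ofReal_mul (by positivity), ← ENNReal.ofReal_mul (by positivity)]
        congr 1
        ring

/-- The patch estimate in terms of the seminorms: for the exponent `p = n + 2s`, the square root of
`H ^ (n + 2 - p)` is `H ^ (1 - s)`. -/
theorem slobodeckijSeminorm_patch_le {d : ℕ} (hd : 1 ≤ d - 1) {s : ℝ} (hs : 0 < s) (hs' : s < 1)
    {a b c : ℝ} (ha : 0 < a) (hb : 0 < b) (hc : 0 < c) (N : ℕ)
    {Δ : Set (E (d - 1))} (hΔ : Convex ℝ Δ) (hΔm : MeasurableSet Δ) (hΔf : volume Δ ≠ ∞) :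
    ∃ C : ℝ, 0 < C ∧ ∀ (H : ℝ) (z : E d) (ι : Type) (I : Finset ι) (T : ι → Set (E d))
      (R : ι → ι → Prop), 0 < H → IsRegularPatch a b c N Δ z H I T R →
      ∀ (v : E d → ℝ) (g : E d → E d), MemH1WithGradient (⋃ i ∈ I, T i) v g →
      slobodeckijSeminorm s (⋃ i ∈ I, T i) v ≤
        ENNReal.ofReal (C * H ^ (1 - s)) *
          eLpNorm g 2 ((surfaceMeasure d).restrict (⋃ i ∈ I, T i)) := by
  have hdc : ((d - 1 : ℕ) : ℝ) = (d : ℝ) - 1 := by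
    rw [Nat.cast_sub (by omega), Nat.cast_one]
  have hd1 : (0 : ℝ) ≤ (d : ℝ) - 1 := by rw [← hdc]; positivity
  obtain ⟨C, hC, hmain⟩ := slobodeckijIntegral_patch_le (p := (d : ℝ) - 1 + 2 * s) hd
    (by positivity) (by rw [hdc]; linarith) ha hb hc N hΔ hΔm hΔf
  refine ⟨Real.sqrt C + 1, by positivity, ?_⟩
  intro H z ι I T R hH hP v g hvg
  set S := ⋃ i ∈ I, T i with hS
  have h := hmain H z ι I T R hH hP v (hvg.memLp.1.mk v) g (hvg.memLp_gradient.1.mk g) hvg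
    hvg.memLp.1.stronglyMeasurable_mk.measurable hvg.memLp.1.ae_eq_mk
    hvg.memLp_gradient.1.stronglyMeasurable_mk.measurable hvg.memLp_gradient.1.ae_eq_mk
  rw [← hS] at h
  have hY : ∫⁻ y in S, ‖hvg.memLp_gradient.1.mk g y‖ₑ ^ 2 ∂(surfaceMeasure d) =
      ∫⁻ y in S, ‖g y‖ₑ ^ 2 ∂(surfaceMeasure d) := by
    refine lintegral_congr_ae ?_
    filter_upwards [hvg.memLp_gradient.1.ae_eq_mk] with y hy
    rw [hy]
  have hX : slobodeckijIntegral (d - 1) ((d : ℝ) - 1 + 2 * s) (hvg.memLp.1.mk v) S S =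
      ∫⁻ x in S, ∫⁻ y in S, ENNReal.ofReal (|v x - v y| ^ 2 / ‖x - y‖ ^ ((d : ℝ) - 1 + 2 * s))
        ∂(surfaceMeasure d) ∂(surfaceMeasure d) := by
    refine lintegral_congr_ae ?_
    filter_upwards [hvg.memLp.1.ae_eq_mk] with x hx
    refine lintegral_congr_ae ?_
    filter_upwards [hvg.memLp.1.ae_eq_mk] with y hy
    rw [hx, hy]
  rw [hY, hX, hdc] at h
  have hexp : (d : ℝ) - 1 + 2 - ((d : ℝ) - 1 + 2 * s) = (1 - s) * 2 := by ring
  rw [hexp] at h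
  have hnorm : eLpNorm g 2 ((surfaceMeasure d).restrict S) =
      (∫⁻ y in S, ‖g y‖ₑ ^ 2 ∂(surfaceMeasure d)) ^ (1 / 2 : ℝ) := by
    rw [eLpNorm_eq_lintegral_rpow_enorm_toReal two_ne_zero ENNReal.ofNat_ne_top]
    simp
  calc slobodeckijSeminorm s S v ≤ (ENNReal.ofReal (C * H ^ ((1 - s) * 2)) *
        ∫⁻ y in S, ‖g y‖ₑ ^ 2 ∂(surfaceMeasure d)) ^ (1 / 2 : ℝ) :=
        ENNReal.rpow_le_rpow h (by norm_num)
    _ = ENNReal.ofReal (Real.sqrt C * H ^ (1 - s)) *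
        eLpNorm g 2 ((surfaceMeasure d).restrict S) := by
        rw [ENNReal.mul_rpow_of_nonneg _ _ (by norm_num), hnorm,
          ENNReal.ofReal_rpow_of_nonneg (by positivity) (by norm_num)]
        congr 2
        rw [Real.mul_rpow hC (by positivity), ← Real.sqrt_eq_rpow, ← Real.rpow_mul hH.le]
        congr 2
        ring
    _ ≤ _ := by
        gcongr
        linarith

/-! ### Angles between finitely many subspaces -/

section Angles

variable {X : Type*} [NormedAddCommGroup X] [InnerProductSpace ℝ X]

/-- Any two subspaces from `𝒱` and `𝒲` meet under an angle bounded below in terms of `A`: a point of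
the first which is close to the second is close to their intersection. -/
def AngleBound (A : ℝ) (𝒱 𝒲 : Set (Submodule ℝ X)) : Prop :=
  ∀ V ∈ 𝒱, ∀ W ∈ 𝒲, ∀ x ∈ V, ∀ y ∈ W, ∃ w ∈ V ⊓ W, ‖x - w‖ ≤ A * ‖x - y‖

lemma AngleBound.mono {A B : ℝ} {𝒱 𝒲 : Set (Submodule ℝ X)} (h : AngleBound A 𝒱 𝒲) (hAB : A ≤ B) :
    AngleBound B 𝒱 𝒲 := fun V hV W hW x hx y hy => by
  obtain ⟨w, hw, h1⟩ := h V hV W hW x hx y hy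
  exact ⟨w, hw, h1.trans (by gcongr)⟩

lemma exists_norm_sub_le_of_mem [FiniteDimensional ℝ X] (V W : Submodule ℝ X) :
    ∃ A : ℝ, ∀ x ∈ V, ∀ y ∈ W, ∃ w ∈ V ⊓ W, ‖x - w‖ ≤ A * ‖x - y‖ := by
  set U := V ⊓ W with hU
  set M : X →ₗ[ℝ] X := (Wᗮ.starProjection : X →L[ℝ] X).toLinearMap with hM
  have hMW : ∀ y ∈ W, M y = 0 := fun y hy => by
    change Wᗮ.starProjection y = 0
    rw [Submodule.starProjection_apply_eq_zero_iff, Submodule.orthogonal_orthogonal]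
    exact hy
  have hker : LinearMap.ker (M.domRestrict (V ⊓ Uᗮ)) = ⊥ := by
    rw [LinearMap.ker_eq_bot']
    rintro ⟨x, hx⟩ h
    have h1 : Wᗮ.starProjection x = 0 := h
    rw [Submodule.starProjection_apply_eq_zero_iff, Submodule.orthogonal_orthogonal] at h1
    have h2 : x ∈ U ⊓ Uᗮ := ⟨⟨hx.1, h1⟩, hx.2⟩
    rw [Submodule.inf_orthogonal_eq_bot, Submodule.mem_bot] at h2
    exact Subtype.ext h2
  obtain ⟨K, -, hK⟩ := LinearMap.exists_antilipschitzWith _ hker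
  refine ⟨K, fun x hx y hy => ⟨U.starProjection x, Submodule.starProjection_apply_mem _ _, ?_⟩⟩
  have hwU : U.starProjection x ∈ U := Submodule.starProjection_apply_mem _ _
  have hx1 : x - U.starProjection x ∈ V ⊓ Uᗮ :=
    ⟨V.sub_mem hx hwU.1, Submodule.sub_starProjection_mem_orthogonal x⟩
  have h1 := hK.le_mul_norm (f := M.domRestrict (V ⊓ Uᗮ)) (map_zero _) ⟨_, hx1⟩
  refine h1.trans (mul_le_mul_of_nonneg_left ?_ K.2)
  have h2 : M (x - U.starProjection x) = M (x - y) := by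
    rw [map_sub, map_sub, hMW _ hwU.2, hMW _ hy]
  rw [LinearMap.domRestrict_apply, h2]
  exact Submodule.norm_starProjection_apply_le _ _

lemma exists_angleBound [FiniteDimensional ℝ X] {𝒱 𝒲 : Set (Submodule ℝ X)} (h𝒱 : 𝒱.Finite)
    (h𝒲 : 𝒲.Finite) : ∃ A : ℝ, 1 ≤ A ∧ AngleBound A 𝒱 𝒲 := by
  choose f hf using fun V W : Submodule ℝ X => exists_norm_sub_le_of_mem V W
  obtain ⟨A, hA⟩ := ((h𝒱.prod h𝒲).image fun q => f q.1 q.2).bddAbove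
  refine ⟨max A 1, le_max_right _ _, fun V hV W hW x hx y hy => ?_⟩
  obtain ⟨w, hw, h1⟩ := hf V W x hx y hy
  refine ⟨w, hw, h1.trans ?_⟩
  gcongr
  exact (hA ⟨(V, W), ⟨hV, hW⟩, rfl⟩).trans (le_max_left _ _)

end Angles

/-! ### Fans of triangles at a node -/

section Fan

variable {X : Type*} [NormedAddCommGroup X] [InnerProductSpace ℝ X]

/-- The triangles at a node, moved to the origin and described by their pairs of edge vectors:
`Tri a b` says that the triangle with vertices `0`, `a`, `b` belongs to the fan. The constant `c`
measures the shape regularity, `𝒱` contains the planes of the triangles and `ℰ` contains the lines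
of all edges across which the fan does not continue in the same plane. -/
structure IsFan (c : ℝ) (𝒱 ℰ : Set (Submodule ℝ X)) (Tri : X → X → Prop) : Prop where
  pos : 0 < c
  le_one : c ≤ 1
  symm : ∀ {a b}, Tri a b → Tri b a
  indep : ∀ {a b}, Tri a b → LinearIndependent ℝ ![a, b]
  shape : ∀ {a b}, Tri a b → ∀ t : ℝ, c * ‖a‖ ≤ ‖b - t • a‖ ∧ c * ‖b‖ ≤ ‖b - t • a‖
  plane : ∀ {a b}, Tri a b → Submodule.span ℝ {a, b} ∈ 𝒱
  inter : ∀ {a b a' b'}, Tri a b → Tri a' b' → ∀ {α β α' β' : ℝ}, 0 < α → 0 ≤ β → 0 ≤ α' → 0 ≤ β' →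
    α • a + β • b = α' • a' + β' • b' → a = a' ∨ a = b'
  continues : ∀ {a b}, Tri a b → Submodule.span ℝ {a} ∉ ℰ →
    ∃ c' : X, ∃ γ₁ γ₂ : ℝ, Tri a c' ∧ γ₂ < 0 ∧ c' = γ₁ • a + γ₂ • b

namespace IsFan

variable {c : ℝ} {𝒱 ℰ : Set (Submodule ℝ X)} {Tri : X → X → Prop}

lemma coord_eq_zero (h : IsFan c 𝒱 ℰ Tri) {a b : X} (hT : Tri a b) {α β : ℝ}
    (h0 : α • a + β • b = 0) : α = 0 ∧ β = 0 :=
  (LinearIndependent.pair_iff.1 (h.indep hT)) α β h0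

lemma ne (h : IsFan c 𝒱 ℰ Tri) {a b : X} (hT : Tri a b) : a ≠ b := by
  rintro rfl
  have := (h.coord_eq_zero hT (α := 1) (β := -1) (by simp)).1
  norm_num at this

lemma norm_le (h : IsFan c 𝒱 ℰ Tri) {a b : X} (hT : Tri a b) : c * ‖a‖ ≤ ‖b‖ := by
  simpa using (h.shape hT 0).1

lemma norm_pos (h : IsFan c 𝒱 ℰ Tri) {a b : X} (hT : Tri a b) : 0 < ‖a‖ := by
  rw [norm_pos_iff]
  rintro rfl
  have := (h.coord_eq_zero hT (α := 1) (β := 0) (by simp)).1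
  norm_num at this

lemma mul_abs_le (h : IsFan c 𝒱 ℰ Tri) {a b : X} (hT : Tri a b) (t β : ℝ) :
    c * ‖a‖ * |β| ≤ ‖t • a + β • b‖ ∧ c * ‖b‖ * |β| ≤ ‖t • a + β • b‖ := by
  rcases eq_or_ne β 0 with rfl | hβ
  · simp
  have h1 : t • a + β • b = β • (b - (-(t / β)) • a) := by
    rw [smul_sub, smul_smul, sub_eq_add_neg, ← neg_smul, add_comm]
    congr 2
    field_simp
  rw [h1, norm_smul, Real.norm_eq_abs]
  have h2 := h.shape hT (-(t / β))
  constructor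
  · rw [mul_comm]; exact mul_le_mul_of_nonneg_left h2.1 (abs_nonneg _)
  · rw [mul_comm]; exact mul_le_mul_of_nonneg_left h2.2 (abs_nonneg _)

lemma le_norm_add (h : IsFan c 𝒱 ℰ Tri) {a b : X} (hT : Tri a b) (t β : ℝ) :
    c / 2 * ‖a‖ * (|t| + |β|) ≤ ‖t • a + β • b‖ := by
  have h1 := (h.mul_abs_le hT t β).1
  have h2 := (h.mul_abs_le (h.symm hT) β t).2
  rw [add_comm] at h2
  linarith

lemma mem_span {a b : X} {w : X} :
    w ∈ Submodule.span ℝ {a, b} ↔ ∃ α β : ℝ, w = α • a + β • b := by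
  rw [Submodule.mem_span_pair]
  exact ⟨fun ⟨α, β, h⟩ => ⟨α, β, h.symm⟩, fun ⟨α, β, h⟩ => ⟨α, β, h.symm⟩⟩

lemma finrank_span (h : IsFan c 𝒱 ℰ Tri) {a b : X} (hT : Tri a b) :
    Module.finrank ℝ (Submodule.span ℝ {a, b}) = 2 := by
  have := finrank_span_eq_card (h.indep hT)
  rw [Matrix.range_cons_cons_empty] at this
  simpa using this

lemma span_eq_of_le (h : IsFan c 𝒱 ℰ Tri) {a b a' b' : X} (hT : Tri a b) (hT' : Tri a' b')
    (hle : Submodule.span ℝ {a, b} ≤ Submodule.span ℝ {a', b'}) :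
    Submodule.span ℝ {a, b} = Submodule.span ℝ {a', b'} := by
  have : FiniteDimensional ℝ (Submodule.span ℝ ({a', b'} : Set X)) :=
    FiniteDimensional.span_of_finite ℝ (by simp)
  exact Submodule.eq_of_le_of_finrank_eq hle
    ((h.finrank_span hT).trans (h.finrank_span hT').symm)

/-- If an edge vector and a vector outside its line lie in a subspace, so does the whole plane. -/
lemma span_le_of_mem {a b w : X} {V : Submodule ℝ X} (hw : w ∈ Submodule.span ℝ {a, b})
    (hwa : w ∉ Submodule.span ℝ {a}) (ha : a ∈ V) (hwV : w ∈ V) : Submodule.span ℝ {a, b} ≤ V := by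
  obtain ⟨α, β, rfl⟩ := mem_span.1 hw
  have hβ : β ≠ 0 := by
    rintro rfl
    exact hwa (by simpa using Submodule.smul_mem _ α (Submodule.mem_span_singleton_self a))
  have hb : b ∈ V := by
    have h1 : β • b ∈ V := by
      have := V.sub_mem hwV (V.smul_mem α ha)
      simpa using this
    have := V.smul_mem β⁻¹ h1
    rwa [smul_smul, inv_mul_cancel₀ hβ, one_smul] at this
  rw [Submodule.span_le]
  rintro x (rfl | rfl)
  · exact ha
  · exact hb

/-- Two triangles sharing the edge `a` in the same plane lie on opposite sides of this edge. -/
lemma neg_of_coplanar (h : IsFan c 𝒱 ℰ Tri) {a b b' : X} (hT : Tri a b) (hT' : Tri a b')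
    (hne : b ≠ b') {γ₁ γ₂ : ℝ} (hb' : b' = γ₁ • a + γ₂ • b) : γ₂ < 0 := by
  by_contra! h0
  rcases h0.eq_or_lt with h0 | h0
  · have := (h.coord_eq_zero hT' (α := γ₁) (β := -1) (by rw [hb', ← h0]; simp)).2
    norm_num at this
  · have h1 : γ₂ • b + (γ₁ + |γ₁|) • a = |γ₁| • a + (1 : ℝ) • b' := by
      rw [hb']; module
    rcases h.inter (h.symm hT) hT' h0 (by linarith [neg_abs_le γ₁]) (abs_nonneg _) zero_le_one h1
      with h2 | h2
    · exact h.ne hT h2.symm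
    · exact hne h2

lemma fold_left (h : IsFan c 𝒱 ℰ Tri) {A : ℝ} (hA : 1 ≤ A) (hV : AngleBound A 𝒱 𝒱) {a b b' : X}
    (hT : Tri a b) (hT' : Tri a b') (hne : b ≠ b') {β ν : ℝ} (hβ : 0 ≤ β) (hν : 0 ≤ ν) (t : ℝ) :
    c * ‖a‖ * β ≤ A * ‖t • a + β • b - ν • b'‖ := by
  by_cases hVV : Submodule.span ℝ {a, b} = Submodule.span ℝ {a, b'}
  · have hb' : b' ∈ Submodule.span ℝ {a, b} := by
      rw [hVV]
      exact Submodule.subset_span (by simp)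
    obtain ⟨γ₁, γ₂, hb'⟩ := mem_span.1 hb'
    have hγ := h.neg_of_coplanar hT hT' hne hb'
    have h1 : t • a + β • b - ν • b' = (t - ν * γ₁) • a + (β - ν * γ₂) • b := by
      rw [hb']; module
    have h2 := (h.mul_abs_le hT (t - ν * γ₁) (β - ν * γ₂)).1
    rw [← h1] at h2
    have h3 : β ≤ |β - ν * γ₂| := le_trans (by nlinarith) (le_abs_self _)
    have h4 : c * ‖a‖ * β ≤ ‖t • a + β • b - ν • b'‖ :=
      le_trans (mul_le_mul_of_nonneg_left h3 (mul_nonneg h.pos.le (norm_nonneg _))) h2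
    exact h4.trans (le_mul_of_one_le_left (norm_nonneg _) hA)
  · obtain ⟨w, hw, h1⟩ := hV _ (h.plane hT) _ (h.plane hT') (t • a + β • b)
      (mem_span.2 ⟨t, β, rfl⟩) (ν • b') (mem_span.2 ⟨0, ν, by simp⟩)
    have hwa : w ∈ Submodule.span ℝ {a} := by
      by_contra hwa
      exact hVV (h.span_eq_of_le hT hT' (span_le_of_mem hw.1 hwa
        (Submodule.subset_span (by simp)) hw.2))
    obtain ⟨τ, rfl⟩ := Submodule.mem_span_singleton.1 hwa
    have h2 := (h.mul_abs_le hT (t - τ) β).1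
    rw [abs_of_nonneg hβ] at h2
    have h3 : t • a + β • b - τ • a = (t - τ) • a + β • b := by module
    rw [h3] at h1
    exact h2.trans h1

/-- The folding estimate: the two triangles at a common edge `a` are not folded together. -/
lemma fold (h : IsFan c 𝒱 ℰ Tri) {A : ℝ} (hA : 1 ≤ A) (hV : AngleBound A 𝒱 𝒱) {a b b' : X}
    (hT : Tri a b) (hT' : Tri a b') (hne : b ≠ b') {β ν : ℝ} (hβ : 0 ≤ β) (hν : 0 ≤ ν) (t : ℝ) :
    c ^ 2 * ‖a‖ * (|t| + β + ν) ≤ 5 * A * ‖t • a + β • b - ν • b'‖ := by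
  set δ := ‖t • a + β • b - ν • b'‖ with hδ
  have h1 := h.fold_left hA hV hT hT' hne hβ hν t
  have h2 := h.fold_left hA hV hT' hT hne.symm hν hβ (-t)
  have h3 : (-t) • a + ν • b' - β • b = -(t • a + β • b - ν • b') := by module
  rw [h3, norm_neg] at h2
  have h4 : |t| * ‖a‖ ≤ δ + β * ‖b‖ + ν * ‖b'‖ := by
    have h5 : t • a = (t • a + β • b - ν • b') - β • b + ν • b' := by module
    have h6 := norm_add_le ((t • a + β • b - ν • b') - β • b) (ν • b')
    have h7 := norm_sub_le (t • a + β • b - ν • b') (β • b)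
    rw [← h5] at h6
    rw [norm_smul, norm_smul, Real.norm_eq_abs, Real.norm_of_nonneg hν] at h6
    rw [norm_smul β, Real.norm_of_nonneg hβ] at h7
    linarith
  have hb := h.norm_le (h.symm hT)
  have hb' := h.norm_le (h.symm hT')
  have hc := h.pos
  have hc1 := h.le_one
  have hδ0 : 0 ≤ δ := norm_nonneg _
  have hcc : c ^ 2 ≤ c := by nlinarith
  have ha := norm_nonneg a
  have e1 : c ^ 2 * ‖a‖ * β ≤ A * δ := le_trans (by gcongr) h1
  have e2 : c ^ 2 * ‖a‖ * ν ≤ A * δ := le_trans (by gcongr) h2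
  have e3 : c ^ 2 * (|t| * ‖a‖) ≤ c ^ 2 * δ + c * β * ‖a‖ + c * ν * ‖a‖ := by
    have f1 : c ^ 2 * (β * ‖b‖) ≤ c * β * ‖a‖ := by
      have := mul_le_mul_of_nonneg_left hb (mul_nonneg hc.le hβ)
      nlinarith
    have f2 : c ^ 2 * (ν * ‖b'‖) ≤ c * ν * ‖a‖ := by
      have := mul_le_mul_of_nonneg_left hb' (mul_nonneg hc.le hν)
      nlinarith
    nlinarith [mul_le_mul_of_nonneg_left h4 (sq_nonneg c)]
  have e4 : c ^ 2 * δ ≤ A * δ := mul_le_mul_of_nonneg_right (by nlinarith) hδ0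
  nlinarith

end IsFan

end Fan

namespace IsFan

variable {X : Type*} [NormedAddCommGroup X] [InnerProductSpace ℝ X]
variable {c : ℝ} {𝒱 ℰ : Set (Submodule ℝ X)} {Tri : X → X → Prop}

/-- A point `w` of the plane of a triangle that lies beyond its edge `a` is far away from any point
`x` of the triangle, unless `a` is one of finitely many special edges, close to `x`, or `w` lies
inside of the next triangle of the fan in this plane. -/
lemma exit_edge (h : IsFan c 𝒱 ℰ Tri) {A : ℝ} (hA : 1 ≤ A) (hV : AngleBound A 𝒱 𝒱) {a b : X}
    (hT : Tri a b) {α β α' β' : ℝ} (hα' : 0 ≤ α') (hβ' : 0 ≤ β') (hβ : β < 0) {x w : X}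
    (hx : x = α' • a + β' • b) (hw : w = α • a + β • b) :
    ‖x‖ ≤ 5 * A / c ^ 3 * ‖x - w‖ ∨
    (Submodule.span ℝ {a} ∈ ℰ ∧ w ∉ Submodule.span ℝ {a} ∧
      ∃ l : ℝ, 0 ≤ l ∧ ‖x - l • a‖ ≤ 5 * A / c ^ 3 * ‖x - w‖) ∨
    ∃ c', Tri a c' ∧ c' ∈ Submodule.span ℝ {a, b} ∧ ∃ τ ν : ℝ, 0 < τ ∧ 0 < ν ∧
      w = τ • a + ν • c' := by
  have hc := h.pos
  have hc1 := h.le_one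
  by_cases hs : Submodule.span ℝ {a} ∈ ℰ
  · refine Or.inr (Or.inl ⟨hs, ?_, α', hα', ?_⟩)
    · intro hmem
      obtain ⟨τ, hτ⟩ := Submodule.mem_span_singleton.1 hmem
      have := (h.coord_eq_zero hT (α := α - τ) (β := β) (by
        rw [sub_smul, hτ, hw]; abel)).2
      exact hβ.ne this
    · have h1 : x - w = (α' - α) • a + (β' - β) • b := by rw [hx, hw]; module
      have h2 := (h.mul_abs_le hT (α' - α) (β' - β)).2
      rw [← h1, abs_of_nonneg (by linarith)] at h2
      have h3 : x - α' • a = β' • b := by rw [hx]; module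
      rw [h3, norm_smul, Real.norm_of_nonneg hβ', div_mul_eq_mul_div, le_div_iff₀ (by positivity)]
      have hb := norm_nonneg b
      have h4 : c * ‖b‖ * β' ≤ ‖x - w‖ := le_trans (by gcongr; linarith) h2
      have h5 : β' * ‖b‖ * c ^ 3 ≤ c * ‖b‖ * β' := by
        have h6 : c ^ 3 ≤ c := by
          have := pow_le_pow_of_le_one hc.le hc1 (show 1 ≤ 3 by norm_num)
          simpa using this
        calc β' * ‖b‖ * c ^ 3 ≤ β' * ‖b‖ * c := by gcongr
          _ = _ := by ring
      have h7 : ‖x - w‖ ≤ 5 * A * ‖x - w‖ := le_mul_of_one_le_left (norm_nonneg _) (by linarith)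
      linarith
  · obtain ⟨c', γ₁, γ₂, hT', hγ, hc'⟩ := h.continues hT hs
    have hne : b ≠ c' := by
      rintro rfl
      have := (h.coord_eq_zero hT (α := γ₁) (β := γ₂ - 1) (by
        rw [sub_smul, one_smul, ← add_sub_assoc, ← hc', sub_self])).2
      linarith
    set ν := β / γ₂ with hν
    have hν0 : 0 < ν := div_pos_of_neg_of_neg hβ hγ
    have hβν : β = ν * γ₂ := by rw [hν, div_mul_cancel₀ _ hγ.ne]
    set τ := α - ν * γ₁ with hτ
    have hw' : w = τ • a + ν • c' := by
      rw [hw, hc', hτ]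
      nth_rewrite 1 [hβν]
      module
    by_cases hτ0 : 0 < τ
    · refine Or.inr (Or.inr ⟨c', hT', ?_, τ, ν, hτ0, hν0, hw'⟩)
      exact mem_span.2 ⟨γ₁, γ₂, hc'⟩
    · left
      push Not at hτ0
      have h1 : x - w = (α' - τ) • a + β' • b - ν • c' := by rw [hx, hw']; module
      have h2 := h.fold hA hV hT hT' hne hβ' hν0.le (α' - τ)
      rw [← h1] at h2
      have h3 : ‖x‖ ≤ α' * ‖a‖ + β' * ‖b‖ := by
        rw [hx]
        refine (norm_add_le _ _).trans ?_
        rw [norm_smul, norm_smul, Real.norm_of_nonneg hα', Real.norm_of_nonneg hβ']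
      have h4 := h.norm_le (h.symm hT)
      have ha := norm_nonneg a
      rw [div_mul_eq_mul_div, le_div_iff₀ (by positivity)]
      have h5 : α' ≤ |α' - τ| := le_trans (by linarith) (le_abs_self _)
      calc ‖x‖ * c ^ 3 ≤ (α' * ‖a‖ + β' * ‖b‖) * c ^ 3 := by gcongr
        _ = c ^ 2 * (c * α' * ‖a‖ + β' * (c * ‖b‖)) := by ring
        _ ≤ c ^ 2 * (1 * α' * ‖a‖ + β' * ‖a‖) := by gcongr
        _ = c ^ 2 * ‖a‖ * (α' + β') := by ring
        _ ≤ c ^ 2 * ‖a‖ * (|α' - τ| + β' + ν) :=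
          mul_le_mul_of_nonneg_left (by linarith) (by positivity)
        _ ≤ _ := h2

/-- The position of a point `w` of the plane of a triangle relative to a point `x` of its cone: `w` lies
in the cone, or far away from `x`, or beyond a special edge close to `x`, or in the interior of the
cone of a coplanar neighbour. -/
lemma exit (h : IsFan c 𝒱 ℰ Tri) {A : ℝ} (hA : 1 ≤ A) (hV : AngleBound A 𝒱 𝒱) {a b : X}
    (hT : Tri a b) {α' β' : ℝ} (hα' : 0 ≤ α') (hβ' : 0 ≤ β') {x w : X}
    (hx : x = α' • a + β' • b) (hw : w ∈ Submodule.span ℝ {a, b}) :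
    (∃ α β : ℝ, 0 ≤ α ∧ 0 ≤ β ∧ w = α • a + β • b) ∨
    ‖x‖ ≤ 5 * A / c ^ 3 * ‖x - w‖ ∨
    (∃ e f, Tri e f ∧ (e = a ∨ e = b) ∧ Submodule.span ℝ {e, f} = Submodule.span ℝ {a, b} ∧
      Submodule.span ℝ {e} ∈ ℰ ∧ w ∉ Submodule.span ℝ {e} ∧
      ∃ l : ℝ, 0 ≤ l ∧ ‖x - l • e‖ ≤ 5 * A / c ^ 3 * ‖x - w‖) ∨
    ∃ e c', (e = a ∨ e = b) ∧ Tri e c' ∧ c' ∈ Submodule.span ℝ {a, b} ∧ ∃ τ ν : ℝ, 0 < τ ∧ 0 < ν ∧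
      w = τ • e + ν • c' := by
  obtain ⟨α, β, hw⟩ := mem_span.1 hw
  by_cases hβ : β < 0
  · rcases h.exit_edge hA hV hT hα' hβ' hβ hx hw with h1 | ⟨h1, h2, h3⟩ | ⟨c', h1, h2, h3⟩
    · exact Or.inr (Or.inl h1)
    · exact Or.inr (Or.inr (Or.inl ⟨a, b, hT, Or.inl rfl, rfl, h1, h2, h3⟩))
    · exact Or.inr (Or.inr (Or.inr ⟨a, c', Or.inl rfl, h1, h2, h3⟩))
  by_cases hα : α < 0
  · rw [add_comm] at hx hw
    rcases h.exit_edge hA hV (h.symm hT) hβ' hα' hα hx hw with h1 | ⟨h1, h2, h3⟩ | ⟨c', h1, h2, h3⟩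
    · exact Or.inr (Or.inl h1)
    · exact Or.inr (Or.inr (Or.inl ⟨b, a, h.symm hT, Or.inr rfl, by rw [pair_comm], h1, h2, h3⟩))
    · rw [pair_comm] at h2
      exact Or.inr (Or.inr (Or.inr ⟨b, c', Or.inr rfl, h1, h2, h3⟩))
  · exact Or.inl ⟨α, β, not_lt.1 hα, not_lt.1 hβ, hw⟩

/-- A point `w` in the triangle with edges `e` and `f`, but off the line of the vector `e`, cannot be
moved to a special edge `l • e` at small cost when it lies in a transversal plane. -/
lemma norm_le_of_near_edge (h : IsFan c 𝒱 ℰ Tri) {A B : ℝ} (hA : 1 ≤ A) {𝒲 : Set (Submodule ℝ X)}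
    (hE : AngleBound A ℰ 𝒲) {e f a' b' : X} (hT : Tri e f) (hT' : Tri a' b')
    (hVV : Submodule.span ℝ {e, f} ≠ Submodule.span ℝ {a', b'})
    (hW : Submodule.span ℝ {e, f} ⊓ Submodule.span ℝ {a', b'} ∈ 𝒲)
    (he : Submodule.span ℝ {e} ∈ ℰ) {x w : X} {r l : ℝ}
    (hw : w ∈ Submodule.span ℝ {e, f} ⊓ Submodule.span ℝ {a', b'})
    (hwe : w ∉ Submodule.span ℝ {e}) (hB : 1 ≤ B) (hr : ‖x - w‖ ≤ r) (hl : ‖x - l • e‖ ≤ B * r) :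
    ‖x‖ ≤ 3 * A * B * r := by
  have hr0 : 0 ≤ r := (norm_nonneg _).trans hr
  obtain ⟨u, hu, h1⟩ := hE _ he _ hW (l • e)
    (Submodule.smul_mem _ _ (Submodule.mem_span_singleton_self e)) w hw
  have hu0 : u = 0 := by
    by_contra hu0
    obtain ⟨τ, rfl⟩ := Submodule.mem_span_singleton.1 hu.1
    have hτ : τ ≠ 0 := by rintro rfl; simp at hu0
    have heV : e ∈ Submodule.span ℝ {a', b'} := by
      have := Submodule.smul_mem _ τ⁻¹ hu.2.2
      rwa [smul_smul, inv_mul_cancel₀ hτ, one_smul] at this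
    exact hVV (h.span_eq_of_le hT hT' (span_le_of_mem hw.1 hwe heV hw.2))
  rw [hu0, sub_zero] at h1
  have h2 : ‖l • e - w‖ ≤ 2 * B * r := by
    have h3 := norm_sub_le_norm_sub_add_norm_sub (l • e) x w
    rw [norm_sub_rev (l • e) x] at h3
    nlinarith
  have h3 : ‖x‖ ≤ ‖x - l • e‖ + ‖l • e‖ := by
    have := norm_add_le (x - l • e) (l • e)
    simpa using this
  have h4 : A * ‖l • e - w‖ ≤ A * (2 * B * r) := by gcongr
  have h5 : B * r ≤ A * (B * r) := le_mul_of_one_le_left (by positivity) hA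
  nlinarith

/-- Two triangles of the fan without a common edge are seen from the node under an angle which is
bounded below. If their planes agree, then `y` itself is located relative to the first triangle and
`x` relative to the second one. Otherwise this is done with a point `w` of the intersection of the
planes which is close to `x` and `y`. -/
lemma separated_left (h : IsFan c 𝒱 ℰ Tri) {A : ℝ} (hA : 1 ≤ A) (hV : AngleBound A 𝒱 𝒱)
    (hE : AngleBound A ℰ ℰ) (hEV : AngleBound A ℰ (image2 (· ⊓ ·) 𝒱 𝒱)) {a b a' b' : X}
    (hT : Tri a b) (hT' : Tri a' b') (h1 : a ≠ a') (h2 : a ≠ b') (h3 : b ≠ a') (h4 : b ≠ b')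
    {α β α' β' : ℝ} (hα : 0 ≤ α) (hβ : 0 ≤ β) (hα' : 0 ≤ α') (hβ' : 0 ≤ β') {x y : X}
    (hx : x = α • a + β • b) (hy : y = α' • a' + β' • b') :
    ‖x‖ ≤ 7 * A ^ 2 * (5 * A / c ^ 3) * ‖x - y‖ := by
  have hc := h.pos
  have hc1 := h.le_one
  set B := 5 * A / c ^ 3 with hBdef
  have hB : 1 ≤ B := by
    rw [hBdef, le_div_iff₀ (by positivity)]
    have : c ^ 3 ≤ 1 := pow_le_one₀ hc.le hc1
    linarith
  set δ := ‖x - y‖ with hδ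
  have hδ0 : 0 ≤ δ := norm_nonneg _
  have hA2 : A ≤ A ^ 2 := by nlinarith
  have k1 : A * δ ≤ A ^ 2 * δ := by gcongr
  have k2 : δ ≤ A * δ := le_mul_of_one_le_left hδ0 hA
  have k3 : A ^ 2 * δ ≤ A ^ 2 * B * δ := by
    have := mul_le_mul_of_nonneg_left hB (show 0 ≤ A ^ 2 * δ by positivity)
    nlinarith
  have k4 : A * B * δ ≤ A ^ 2 * B * δ := by
    have := mul_le_mul_of_nonneg_right hA2 (show 0 ≤ B * δ by positivity)
    nlinarith
  have k5 : B * δ ≤ A * B * δ := by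
    have := mul_le_mul_of_nonneg_right hA (show 0 ≤ B * δ by positivity)
    nlinarith
  have hxy : ‖x‖ ≤ ‖y‖ + δ := by
    have := norm_add_le y (x - y)
    rw [add_sub_cancel] at this
    exact this
  have hdisj : ∀ {e e'}, (e = a ∨ e = b) → (e' = a' ∨ e' = b') → e ≠ e' := by
    rintro e e' (rfl | rfl) (rfl | rfl) <;> assumption
  -- a common point of the two cones is the node
  have hzero : ∀ {w}, (∃ α β : ℝ, 0 ≤ α ∧ 0 ≤ β ∧ w = α • a + β • b) →
      (∃ α β : ℝ, 0 ≤ α ∧ 0 ≤ β ∧ w = α • a' + β • b') → w = 0 := by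
    rintro w ⟨α, β, hα, hβ, hw⟩ ⟨α', β', hα', hβ', hw'⟩
    rcases hα.eq_or_lt with rfl | hα
    · rcases hβ.eq_or_lt with rfl | hβ
      · simp [hw]
      · exfalso
        rcases h.inter (h.symm hT) hT' hβ le_rfl hα' hβ'
          (by rw [← hw', hw]; module) with h5 | h5
        exacts [h3 h5, h4 h5]
    · exfalso
      rcases h.inter hT hT' hα hβ hα' hβ' (by rw [← hw', hw]) with h5 | h5
      exacts [h1 h5, h2 h5]
  have hyT' : ∃ α β : ℝ, 0 ≤ α ∧ 0 ≤ β ∧ y = α • a' + β • b' := ⟨α', β', hα', hβ', hy⟩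
  have hxT : ∃ α' β' : ℝ, 0 ≤ α' ∧ 0 ≤ β' ∧ x = α' • a + β' • b := ⟨α, β, hα, hβ, hx⟩
  have hyV : y ∈ Submodule.span ℝ {a', b'} := mem_span.2 ⟨α', β', hy⟩
  have hxV : x ∈ Submodule.span ℝ {a, b} := mem_span.2 ⟨α, β, hx⟩
  by_cases hVV : Submodule.span ℝ {a, b} = Submodule.span ℝ {a', b'}
  · rcases h.exit hA hV hT hα hβ hx (hVV ▸ hyV) with h5 | h5 | h5 | h5
    · have hy0 : y = 0 := hzero h5 hyT'
      have : ‖x‖ = δ := by rw [hδ, hy0, sub_zero]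
      linarith
    · linarith
    · obtain ⟨e, f, hTe, he, -, heE, -, l, hl, h6⟩ := h5
      rcases h.exit hA hV hT' hα' hβ' hy (hVV ▸ hxV) with h7 | h7 | h7 | h7
      · have hx0 : x = 0 := hzero hxT h7
        rw [hx0, norm_zero]
        positivity
      · rw [norm_sub_rev y x] at h7
        linarith
      · obtain ⟨e', f', hTe', he', -, heE', -, l', hl', h8⟩ := h7
        rw [norm_sub_rev y x] at h8
        have h9 : ‖l • e - l' • e'‖ ≤ 3 * B * δ := by
          have e1 := norm_sub_le_norm_sub_add_norm_sub (l • e) x (l' • e')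
          have e2 := norm_sub_le_norm_sub_add_norm_sub x y (l' • e')
          rw [norm_sub_rev (l • e) x] at e1
          nlinarith
        have h10 : ‖l • e‖ ≤ A * ‖l • e - l' • e'‖ := by
          obtain ⟨u, hu, h11⟩ := hE _ heE _ heE' (l • e)
            (Submodule.smul_mem _ _ (Submodule.mem_span_singleton_self e)) (l' • e')
            (Submodule.smul_mem _ _ (Submodule.mem_span_singleton_self e'))
          by_cases hu0 : u = 0
          · rwa [hu0, sub_zero] at h11
          · obtain ⟨τ, hτ⟩ := Submodule.mem_span_singleton.1 hu.1
            obtain ⟨τ', hτ'⟩ := Submodule.mem_span_singleton.1 hu.2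
            have hτ0 : τ ≠ 0 := by rintro rfl; exact hu0 (by simpa using hτ.symm)
            have hτ0' : τ' ≠ 0 := by rintro rfl; exact hu0 (by simpa using hτ'.symm)
            have hee : e = (τ' / τ) • e' := by
              rw [div_eq_inv_mul, mul_smul, hτ', ← hτ, smul_smul, inv_mul_cancel₀ hτ0, one_smul]
            -- two special edges on one line point into opposite directions
            have hneg : τ' / τ < 0 := by
              rcases lt_or_gt_of_ne (div_ne_zero hτ0' hτ0) with h12 | h12
              · exact h12
              · exfalso
                rcases h.inter hTe hTe' one_pos le_rfl h12.le le_rfl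
                  (show (1 : ℝ) • e + (0 : ℝ) • f = (τ' / τ) • e' + (0 : ℝ) • f' by
                    rw [← hee]; module) with h13 | h13
                · exact hdisj he he' h13
                · have h14 := h.coord_eq_zero hTe' (α := -(τ' / τ)) (β := 1) (by
                    rw [← h13, neg_smul, ← hee]; module)
                  norm_num at h14
            set ρ := τ' / τ with hρ
            have h12 : l • e - l' • e' = (l - l' / ρ) • e := by
              rw [hee, smul_smul, smul_smul, ← sub_smul, sub_mul, div_mul_cancel₀ _ hneg.ne]
            have h13 : l ≤ |l - l' / ρ| := by
              have : l' / ρ ≤ 0 := div_nonpos_of_nonneg_of_nonpos hl' hneg.le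
              exact le_trans (by linarith) (le_abs_self _)
            rw [h12, norm_smul, norm_smul, Real.norm_eq_abs, Real.norm_eq_abs, abs_of_nonneg hl]
            refine le_trans ?_ (le_mul_of_one_le_left (by positivity) hA)
            gcongr
        have h11 : ‖x‖ ≤ ‖x - l • e‖ + ‖l • e‖ := by
          have := norm_add_le (x - l • e) (l • e)
          simpa using this
        have h12 : A * ‖l • e - l' • e'‖ ≤ A * (3 * B * δ) := by gcongr
        nlinarith
      · obtain ⟨e', c', he', hTe', -, τ, ν, hτ, hν, hw⟩ := h7
        exfalso
        rcases h.inter hTe' hT hτ hν.le hα hβ (by rw [← hx, hw]) with h8 | h8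
        · exact hdisj (Or.inl rfl) he' h8.symm
        · exact hdisj (Or.inr rfl) he' h8.symm
    · obtain ⟨e', c', he', hTe', -, τ, ν, hτ, hν, hw⟩ := h5
      exfalso
      rcases h.inter hTe' hT' hτ hν.le hα' hβ' (by rw [← hy, hw]) with h8 | h8
      · exact hdisj he' (Or.inl rfl) h8
      · exact hdisj he' (Or.inr rfl) h8
  · obtain ⟨w, hw, hxw⟩ := hV _ (h.plane hT) _ (h.plane hT') x hxV y hyV
    have hyw : ‖y - w‖ ≤ 2 * A * δ := by
      have e1 := norm_sub_le_norm_sub_add_norm_sub y x w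
      rw [norm_sub_rev y x] at e1
      linarith
    have hWmem : Submodule.span ℝ {a, b} ⊓ Submodule.span ℝ {a', b'} ∈ image2 (· ⊓ ·) 𝒱 𝒱 :=
      ⟨_, h.plane hT, _, h.plane hT', rfl⟩
    have hBxw : B * ‖x - w‖ ≤ A * B * δ := by
      have := mul_le_mul_of_nonneg_left hxw (show 0 ≤ B by linarith)
      linarith
    have hByw : B * ‖y - w‖ ≤ 2 * A * B * δ := by
      have := mul_le_mul_of_nonneg_left hyw (show 0 ≤ B by linarith)
      linarith
    rcases h.exit hA hV hT hα hβ hx hw.1 with h5 | h5 | h5 | h5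
    rotate_left
    · linarith
    · obtain ⟨e, f, hTe, he, hspan, heE, hwe, l, hl, h6⟩ := h5
      have := h.norm_le_of_near_edge (B := B) (r := A * δ) (l := l) hA hEV hTe hT'
        (by rwa [hspan]) (by rwa [hspan]) heE (by rwa [hspan]) hwe hB hxw (by linarith)
      nlinarith
    all_goals
      rcases h.exit hA hV hT' hα' hβ' hy hw.2 with h7 | h7 | h7 | h7
      rotate_left
      · linarith
      · obtain ⟨e, f, hTe, he, hspan, heE, hwe, l, hl, h6⟩ := h7
        have := h.norm_le_of_near_edge (B := B) (r := 2 * A * δ) (l := l) hA hEV hTe hT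
          (by rw [hspan]; exact Ne.symm hVV) (by rw [hspan, inf_comm]; exact hWmem) heE
          (by rw [hspan, inf_comm]; exact hw) hwe hB hyw (by linarith)
        nlinarith
    -- what remains is that `w` lies in the cones of triangles in both planes, which then share the
    -- edges that carry `w`; this is impossible unless `w` is the node
    · obtain ⟨e', c', he', hTe', hc', τ', ν', hτ', hν', hw'⟩ := h7
      obtain ⟨e, c'', he, hTe, hc'', τ, ν, hτ, hν, hw2⟩ := h5
      exfalso
      have heq : τ • e + ν • c'' = τ' • e' + ν' • c' := by rw [← hw', ← hw2]
      have heq' : ν • c'' + τ • e = τ' • e' + ν' • c' := by rw [← heq, add_comm]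
      have memV' : ∀ u, u = e' ∨ u = c' → u ∈ Submodule.span ℝ {a', b'} := by
        rintro u (rfl | rfl)
        · exact Submodule.subset_span (by simpa using he')
        · exact hc'
      have he2 := memV' e (h.inter hTe hTe' hτ hν.le hτ'.le hν'.le heq)
      have hc2 := memV' c'' (h.inter (h.symm hTe) hTe' hν hτ.le hτ'.le hν'.le heq')
      have heV : e ∈ Submodule.span ℝ {a, b} := Submodule.subset_span (by simpa using he)
      have s1 : Submodule.span ℝ {e, c''} ≤ Submodule.span ℝ {a, b} := by
        rw [Submodule.span_le]; rintro u (rfl | rfl)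
        exacts [heV, hc'']
      have s2 : Submodule.span ℝ {e, c''} ≤ Submodule.span ℝ {a', b'} := by
        rw [Submodule.span_le]; rintro u (rfl | rfl)
        exacts [he2, hc2]
      exact hVV ((h.span_eq_of_le hTe hT s1).symm.trans (h.span_eq_of_le hTe hT' s2))
    · obtain ⟨e, c'', he, hTe, hc'', τ, ν, hτ, hν, hw2⟩ := h5
      obtain ⟨α₁, β₁, hα₁, hβ₁, hw1⟩ := h7
      exfalso
      rcases h.inter hTe hT' hτ hν.le hα₁ hβ₁ (by rw [← hw1, hw2]) with h8 | h8
      · exact hdisj he (Or.inl rfl) h8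
      · exact hdisj he (Or.inr rfl) h8
    · obtain ⟨e', c', he', hTe', hc', τ', ν', hτ', hν', hw'⟩ := h7
      obtain ⟨α₁, β₁, hα₁, hβ₁, hw1⟩ := h5
      exfalso
      rcases h.inter hTe' hT hτ' hν'.le hα₁ hβ₁ (by rw [← hw1, hw']) with h8 | h8
      · exact hdisj (Or.inl rfl) he' h8.symm
      · exact hdisj (Or.inr rfl) he' h8.symm
    · have hw0 : w = 0 := hzero h5 h7
      rw [hw0, sub_zero] at hxw
      linarith

end IsFan

/-! ### Reference domains and folding maps -/

/-- The reference triangle. -/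
def refTriangle : Set (E 2) := {x | 0 ≤ x 0 ∧ 0 ≤ x 1 ∧ x 0 + x 1 ≤ 1}

/-- Two copies of the reference triangle, unfolded along their common edge. -/
def refKite : Set (E 2) := {x | 0 ≤ x 0 ∧ x 0 + |x 1| ≤ 1}

lemma convex_refTriangle : Convex ℝ refTriangle := by
  intro x hx y hy a b ha hb hab
  obtain ⟨h1, h2, h3⟩ := hx
  obtain ⟨k1, k2, k3⟩ := hy
  refine ⟨?_, ?_, ?_⟩ <;> simp only [PiLp.add_apply, PiLp.smul_apply, smul_eq_mul]
  · positivity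
  · positivity
  · nlinarith

lemma convex_refKite : Convex ℝ refKite := by
  intro x hx y hy a b ha hb hab
  obtain ⟨h1, h2⟩ := hx
  obtain ⟨k1, k2⟩ := hy
  refine ⟨?_, ?_⟩ <;> simp only [PiLp.add_apply, PiLp.smul_apply, smul_eq_mul]
  · positivity
  · have : |a * x 1 + b * y 1| ≤ a * |x 1| + b * |y 1| := by
      refine (abs_add_le _ _).trans ?_
      rw [abs_mul, abs_mul, abs_of_nonneg ha, abs_of_nonneg hb]
    nlinarith

lemma continuous_coord {n : ℕ} (i : Fin n) : Continuous fun x : E n => x i := by fun_prop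

lemma isClosed_refTriangle : IsClosed refTriangle := by
  have h0 := continuous_coord (n := 2) 0
  have h1 := continuous_coord (n := 2) 1
  exact (isClosed_le continuous_const h0).inter
    ((isClosed_le continuous_const h1).inter (isClosed_le (h0.add h1) continuous_const))

lemma refTriangle_subset_refKite : refTriangle ⊆ refKite := fun x ⟨h1, h2, h3⟩ =>
  ⟨h1, by rwa [abs_of_nonneg h2]⟩

lemma isClosed_refKite : IsClosed refKite := by
  have h0 := continuous_coord (n := 2) 0
  have h1 := continuous_coord (n := 2) 1
  exact (isClosed_le continuous_const h0).inter (isClosed_le (h0.add h1.abs) continuous_const)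

lemma refKite_subset_ball : refKite ⊆ Metric.ball 0 2 := by
  rintro x ⟨h1, h2⟩
  rw [mem_ball_zero_iff, EuclideanSpace.norm_eq, Real.sqrt_lt' (by norm_num), Fin.sum_univ_two]
  simp only [Real.norm_eq_abs, sq_abs]
  have h3 := abs_nonneg (x 1)
  have h4 := sq_abs (x 1)
  nlinarith

lemma interior_refTriangle_nonempty : (interior refTriangle).Nonempty := by
  refine ⟨!₂[1 / 4, 1 / 4], mem_interior.2 ⟨{x | 0 < x 0 ∧ 0 < x 1 ∧ x 0 + x 1 < 1}, ?_, ?_, ?_⟩⟩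
  · exact fun x ⟨h1, h2, h3⟩ => ⟨h1.le, h2.le, h3.le⟩
  · have h0 := continuous_coord (n := 2) 0
    have h1 := continuous_coord (n := 2) 1
    exact (isOpen_lt continuous_const h0).inter
      ((isOpen_lt continuous_const h1).inter (isOpen_lt (h0.add h1) continuous_const))
  · refine ⟨?_, ?_, ?_⟩ <;> norm_num

lemma interior_refKite_nonempty : (interior refKite).Nonempty :=
  interior_refTriangle_nonempty.mono (interior_mono refTriangle_subset_refKite)

lemma volume_refTriangle_ne_top : volume refTriangle ≠ ∞ :=
  ((measure_mono (refTriangle_subset_refKite.trans refKite_subset_ball)).trans_lt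
    measure_ball_lt_top).ne

lemma mem_convexHull_triple {d : ℕ} {z a b x : E d} :
    x ∈ convexHull ℝ ({z, z + a, z + b} : Set (E d)) ↔
      ∃ α β : ℝ, 0 ≤ α ∧ 0 ≤ β ∧ α + β ≤ 1 ∧ x = z + α • a + β • b := by
  constructor
  · have hconv : Convex ℝ {x | ∃ α β : ℝ, 0 ≤ α ∧ 0 ≤ β ∧ α + β ≤ 1 ∧ x = z + α • a + β • b} := by
      rintro _ ⟨α, β, h1, h2, h3, rfl⟩ _ ⟨α', β', k1, k2, k3, rfl⟩ s t hs ht hst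
      refine ⟨s * α + t * α', s * β + t * β', by positivity, by positivity, by nlinarith, ?_⟩
      have : z = (s + t) • z := by rw [hst, one_smul]
      nth_rewrite 3 [this]
      module
    intro h
    refine convexHull_min ?_ hconv h
    rintro _ (rfl | rfl | rfl)
    · exact ⟨0, 0, le_rfl, le_rfl, by norm_num, by simp⟩
    · exact ⟨1, 0, by norm_num, le_rfl, by norm_num, by simp⟩
    · exact ⟨0, 1, le_rfl, by norm_num, by norm_num, by simp⟩
  · rintro ⟨α, β, h1, h2, h3, rfl⟩
    have hc := convex_convexHull ℝ ({z, z + a, z + b} : Set (E d))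
    have m : ∀ y ∈ ({z, z + a, z + b} : Set (E d)), y ∈ convexHull ℝ {z, z + a, z + b} :=
      fun y hy => subset_convexHull ℝ _ hy
    have := hc.sum_mem (t := Finset.univ) (w := ![1 - α - β, α, β]) (z := ![z, z + a, z + b])
      (by intro i _; fin_cases i <;> simp <;> linarith) (by simp [Fin.sum_univ_three]; ring)
      (by intro i _; fin_cases i <;> exact m _ (by simp))
    simp only [Fin.sum_univ_three, Matrix.cons_val_zero, Matrix.cons_val_one, Matrix.cons_val] at this
    convert this using 1
    module

lemma mem_convexHull_pair {d : ℕ} {z a x : E d} :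
    x ∈ convexHull ℝ ({z, z + a} : Set (E d)) ↔ ∃ α : ℝ, 0 ≤ α ∧ α ≤ 1 ∧ x = z + α • a := by
  rw [convexHull_pair, segment_eq_image']
  constructor
  · rintro ⟨α, ⟨h1, h2⟩, rfl⟩
    exact ⟨α, h1, h2, by simp⟩
  · rintro ⟨α, h1, h2, rfl⟩
    exact ⟨α, ⟨h1, h2⟩, by simp⟩

/-- The piecewise affine map that sends one half plane to the half plane spanned by `± a` and `b` at
the point `z`, and the other one to the half plane spanned by `± a` and `b'`. -/
noncomputable def foldMap {d : ℕ} (z a b b' : E d) (x : E 2) : E d :=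
  z + x 0 • a + max (x 1) 0 • b + max (-x 1) 0 • b'

lemma isBiLipschitz_foldMap {d : ℕ} {z a b b' : E d} {m M : ℝ} (hm : 0 < m)
    (hb : ∀ t β : ℝ, m * (|t| + |β|) ≤ ‖t • a + β • b‖)
    (hb' : ∀ t β : ℝ, m * (|t| + |β|) ≤ ‖t • a + β • b'‖)
    (hf : ∀ t β ν : ℝ, 0 ≤ β → 0 ≤ ν → m * (|t| + β + ν) ≤ ‖t • a + β • b - ν • b'‖)
    (ha : ‖a‖ ≤ M) (hbM : ‖b‖ ≤ M) (hbM' : ‖b'‖ ≤ M) :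
    IsBiLipschitz (foldMap z a b b') m (2 * M) := by
  have hM : 0 ≤ M := (norm_nonneg _).trans ha
  have hn1 : ∀ x : E 2, ‖x‖ ≤ |x 0| + |x 1| := by
    intro x
    rw [EuclideanSpace.norm_eq, Real.sqrt_le_left (by positivity), Fin.sum_univ_two]
    simp only [Real.norm_eq_abs]
    nlinarith [abs_nonneg (x 0), abs_nonneg (x 1)]
  have hn2 : ∀ x : E 2, |x 0| + |x 1| ≤ 2 * ‖x‖ := by
    intro x
    have h0 := PiLp.norm_apply_le x 0
    have h1 := PiLp.norm_apply_le x 1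
    rw [Real.norm_eq_abs] at h0 h1
    linarith
  have hdiff : ∀ x y : E 2, foldMap z a b b' x - foldMap z a b b' y =
      (x 0 - y 0) • a + (max (x 1) 0 - max (y 1) 0) • b + (max (-x 1) 0 - max (-y 1) 0) • b' := by
    intro x y
    simp only [foldMap]
    module
  refine ⟨hm, fun x y => ?_, fun x y => ?_⟩
  · rw [hdiff]
    have h1 := hn1 (x - y)
    simp only [PiLp.sub_apply] at h1
    refine (mul_le_mul_of_nonneg_left h1 hm.le).trans ?_
    rcases le_total 0 (x 1) with hx | hx <;> rcases le_total 0 (y 1) with hy | hy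
    · rw [max_eq_left hx, max_eq_left hy, max_eq_right (neg_nonpos.2 hx),
        max_eq_right (neg_nonpos.2 hy)]
      simpa using hb (x 0 - y 0) (x 1 - y 1)
    · rw [max_eq_left hx, max_eq_right hy, max_eq_right (neg_nonpos.2 hx),
        max_eq_left (neg_nonneg.2 hy)]
      have h2 := hf (x 0 - y 0) (x 1) (-y 1) hx (neg_nonneg.2 hy)
      rw [abs_of_nonneg (show 0 ≤ x 1 - y 1 by linarith)]
      calc _ = m * (|x 0 - y 0| + x 1 + -y 1) := by ring
        _ ≤ _ := h2
        _ = _ := by congr 1; module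
    · rw [max_eq_right hx, max_eq_left hy, max_eq_left (neg_nonneg.2 hx),
        max_eq_right (neg_nonpos.2 hy)]
      have h2 := hf (y 0 - x 0) (y 1) (-x 1) hy (neg_nonneg.2 hx)
      rw [abs_of_nonpos (show x 1 - y 1 ≤ 0 by linarith), abs_sub_comm]
      calc _ = m * (|y 0 - x 0| + y 1 + -x 1) := by ring
        _ ≤ _ := h2
        _ = _ := by rw [← norm_neg]; congr 1; module
    · rw [max_eq_right hx, max_eq_right hy, max_eq_left (neg_nonneg.2 hx),
        max_eq_left (neg_nonneg.2 hy)]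
      have h2 := hb' (x 0 - y 0) (-x 1 - -y 1)
      rw [show -x 1 - -y 1 = -(x 1 - y 1) by ring, abs_neg] at h2
      refine h2.trans_eq ?_
      congr 1; module
  · rw [hdiff]
    have h1 := hn2 (x - y)
    simp only [PiLp.sub_apply] at h1
    have h3 : |max (x 1) 0 - max (y 1) 0| + |max (-x 1) 0 - max (-y 1) 0| = |x 1 - y 1| := by
      rcases le_total 0 (x 1) with hx | hx <;> rcases le_total 0 (y 1) with hy | hy
      · rw [max_eq_left hx, max_eq_left hy, max_eq_right (neg_nonpos.2 hx),
          max_eq_right (neg_nonpos.2 hy)]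
        simp
      · rw [max_eq_left hx, max_eq_right hy, max_eq_right (neg_nonpos.2 hx),
          max_eq_left (neg_nonneg.2 hy), abs_of_nonneg (by linarith), abs_of_nonpos (by linarith),
          abs_of_nonneg (by linarith)]
        ring
      · rw [max_eq_right hx, max_eq_left hy, max_eq_left (neg_nonneg.2 hx),
          max_eq_right (neg_nonpos.2 hy), abs_of_nonpos (by linarith), abs_of_nonneg (by linarith),
          abs_of_nonpos (by linarith)]
        ring
      · rw [max_eq_right hx, max_eq_right hy, max_eq_left (neg_nonneg.2 hx),
          max_eq_left (neg_nonneg.2 hy)]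
        rw [show -x 1 - -y 1 = -(x 1 - y 1) by ring, abs_neg]
        simp
    calc _ ≤ |x 0 - y 0| * M + |max (x 1) 0 - max (y 1) 0| * M +
          |max (-x 1) 0 - max (-y 1) 0| * M := by
          refine (norm_add_le _ _).trans (add_le_add ((norm_add_le _ _).trans (add_le_add ?_ ?_)) ?_)
          all_goals
            rw [norm_smul, Real.norm_eq_abs]
            gcongr
      _ = M * (|x 0 - y 0| + |x 1 - y 1|) := by rw [← h3]; ring
      _ ≤ M * (2 * ‖x - y‖) := by gcongr
      _ = _ := by ring

lemma foldMap_image_refTriangle {d : ℕ} (z a b b' : E d) :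
    foldMap z a b b' '' refTriangle = convexHull ℝ ({z, z + a, z + b} : Set (E d)) := by
  ext x
  rw [mem_convexHull_triple]
  constructor
  · rintro ⟨y, ⟨h1, h2, h3⟩, rfl⟩
    refine ⟨y 0, y 1, h1, h2, h3, ?_⟩
    rw [foldMap, max_eq_left h2, max_eq_right (neg_nonpos.2 h2)]
    simp
  · rintro ⟨α, β, h1, h2, h3, rfl⟩
    refine ⟨!₂[α, β], ⟨by simpa using h1, by simpa using h2, by simpa using h3⟩, ?_⟩
    simp [foldMap, h2]

lemma foldMap_image_refKite {d : ℕ} (z a b b' : E d) :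
    foldMap z a b b' '' refKite = convexHull ℝ ({z, z + a, z + b} : Set (E d)) ∪
      convexHull ℝ ({z, z + a, z + b'} : Set (E d)) := by
  ext x
  rw [mem_union, mem_convexHull_triple, mem_convexHull_triple]
  constructor
  · rintro ⟨y, ⟨h1, h2⟩, rfl⟩
    rcases le_total 0 (y 1) with h3 | h3
    · left
      rw [abs_of_nonneg h3] at h2
      refine ⟨y 0, y 1, h1, h3, h2, ?_⟩
      rw [foldMap, max_eq_left h3, max_eq_right (neg_nonpos.2 h3)]
      simp
    · right
      rw [abs_of_nonpos h3] at h2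
      refine ⟨y 0, -y 1, h1, neg_nonneg.2 h3, h2, ?_⟩
      rw [foldMap, max_eq_right h3, max_eq_left (neg_nonneg.2 h3)]
      simp
  · rintro (⟨α, β, h1, h2, h3, rfl⟩ | ⟨α, β, h1, h2, h3, rfl⟩)
    · refine ⟨!₂[α, β], ⟨by simpa using h1, by simpa [abs_of_nonneg h2] using h3⟩, ?_⟩
      simp [foldMap, h2]
    · refine ⟨!₂[α, -β], ⟨by simpa using h1, by simpa [abs_of_nonneg h2] using h3⟩, ?_⟩
      simp [foldMap, h2]

/-! ### Regularity of the patches of triangles -/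

/-- A separated family of unit vectors has a bounded number of members. -/
lemma exists_card_le_of_separated (d : ℕ) {δ : ℝ} (hδ : 0 < δ) :
    ∃ N : ℕ, ∀ (ι : Type) (I : Finset ι) (u : ι → E d), (∀ i ∈ I, ‖u i‖ = 1) →
      (∀ i ∈ I, ∀ j ∈ I, i ≠ j → δ ≤ ‖u i - u j‖) → I.card ≤ N := by
  obtain ⟨t, htf, ht⟩ := Metric.totallyBounded_iff.1
    (isCompact_closedBall (0 : E d) 1).totallyBounded (δ / 2) (by positivity)
  lift t to Finset (E d) using htf
  refine ⟨t.card, fun ι I u hu hsep => ?_⟩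
  have h1 : ∀ i ∈ I, ∃ y ∈ t, dist (u i) y < δ / 2 := by
    intro i hi
    have := ht (show u i ∈ Metric.closedBall 0 1 by simp [hu i hi])
    simpa using this
  choose! f hf hfd using h1
  refine Finset.card_le_card_of_injOn f hf fun i hi j hj hij => ?_
  by_contra hne
  have h2 := hsep i hi j hj hne
  have h3 := dist_triangle_right (u i) (u j) (f i)
  have h4 := hfd i hi
  have h5 := hfd j hj
  rw [← hij] at h5
  rw [← dist_eq_norm] at h2
  linarith

/-- A finite set on which a reflexive symmetric relation is connected is connected by paths whose
length is the given bound of its cardinality. -/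
lemma exists_path_of_connected {ι : Type} {I : Finset ι} {R : ι → ι → Prop} {N : ℕ}
    (hN : I.card ≤ N) (hrefl : ∀ i ∈ I, R i i) (hsymm : ∀ i j, R i j → R j i)
    (hconn : ∀ A ⊆ I, A.Nonempty → (∀ i ∈ A, ∀ j ∈ I, R i j → j ∈ A) → I ⊆ A) :
    ∀ i ∈ I, ∀ j ∈ I, ∃ f : ℕ → ι, f 0 = i ∧ f N = j ∧ (∀ k, f k ∈ I) ∧
      ∀ k, R (f k) (f (k + 1)) := by
  classical
  intro i hi j hj
  let G : SimpleGraph I := ⟨fun x y => x ≠ y ∧ R x y, ⟨fun x y h => ⟨h.1.symm, hsymm _ _ h.2⟩⟩,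
    ⟨fun x h => h.1 rfl⟩⟩
  have hreach : G.Reachable ⟨i, hi⟩ ⟨j, hj⟩ := by
    let A : Finset ι := I.filter fun x => ∃ hx : x ∈ I, G.Reachable ⟨i, hi⟩ ⟨x, hx⟩
    have hA : I ⊆ A := by
      refine hconn A (Finset.filter_subset _ _) ⟨i, ?_⟩ ?_
      · exact Finset.mem_filter.2 ⟨hi, hi, SimpleGraph.Reachable.refl _⟩
      · intro x hx y hy hxy
        obtain ⟨_, hxI, hr⟩ := Finset.mem_filter.1 hx
        refine Finset.mem_filter.2 ⟨hy, hy, ?_⟩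
        by_cases hne : x = y
        · subst hne; exact hr
        · refine hr.trans (SimpleGraph.Adj.reachable ?_)
          exact ⟨fun h => hne (congrArg Subtype.val h), hxy⟩
    obtain ⟨_, _, h⟩ := Finset.mem_filter.1 (hA hj)
    exact h
  obtain ⟨w⟩ := hreach
  let p := w.toPath
  have hlen : (p : G.Walk ⟨i, hi⟩ ⟨j, hj⟩).length ≤ N := by
    have := p.2.length_lt
    rw [Fintype.card_coe] at this
    omega
  refine ⟨fun k => ((p : G.Walk ⟨i, hi⟩ ⟨j, hj⟩).getVert k : ι), ?_, ?_, fun k => Subtype.prop _,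
    fun k => ?_⟩
  · simp
  · simp only [SimpleGraph.Walk.getVert_of_length_le _ hlen]
  · by_cases hk : k < (p : G.Walk ⟨i, hi⟩ ⟨j, hj⟩).length
    · exact ((p : G.Walk ⟨i, hi⟩ ⟨j, hj⟩).adj_getVert_succ hk).2
    · have h1 := (p : G.Walk ⟨i, hi⟩ ⟨j, hj⟩).getVert_of_length_le (not_lt.1 hk)
      have h2 := (p : G.Walk ⟨i, hi⟩ ⟨j, hj⟩).getVert_of_length_le
        (show (p : G.Walk ⟨i, hi⟩ ⟨j, hj⟩).length ≤ k + 1 by omega)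
      simp only [h1, h2]
      exact hrefl j hj

open scoped Classical in
/-- The edge vectors `a`, `b` of the triangles from `I` at the node `z`. -/
def fanTri {d : ℕ} (I : Finset (Finset (E d))) (z a b : E d) : Prop :=
  ({z, z + a, z + b} : Finset (E d)) ∈ I

open scoped Classical in
lemma exists_eq_of_mem {d : ℕ} {t : Finset (E d)} {z p : E d} (ht : t.card = 3) (hz : z ∈ t)
    (hp : p ∈ t) (hpz : p ≠ z) : ∃ a b, p = z + a ∧ t = {z, z + a, z + b} := by
  have h1 : ((t.erase z).erase p).card = 1 := by
    rw [Finset.card_erase_of_mem (Finset.mem_erase.2 ⟨hpz, hp⟩), Finset.card_erase_of_mem hz, ht]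
  obtain ⟨q, hq⟩ := Finset.card_eq_one.1 h1
  refine ⟨p - z, q - z, by simp, ?_⟩
  rw [add_sub_cancel, add_sub_cancel, ← hq, Finset.insert_erase (Finset.mem_erase.2 ⟨hpz, hp⟩),
    Finset.insert_erase hz]

open scoped Classical in
lemma exists_eq_triple {d : ℕ} {t : Finset (E d)} {z : E d} (ht : t.card = 3) (hz : z ∈ t) :
    ∃ a b, t = {z, z + a, z + b} := by
  have h1 : 0 < (t.erase z).card := by rw [Finset.card_erase_of_mem hz, ht]; norm_num
  obtain ⟨p, hp⟩ := Finset.card_pos.1 h1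
  obtain ⟨hpz, hp⟩ := Finset.mem_erase.1 hp
  obtain ⟨a, b, -, h⟩ := exists_eq_of_mem ht hz hp hpz
  exact ⟨a, b, h⟩

open scoped Classical in
lemma exists_common_edge {d : ℕ} {t t' : Finset (E d)} {z : E d} (ht : t.card = 3) (hz : z ∈ t)
    (ht' : t'.card = 3) (hz' : z ∈ t') (hne : t ≠ t') (h : 2 ≤ (t ∩ t').card) :
    ∃ a b b', t = {z, z + a, z + b} ∧ t' = {z, z + a, z + b'} ∧ b ≠ b' := by
  have h1 : 0 < ((t ∩ t').erase z).card := by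
    rw [Finset.card_erase_of_mem (Finset.mem_inter.2 ⟨hz, hz'⟩)]; omega
  obtain ⟨p, hp⟩ := Finset.card_pos.1 h1
  obtain ⟨hpz, hp⟩ := Finset.mem_erase.1 hp
  obtain ⟨hp1, hp2⟩ := Finset.mem_inter.1 hp
  obtain ⟨a, b, ha, h2⟩ := exists_eq_of_mem ht hz hp1 hpz
  obtain ⟨a', b', ha', h3⟩ := exists_eq_of_mem ht' hz' hp2 hpz
  have : a = a' := add_left_cancel (ha.symm.trans ha')
  subst this
  refine ⟨a, b, b', h2, h3, ?_⟩
  rintro rfl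
  exact hne (h2.trans h3.symm)

/-- Unit vectors pointing into distinct triangles of a fan are separated. -/
lemma IsFan.bisector_separated {X : Type*} [NormedAddCommGroup X] [InnerProductSpace ℝ X]
    {c A : ℝ} {𝒱 ℰ : Set (Submodule ℝ X)} {Tri : X → X → Prop} (h : IsFan c 𝒱 ℰ Tri) (hA : 1 ≤ A)
    (hV : AngleBound A 𝒱 𝒱) {a b b' : X} (hT : Tri a b) (hT' : Tri a b') (hne : b ≠ b') :
    c ^ 3 / (10 * A) ≤ ‖‖a + b‖⁻¹ • (a + b) - ‖a + b'‖⁻¹ • (a + b')‖ := by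
  have hc := h.pos
  have hc1 := h.le_one
  have hpos : 0 < ‖a + b‖ := by
    rw [norm_pos_iff]
    intro h0
    have := (h.coord_eq_zero hT (α := 1) (β := 1) (by simpa using h0)).1
    norm_num at this
  set ρ := ‖a + b‖⁻¹ with hρ
  set ρ' := ‖a + b'‖⁻¹ with hρ'
  have hρ0 : 0 < ρ := inv_pos.2 hpos
  have hρ0' : 0 ≤ ρ' := inv_nonneg.2 (norm_nonneg _)
  have h1 := h.fold hA hV hT hT' hne hρ0.le hρ0' (ρ - ρ')
  have h2 : (ρ - ρ') • a + ρ • b - ρ' • b' = ρ • (a + b) - ρ' • (a + b') := by module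
  rw [h2] at h1
  have h3 : c / 2 ≤ ρ * ‖a‖ := by
    have h4 : ‖a + b‖ ≤ ‖a‖ + ‖b‖ := norm_add_le _ _
    have h5 := h.norm_le (h.symm hT)
    have ha := norm_nonneg a
    rw [hρ, inv_mul_eq_div, le_div_iff₀ hpos]
    nlinarith
  rw [div_le_iff₀ (by positivity)]
  have h6 : c ^ 2 * ‖a‖ * ρ ≤ c ^ 2 * ‖a‖ * (|ρ - ρ'| + ρ + ρ') := by
    have := abs_nonneg (ρ - ρ')
    gcongr
    linarith
  have h7 : c ^ 3 / 2 ≤ c ^ 2 * ‖a‖ * ρ := by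
    have := mul_le_mul_of_nonneg_left h3 (sq_nonneg c)
    nlinarith
  linarith

lemma diam_le_of_forall {d : ℕ} {S : Set (E d)} {z : E d} {r : ℝ} (hr : 0 ≤ r)
    (h : ∀ x ∈ S, ‖x - z‖ ≤ r) : Metric.diam S ≤ 2 * r := by
  refine Metric.diam_le_of_forall_dist_le (by positivity) fun x hx y hy => ?_
  have h1 := h x hx
  have h2 := h y hy
  rw [← dist_eq_norm] at h1 h2
  have := dist_triangle_right x y z
  linarith

lemma norm_smul_add_smul_le {X : Type*} [NormedAddCommGroup X] [NormedSpace ℝ X] {a b : X}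
    {α β r : ℝ} (hα : 0 ≤ α) (hβ : 0 ≤ β) (hαβ : α + β ≤ 1) (ha : ‖a‖ ≤ r) (hb : ‖b‖ ≤ r) :
    ‖α • a + β • b‖ ≤ r := by
  have hr : 0 ≤ r := (norm_nonneg _).trans ha
  calc _ ≤ α * ‖a‖ + β * ‖b‖ := by
        refine (norm_add_le _ _).trans ?_
        rw [norm_smul, norm_smul, Real.norm_of_nonneg hα, Real.norm_of_nonneg hβ]
    _ ≤ α * r + β * r := by gcongr
    _ ≤ r := by nlinarith

open scoped Classical in
/-- A connected fan of shape regular triangles is a regular patch, with constants depending only on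
the shape regularity and on the angles between the finitely many planes and special lines. -/
theorem exists_isRegularPatch_of_isFan {c A : ℝ} (hc : 0 < c) (hc1 : c ≤ 1) (hA : 1 ≤ A) :
    ∃ (a b c' : ℝ) (N : ℕ), 0 < a ∧ 0 < b ∧ 0 < c' ∧
      ∀ (z : E 3) (I : Finset (Finset (E 3))) (𝒱 ℰ : Set (Submodule ℝ (E 3))),
      I.Nonempty → (∀ t ∈ I, z ∈ t ∧ t.card = 3) → IsFan c 𝒱 ℰ (fanTri I z) →
      AngleBound A 𝒱 𝒱 → AngleBound A ℰ ℰ → AngleBound A ℰ (image2 (· ⊓ ·) 𝒱 𝒱) →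
      (∀ J ⊆ I, J.Nonempty → (∀ t ∈ J, ∀ t' ∈ I, 2 ≤ (t ∩ t').card → t' ∈ J) → I ⊆ J) →
      0 < Metric.diam (⋃ t ∈ I, convexHull ℝ (t : Set (E 3))) ∧
      IsRegularPatch a b c' N refTriangle z (Metric.diam (⋃ t ∈ I, convexHull ℝ (t : Set (E 3))))
        I (fun t => convexHull ℝ (t : Set (E 3))) (fun t t' => 2 ≤ (t ∩ t').card) := by
  set C : ℝ := 7 * A ^ 2 * (5 * A / c ^ 3) with hC
  have hC0 : 0 < C := by positivity
  set δ : ℝ := min (c ^ 3 / (10 * A)) C⁻¹ with hδ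
  have hδ0 : 0 < δ := lt_min (by positivity) (by positivity)
  obtain ⟨N, hN⟩ := exists_card_le_of_separated 3 hδ0
  -- all edges at the node are at least `κ` times as long as the diameter of the patch, and `k` is the
  -- constant of the folding estimate
  set κ : ℝ := c ^ (2 * (N + 1)) / 2 with hκ
  have hκ0 : 0 < κ := by positivity
  set k : ℝ := c ^ 2 / (5 * A) with hk
  have hk0 : 0 < k := by positivity
  refine ⟨k * κ, 2, (2 * C)⁻¹, N, by positivity, by norm_num, by positivity, ?_⟩
  intro z I 𝒱 ℰ hIne hI h hV hE hEV hconn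
  set S : Set (E 3) := ⋃ t ∈ I, convexHull ℝ (t : Set (E 3)) with hS
  have htri : ∀ t ∈ I, ∃ a b, t = {z, z + a, z + b} ∧ fanTri I z a b := by
    intro t ht
    obtain ⟨a, b, hab⟩ := exists_eq_triple (hI t ht).2 (hI t ht).1
    exact ⟨a, b, hab, by rw [fanTri, ← hab]; exact ht⟩
  have hedge : ∀ t ∈ I, ∀ t' ∈ I, t ≠ t' → 2 ≤ (t ∩ t').card → ∃ a b b', t = {z, z + a, z + b} ∧
      t' = {z, z + a, z + b'} ∧ b ≠ b' ∧ fanTri I z a b ∧ fanTri I z a b' := by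
    intro t ht t' ht' hne hR
    obtain ⟨a, b, b', h1, h2, h3⟩ := exists_common_edge (hI t ht).2 (hI t ht).1 (hI t' ht').2
      (hI t' ht').1 hne hR
    exact ⟨a, b, b', h1, h2, h3, by rw [fanTri, ← h1]; exact ht, by rw [fanTri, ← h2]; exact ht'⟩
  have hcoe : ∀ a b : E 3, ((({z, z + a, z + b} : Finset (E 3))) : Set (E 3)) =
      {z, z + a, z + b} := fun a b => by simp
  have hsep : ∀ {t t' a b a' b'}, t = ({z, z + a, z + b} : Finset (E 3)) →
      t' = ({z, z + a', z + b'} : Finset (E 3)) → fanTri I z a b → fanTri I z a' b' →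
      ¬ 2 ≤ (t ∩ t').card → ∀ {α β α' β' : ℝ}, 0 ≤ α → 0 ≤ β → 0 ≤ α' → 0 ≤ β' →
      ‖α • a + β • b‖ ≤ C * ‖α • a + β • b - (α' • a' + β' • b')‖ := by
    intro t t' a b a' b' ht ht' hT hT' hR α β α' β' hα hβ hα' hβ'
    have hcommon : ∀ p, fanTri I z p p ∨ p ≠ 0 → z + p ∈ t → z + p ∈ t' → False := by
      intro p hp h1 h2
      have hp0 : p ≠ 0 := by
        rcases hp with hp | hp
        · exact absurd rfl (h.ne hp)
        · exact hp
      apply hR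
      have hsub : ({z, z + p} : Finset (E 3)) ⊆ t ∩ t' := by
        intro q hq
        rw [Finset.mem_insert, Finset.mem_singleton] at hq
        rcases hq with rfl | rfl
        · rw [Finset.mem_inter, ht, ht']; simp
        · exact Finset.mem_inter.2 ⟨h1, h2⟩
      have hcard : ({z, z + p} : Finset (E 3)).card = 2 := Finset.card_pair (by simpa using hp0)
      rw [← hcard]
      exact Finset.card_le_card hsub
    have ha := norm_pos_iff.1 (h.norm_pos hT)
    have hb := norm_pos_iff.1 (h.norm_pos (h.symm hT))
    refine h.separated_left hA hV hE hEV hT hT' ?_ ?_ ?_ ?_ hα hβ hα' hβ' rfl rfl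
    · rintro rfl; exact hcommon a (Or.inr ha) (by simp [ht]) (by simp [ht'])
    · rintro rfl; exact hcommon a (Or.inr ha) (by simp [ht]) (by simp [ht'])
    · rintro rfl; exact hcommon b (Or.inr hb) (by simp [ht]) (by simp [ht'])
    · rintro rfl; exact hcommon b (Or.inr hb) (by simp [ht]) (by simp [ht'])
  -- the directions of the bisectors of the triangles at the node are separated
  have hcard : I.card ≤ N := by
    choose! fa fb hfab hfT using htri
    have hpos : ∀ t ∈ I, 0 < ‖fa t + fb t‖ := by
      intro t ht
      rw [norm_pos_iff]
      intro h0
      have := (h.coord_eq_zero (hfT t ht) (α := 1) (β := 1) (by simpa using h0)).1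
      norm_num at this
    have hunit : ∀ t ∈ I, ‖‖fa t + fb t‖⁻¹ • (fa t + fb t)‖ = 1 := by
      intro t ht
      rw [norm_smul, norm_inv, norm_norm, inv_mul_cancel₀ (hpos t ht).ne']
    refine hN _ I (fun t => ‖fa t + fb t‖⁻¹ • (fa t + fb t)) hunit fun t ht t' ht' hne => ?_
    by_cases hR : 2 ≤ (t ∩ t').card
    · obtain ⟨a, b, b', h1, h2, h3, hT, hT'⟩ := hedge t ht t' ht' hne hR
      have hsum : ∀ t ∈ I, ∀ a b, t = ({z, z + a, z + b} : Finset (E 3)) → fanTri I z a b →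
          fa t + fb t = a + b := by
        intro t ht a b h1 hT
        have h4 := hfab t ht
        have hs : ∀ a b, fanTri I z a b →
            ∑ p ∈ ({z, z + a, z + b} : Finset (E 3)), (p - z) = a + b := by
          intro a b hab
          have ha := norm_pos_iff.1 (h.norm_pos hab)
          have hb := norm_pos_iff.1 (h.norm_pos (h.symm hab))
          rw [Finset.sum_insert (by simp [ha, hb]), Finset.sum_pair (by simpa using h.ne hab)]
          simp
        rw [← hs a b hT, ← h1, ← hs _ _ (hfT t ht), ← h4]
      rw [hsum t ht a b h1 hT, hsum t' ht' a b' h2 hT']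
      exact (min_le_left _ _).trans (h.bisector_separated hA hV hT hT' h3)
    · refine (min_le_right _ _).trans ?_
      have h1 := hsep (hfab t ht) (hfab t' ht') (hfT t ht) (hfT t' ht') hR
        (α := ‖fa t + fb t‖⁻¹) (β := ‖fa t + fb t‖⁻¹) (α' := ‖fa t' + fb t'‖⁻¹)
        (β' := ‖fa t' + fb t'‖⁻¹) (by positivity) (by positivity) (by positivity) (by positivity)
      rw [← smul_add, ← smul_add, hunit t ht] at h1
      rw [inv_le_iff_one_le_mul₀ hC0]
      linarith
  have hrefl : ∀ t ∈ I, 2 ≤ (t ∩ t).card := fun t ht => by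
    rw [Finset.inter_self, (hI t ht).2]; norm_num
  have hpath := exists_path_of_connected (R := fun t t' : Finset (E 3) => 2 ≤ (t ∩ t').card) hcard
    hrefl (fun t t' ht => by rwa [Finset.inter_comm]) hconn
  -- any two edges of one triangle are comparable
  have hsize1 : ∀ t ∈ I, ∀ p ∈ t, p ≠ z → ∀ q ∈ t, q ≠ z → c * ‖p - z‖ ≤ ‖q - z‖ := by
    intro t ht p hp hpz q hq hqz
    obtain ⟨a, b, hab, hT⟩ := htri t ht
    have ha := norm_nonneg a
    have hb := norm_nonneg b
    rw [hab, Finset.mem_insert, Finset.mem_insert, Finset.mem_singleton] at hp hq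
    rcases hp with rfl | rfl | rfl
    · exact absurd rfl hpz
    all_goals
      rcases hq with rfl | rfl | rfl
      · exact absurd rfl hqz
      all_goals simp only [add_sub_cancel_left]
    · nlinarith
    · exact h.norm_le hT
    · exact h.norm_le (h.symm hT)
    · nlinarith
  -- and therefore so are any two edges at the node, along a path of triangles with common edges
  have hsize : ∀ t ∈ I, ∀ p ∈ t, p ≠ z → ∀ t' ∈ I, ∀ q ∈ t', q ≠ z →
      c ^ (2 * (N + 1)) * ‖p - z‖ ≤ ‖q - z‖ := by
    intro t ht p hp hpz t' ht' q hq hqz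
    obtain ⟨f, h0, hfN, hfI, hfR⟩ := hpath t ht t' ht'
    have key : ∀ k, ∀ q ∈ f k, q ≠ z → c ^ (2 * (k + 1)) * ‖p - z‖ ≤ ‖q - z‖ := by
      intro k
      induction k with
      | zero =>
        intro q hq hqz
        rw [h0] at hq
        refine le_trans ?_ (hsize1 t ht p hp hpz q hq hqz)
        gcongr
        exact pow_le_of_le_one hc.le hc1 (by norm_num)
      | succ k ih =>
        intro q hq hqz
        have h1 : ∃ r ∈ f k, r ∈ f (k + 1) ∧ r ≠ z := by
          have h2 : 0 < ((f k ∩ f (k + 1)).erase z).card := by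
            have := Finset.pred_card_le_card_erase (s := f k ∩ f (k + 1)) (a := z)
            have := hfR k
            omega
          obtain ⟨r, hr⟩ := Finset.card_pos.1 h2
          obtain ⟨hrz, hr⟩ := Finset.mem_erase.1 hr
          exact ⟨r, (Finset.mem_inter.1 hr).1, (Finset.mem_inter.1 hr).2, hrz⟩
        obtain ⟨r, hr1, hr2, hrz⟩ := h1
        have h3 := ih r hr1 hrz
        have h4 := hsize1 _ (hfI (k + 1)) r hr2 hrz q hq hqz
        calc c ^ (2 * (k + 1 + 1)) * ‖p - z‖ = c * (c * (c ^ (2 * (k + 1)) * ‖p - z‖)) := by ring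
          _ ≤ c * (1 * ‖r - z‖) := by gcongr
          _ ≤ _ := by rwa [one_mul]
    rw [← hfN] at hq
    exact key N q hq hqz
  have hbdd : Bornology.IsBounded S := by
    rw [hS, Bornology.isBounded_biUnion_finset]
    intro t _
    exact (isBounded_convexHull.2 t.finite_toSet.isBounded)
  have hsubS : ∀ t ∈ I, convexHull ℝ (t : Set (E 3)) ⊆ S := fun t ht =>
    subset_biUnion_of_mem (u := fun t : Finset (E 3) => convexHull ℝ (t : Set (E 3))) ht
  have hmemS : ∀ t ∈ I, ∀ p ∈ t, p ∈ S := fun t ht p hp =>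
    hsubS t ht (subset_convexHull ℝ _ hp)
  have hle : ∀ t ∈ I, ∀ p ∈ t, ‖p - z‖ ≤ Metric.diam S := by
    intro t ht p hp
    rw [← dist_eq_norm]
    exact Metric.dist_le_diam_of_mem hbdd (hmemS t ht p hp) (hmemS t ht z (hI t ht).1)
  have hge : ∀ t ∈ I, ∀ q ∈ t, q ≠ z → κ * Metric.diam S ≤ ‖q - z‖ := by
    intro t ht q hq hqz
    have hcp : 0 < c ^ (2 * (N + 1)) := by positivity
    have h1 : ∀ x ∈ S, ‖x - z‖ ≤ ‖q - z‖ / c ^ (2 * (N + 1)) := by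
      intro x hx
      rw [hS, mem_iUnion₂] at hx
      obtain ⟨t', ht', hx⟩ := hx
      obtain ⟨a, b, hab, hT⟩ := htri t' ht'
      rw [hab, hcoe, mem_convexHull_triple] at hx
      obtain ⟨α, β, hα, hβ, hαβ, rfl⟩ := hx
      have ha := norm_pos_iff.1 (h.norm_pos hT)
      have hb := norm_pos_iff.1 (h.norm_pos (h.symm hT))
      rw [add_assoc, add_sub_cancel_left]
      refine norm_smul_add_smul_le hα hβ hαβ ?_ ?_
      · rw [le_div_iff₀ hcp, mul_comm]
        simpa using hsize t' ht' (z + a) (by simp [hab]) (by simpa using ha) t ht q hq hqz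
      · rw [le_div_iff₀ hcp, mul_comm]
        simpa using hsize t' ht' (z + b) (by simp [hab]) (by simpa using hb) t ht q hq hqz
    have h2 := diam_le_of_forall (by positivity) h1
    rw [hκ]
    calc c ^ (2 * (N + 1)) / 2 * Metric.diam S ≤ c ^ (2 * (N + 1)) / 2 *
          (2 * (‖q - z‖ / c ^ (2 * (N + 1)))) := by gcongr
      _ = ‖q - z‖ := by field_simp
  have hvec : ∀ {a b}, fanTri I z a b → κ * Metric.diam S ≤ ‖a‖ ∧ ‖a‖ ≤ Metric.diam S := by
    intro a b hT
    have ha := norm_pos_iff.1 (h.norm_pos hT)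
    constructor
    · simpa using hge _ hT (z + a) (by simp) (by simpa using ha)
    · simpa using hle _ hT (z + a) (by simp)
  have hH : 0 < Metric.diam S := by
    obtain ⟨t, ht⟩ := hIne
    obtain ⟨a, b, -, hT⟩ := htri t ht
    exact (h.norm_pos hT).trans_le (hvec hT).2
  have hkc : k ≤ c / 2 := by
    rw [hk, div_le_iff₀ (by positivity)]
    nlinarith
  have hlin : ∀ {a b}, fanTri I z a b → ∀ t β : ℝ,
      k * κ * Metric.diam S * (|t| + |β|) ≤ ‖t • a + β • b‖ := by
    intro a b hT t β
    refine le_trans ?_ (h.le_norm_add hT t β)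
    have := (hvec hT).1
    rw [mul_assoc k]
    gcongr
  have hfold : ∀ {a b b'}, fanTri I z a b → fanTri I z a b' → b ≠ b' → ∀ t β ν : ℝ, 0 ≤ β → 0 ≤ ν →
      k * κ * Metric.diam S * (|t| + β + ν) ≤ ‖t • a + β • b - ν • b'‖ := by
    intro a b b' hT hT' hne t β ν hβ hν
    have h1 := h.fold hA hV hT hT' hne hβ hν t
    have h2 := (hvec hT).1
    have h3 : k * ‖a‖ * (|t| + β + ν) ≤ ‖t • a + β • b - ν • b'‖ := by
      rw [hk, div_mul_eq_mul_div, div_mul_eq_mul_div, div_le_iff₀ (by positivity)]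
      linarith
    refine le_trans ?_ h3
    rw [mul_assoc k]
    gcongr
  have hbil : ∀ {a b}, fanTri I z a b →
      IsBiLipschitz (foldMap z a b (-b)) (k * κ * Metric.diam S) (2 * Metric.diam S) := by
    intro a b hT
    refine isBiLipschitz_foldMap (by positivity) (hlin hT) (fun t β => ?_) (fun t β ν hβ hν => ?_)
      (hvec hT).2 (hvec (h.symm hT)).2 (by rw [norm_neg]; exact (hvec (h.symm hT)).2)
    · have := hlin hT t (-β)
      rwa [abs_neg, neg_smul, ← smul_neg] at this
    · have := hlin hT t (β + ν)
      rw [abs_of_nonneg (add_nonneg hβ hν), ← add_assoc] at this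
      refine this.trans_eq ?_
      congr 1; module
  refine ⟨hH, ⟨hcard, hrefl, ?_, ?_, ?_, hpath⟩⟩
  · intro t ht t' ht' hR
    by_cases hne : t = t'
    · subst hne
      obtain ⟨a, b, hab, hT⟩ := htri t ht
      refine ⟨interior refTriangle, foldMap z a b (-b), isOpen_interior,
        convex_refTriangle.interior, ?_, ?_, hbil hT, ?_⟩
      · exact interior_subset.trans (refTriangle_subset_refKite.trans refKite_subset_ball)
      · intro x hx
        refine hsubS t ht ?_
        rw [hab, hcoe, ← foldMap_image_refTriangle z a b (-b)]
        exact mem_image_of_mem _ (interior_subset hx)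
      · rw [convex_refTriangle.closure_interior_eq_closure_of_nonempty_interior
          interior_refTriangle_nonempty, isClosed_refTriangle.closure_eq,
          foldMap_image_refTriangle, union_self, hab, hcoe]
    · obtain ⟨a, b, b', h1, h2, h3, hT, hT'⟩ := hedge t ht t' ht' hne hR
      refine ⟨interior refKite, foldMap z a b b', isOpen_interior,
        convex_refKite.interior, interior_subset.trans refKite_subset_ball, ?_, ?_, ?_⟩
      · intro x hx
        have h4 : foldMap z a b b' x ∈ foldMap z a b b' '' refKite :=
          mem_image_of_mem _ (interior_subset hx)
        rw [foldMap_image_refKite, ← hcoe, ← hcoe, ← h1, ← h2] at h4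
        exact h4.elim (fun h5 => hsubS t ht h5) (fun h5 => hsubS t' ht' h5)
      · exact isBiLipschitz_foldMap (by positivity) (hlin hT) (hlin hT') (hfold hT hT' h3)
          (hvec hT).2 (hvec (h.symm hT)).2 (hvec (h.symm hT')).2
      · rw [convex_refKite.closure_interior_eq_closure_of_nonempty_interior
          interior_refKite_nonempty, isClosed_refKite.closure_eq,
          foldMap_image_refKite, h1, h2, hcoe, hcoe]
  · intro t ht
    obtain ⟨a, b, hab, hT⟩ := htri t ht
    refine ⟨foldMap z a b (-b), hbil hT, by simp [foldMap], ?_⟩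
    rw [foldMap_image_refTriangle, hab, hcoe]
  · intro t ht t' ht' hR x hx y hy
    obtain ⟨a, b, hab, hT⟩ := htri t ht
    obtain ⟨a', b', hab', hT'⟩ := htri t' ht'
    have hR' : ¬ 2 ≤ (t' ∩ t).card := by rwa [Finset.inter_comm]
    have hx' := hx
    have hy' := hy
    rw [hab, hcoe, mem_convexHull_triple] at hx'
    rw [hab', hcoe, mem_convexHull_triple] at hy'
    obtain ⟨α, β, hα, hβ, -, hxe⟩ := hx'
    obtain ⟨α', β', hα', hβ', -, hye⟩ := hy'
    have e1 : x - z = α • a + β • b := by rw [hxe]; abel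
    have e2 : y - z = α' • a' + β' • b' := by rw [hye]; abel
    have h1 := hsep hab hab' hT hT' hR hα hβ hα' hβ'
    have h2 := hsep hab' hab hT' hT hR' hα' hβ' hα hβ
    rw [← e1, ← e2, sub_sub_sub_cancel_right] at h1 h2
    rw [norm_sub_rev y x] at h2
    rw [inv_mul_le_iff₀ (by positivity)]
    linarith

/-! ### Two coverings of a polygonal surface -/

/-- If a ray runs, near its starting point, in a finite union of closed sets, then one of them
contains the starting point and another point of the ray. -/
lemma exists_mem_of_ray {d : ℕ} {ι : Type*} (I : Finset ι) {Q : ι → Set (E d)}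
    (hQ : ∀ i ∈ I, IsClosed (Q i)) {m ν : E d}
    (h : ∀ᶠ t : ℝ in 𝓝[>] 0, m + t • ν ∈ ⋃ i ∈ I, Q i) :
    ∃ i ∈ I, m ∈ Q i ∧ ∃ t : ℝ, 0 < t ∧ m + t • ν ∈ Q i := by
  have h1 : ∃ᶠ t : ℝ in 𝓝[>] 0, ∃ i ∈ I, m + t • ν ∈ Q i := by
    refine (h.mono fun t ht => ?_).frequently
    simpa using ht
  rw [frequently_exists_finset] at h1
  obtain ⟨i, hi, h2⟩ := h1
  refine ⟨i, hi, (hQ i hi).mem_of_frequently_of_tendsto h2 ?_, ?_⟩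
  · have : Continuous fun t : ℝ => m + t • ν := by fun_prop
    have h3 := this.tendsto 0
    simp only [zero_smul, add_zero] at h3
    exact h3.mono_left nhdsWithin_le_nhds
  · obtain ⟨t, h3, h4⟩ := (h2.and_eventually self_mem_nhdsWithin).exists
    exact ⟨t, h4, h3⟩

lemma mem_vectorSpan_of_ray {d : ℕ} {s : Set (E d)} {m ν : E d} {t : ℝ} (ht : 0 < t)
    (h0 : m ∈ convexHull ℝ s) (h1 : m + t • ν ∈ convexHull ℝ s) : ν ∈ vectorSpan ℝ s := by
  have h2 := vsub_mem_vectorSpan_of_mem_affineSpan_of_mem_affineSpan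
    (convexHull_subset_affineSpan s h1) (convexHull_subset_affineSpan s h0)
  rw [vsub_eq_sub, add_sub_cancel_left] at h2
  exact (Submodule.smul_mem_iff _ ht.ne').1 h2

/-- A subspace that contains infinitely many of the vectors `b + σ • a` contains `a` and `b`. -/
lemma exists_mem_of_forall_add_smul {X : Type*} [AddCommGroup X] [Module ℝ X]
    {𝒱 : Set (Submodule ℝ X)} (h𝒱 : 𝒱.Finite) {a b : X}
    (h : ∀ σ : ℕ, ∃ V ∈ 𝒱, b + (σ : ℝ) • a ∈ V) : ∃ V ∈ 𝒱, a ∈ V ∧ b ∈ V := by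
  choose f hf hfm using h
  have := h𝒱.to_subtype
  obtain ⟨i, j, hij, hfij⟩ := Finite.exists_ne_map_eq_of_infinite fun n => (⟨f n, hf n⟩ : 𝒱)
  have hfij : f i = f j := congrArg Subtype.val hfij
  have h1 := hfm i
  have h2 := hfm j
  rw [← hfij] at h2
  have h3 : ((i : ℝ) - j) • a ∈ f i := by
    have := (f i).sub_mem h1 h2
    rwa [add_sub_add_left_eq_sub, ← sub_smul] at this
  have hne : (i : ℝ) - j ≠ 0 := sub_ne_zero.2 (Nat.cast_injective.ne hij)
  have ha := ((f i).smul_mem_iff hne).1 h3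
  refine ⟨f i, hf i, ha, ?_⟩
  have := (f i).sub_mem h1 ((f i).smul_mem (i : ℝ) ha)
  rwa [add_sub_cancel_right] at this

/-- The direction spaces of the simplices in `F`. -/
def directions {d : ℕ} (F : Finset (Finset (E d))) : Set (Submodule ℝ (E d)) :=
  (fun f : Finset (E d) => vectorSpan ℝ (f : Set (E d))) '' F

lemma finite_directions {d : ℕ} (F : Finset (Finset (E d))) : (directions F).Finite :=
  F.finite_toSet.image _

/-- The lines spanned by the edges of the simplices in `F`. -/
def edgeLines {d : ℕ} (F : Finset (Finset (E d))) : Set (Submodule ℝ (E d)) :=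
  ⋃ f ∈ F, image2 (fun p q => Submodule.span ℝ {q - p}) f f

lemma finite_edgeLines {d : ℕ} (F : Finset (Finset (E d))) : (edgeLines F).Finite :=
  F.finite_toSet.biUnion fun f _ => f.finite_toSet.image2 _ f.finite_toSet

lemma vectorSpan_triple {d : ℕ} (z a b : E d) :
    vectorSpan ℝ ({z, z + a, z + b} : Set (E d)) = Submodule.span ℝ {a, b} := by
  rw [vectorSpan_eq_span_vsub_set_right ℝ (p := z) (by simp)]
  simp [image_insert_eq]

lemma finrank_vectorSpan_finset {d n : ℕ} {t : Finset (E d)} (ht : t.card = n + 1)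
    (hi : AffineIndependent ℝ ((↑) : t → E d)) :
    Module.finrank ℝ (vectorSpan ℝ (t : Set (E d))) = n := by
  have := hi.finrank_vectorSpan (n := n) (by simpa using ht)
  rwa [show range ((↑) : t → E d) = (t : Set (E d)) from Subtype.range_coe] at this

open scoped Classical in
lemma linearIndependent_of_triple {d : ℕ} {z a b : E d}
    (ht : ({z, z + a, z + b} : Finset (E d)).card = 3)
    (hi : AffineIndependent ℝ ((↑) : ({z, z + a, z + b} : Finset (E d)) → E d)) :
    LinearIndependent ℝ ![a, b] := by
  have h1 := finrank_vectorSpan_finset ht hi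
  rw [Finset.coe_insert, Finset.coe_insert, Finset.coe_singleton, vectorSpan_triple] at h1
  rw [linearIndependent_iff_card_eq_finrank_span, Matrix.range_cons_cons_empty, Set.finrank, h1]
  simp

lemma isClosed_convexHull_finset {d : ℕ} (t : Finset (E d)) :
    IsClosed (convexHull ℝ (t : Set (E d))) := t.finite_toSet.isClosed_convexHull ℝ

section Complex

variable {d : ℕ} {K : Geometry.SimplicialComplex ℝ (E d)} {Γ : Set (E d)}

/-- The finset of all faces that are elements. -/
noncomputable def elementFinset (hK : IsTriangulation K Γ) : Finset (Finset (E d)) :=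
  (hK.finite.subset (fun _ h => h.1 : {t ∈ K.faces | t.card = d} ⊆ K.faces)).toFinset

lemma mem_elementFinset (hK : IsTriangulation K Γ) {t : Finset (E d)} :
    t ∈ elementFinset hK ↔ t ∈ K.faces ∧ t.card = d := by
  simp [elementFinset]

lemma biUnion_elementFinset (hK : IsTriangulation K Γ) :
    ⋃ t ∈ elementFinset hK, convexHull ℝ (t : Set (E d)) = closure Γ := by
  rw [← hK.space_eq]
  refine Subset.antisymm (iUnion₂_subset fun t ht => ?_) fun x hx => ?_
  · exact K.convexHull_subset_space ((mem_elementFinset hK).1 ht).1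
  · obtain ⟨s, hs, hx⟩ := Geometry.SimplicialComplex.mem_space_iff.1 hx
    obtain ⟨t, ht, hst, hc⟩ := hK.pure s hs
    exact mem_iUnion₂.2 ⟨t, (mem_elementFinset hK).2 ⟨ht, hc⟩,
      convexHull_mono (Finset.coe_subset.2 hst) hx⟩

open scoped Classical in
/-- The elements at the node `z`. -/
noncomputable def nodeElements (hK : IsTriangulation K Γ) (z : E d) : Finset (Finset (E d)) :=
  (elementFinset hK).filter (z ∈ ·)

lemma mem_nodeElements (hK : IsTriangulation K Γ) {z : E d} {t : Finset (E d)} :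
    t ∈ nodeElements hK z ↔ t ∈ K.faces ∧ t.card = d ∧ z ∈ t := by
  simp [nodeElements, mem_elementFinset, and_assoc]

lemma nodeElements_nonempty (hK : IsTriangulation K Γ) {z : E d} (hz : z ∈ K.vertices) :
    (nodeElements hK z).Nonempty := by
  obtain ⟨t, ht, hzt, hc⟩ := hK.pure _ hz
  exact ⟨t, (mem_nodeElements hK).2 ⟨ht, hc, hzt (Finset.mem_singleton_self z)⟩⟩

lemma nodePatch_eq (hK : IsTriangulation K Γ) {z : E d} (hz : z ∈ K.vertices) :
    nodePatch K z = ⋃ t ∈ nodeElements hK z, convexHull ℝ (t : Set (E d)) := by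
  ext x
  simp only [nodePatch, elements, mem_sUnion, mem_ofPred_eq, mem_iUnion, mem_nodeElements,
    exists_prop]
  constructor
  · rintro ⟨_, ⟨⟨t, ht, hc, rfl⟩, hzt⟩, hx⟩
    exact ⟨t, ⟨ht, hc, (K.vertex_mem_convexHull_iff hz ht).1 hzt⟩, hx⟩
  · rintro ⟨t, ⟨ht, hc, hzt⟩, hx⟩
    exact ⟨_, ⟨⟨t, ht, hc, rfl⟩, subset_convexHull ℝ _ hzt⟩, hx⟩

/-- A ray in the surface starts in a simplex of the decomposition `F` whose direction space contains
the direction of the ray. -/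
lemma exists_ray_direction {F : Finset (Finset (E d))}
    (hF : closure Γ = ⋃ t ∈ F, convexHull ℝ (t : Set (E d))) {m ν : E d}
    (h : ∀ᶠ t : ℝ in 𝓝[>] 0, m + t • ν ∈ closure Γ) :
    ∃ f ∈ F, m ∈ convexHull ℝ (f : Set (E d)) ∧ ν ∈ vectorSpan ℝ (f : Set (E d)) := by
  rw [hF] at h
  obtain ⟨f, hf, h1, t, ht, h2⟩ := exists_mem_of_ray F (fun f _ => isClosed_convexHull_finset f) h
  exact ⟨f, hf, h1, mem_vectorSpan_of_ray ht h1 h2⟩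

end Complex

section Triangles

variable {K : Geometry.SimplicialComplex ℝ (E 3)} {Γ : Set (E 3)}
  {F : Finset (Finset (E 3))}

open scoped Classical in
lemma eventually_mem_triangle {z a b : E 3} {m₀ σ : ℝ} (h0 : 0 ≤ m₀) (h1 : m₀ < 1) (hσ : 0 ≤ σ) :
    ∀ᶠ t : ℝ in 𝓝[>] 0, z + m₀ • a + t • (b + σ • a) ∈
      convexHull ℝ (({z, z + a, z + b} : Finset (E 3)) : Set (E 3)) := by
  have h2 : ∀ᶠ t : ℝ in 𝓝[>] 0, t < (1 - m₀) / (1 + σ) :=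
    (eventually_lt_nhds (by apply div_pos <;> linarith)).filter_mono nhdsWithin_le_nhds
  filter_upwards [h2, self_mem_nhdsWithin] with t ht ht0
  rw [lt_div_iff₀ (by linarith)] at ht
  have ht0 : 0 < t := ht0
  rw [Finset.coe_insert, Finset.coe_insert, Finset.coe_singleton, mem_convexHull_triple]
  refine ⟨m₀ + t * σ, t, by positivity, ht0.le, by nlinarith, by module⟩

open scoped Classical in
/-- The plane of each element is one of those of the simplices of a fixed decomposition `F` of the
surface: finitely many planes serve all triangulations. -/
lemma span_mem_directions (hK : IsTriangulation K Γ)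
    (hFi : ∀ t ∈ F, t.card = 3 ∧ AffineIndependent ℝ ((↑) : t → E 3))
    (hF : closure Γ = ⋃ t ∈ F, convexHull ℝ (t : Set (E 3))) {z a b : E 3}
    (ht : ({z, z + a, z + b} : Finset (E 3)) ∈ K.faces)
    (hc : ({z, z + a, z + b} : Finset (E 3)).card = 3) :
    Submodule.span ℝ {a, b} ∈ directions F := by
  have h1 : ∃ V ∈ directions F, a ∈ V ∧ b ∈ V := by
    refine exists_mem_of_forall_add_smul (finite_directions F) fun σ => ?_
    have := eventually_mem_triangle (z := z) (a := a) (b := b) le_rfl one_pos (Nat.cast_nonneg σ)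
    simp only [zero_smul, add_zero] at this
    obtain ⟨f, hf, -, h2⟩ := exists_ray_direction hF (m := z) (ν := b + (σ : ℝ) • a)
      (this.mono fun t h => hK.space_eq ▸ K.convexHull_subset_space ht h)
    exact ⟨_, ⟨f, hf, rfl⟩, h2⟩
  obtain ⟨V, hV, ha, hb⟩ := h1
  obtain ⟨f, hf, rfl⟩ := hV
  have h2 : Submodule.span ℝ {a, b} ≤ vectorSpan ℝ (f : Set (E 3)) := by
    rw [Submodule.span_le]
    rintro x (rfl | rfl)
    · exact ha
    · exact hb
  have h3 := finrank_vectorSpan_finset (n := 2) hc (K.indep ht)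
  rw [Finset.coe_insert, Finset.coe_insert, Finset.coe_singleton, vectorSpan_triple] at h3
  rw [Submodule.eq_of_le_of_finrank_eq h2
    (h3.trans (finrank_vectorSpan_finset (n := 2) (hFi f hf).1 (hFi f hf).2).symm)]
  exact ⟨f, hf, rfl⟩

/-- A point of a triangle which lies on none of its edges is an interior point with respect to the
plane of the triangle. -/
lemma eventually_mem_of_notMem_edges {f : Finset (E 3)} (hc : f.card = 3) {m ν : E 3}
    (hm : m ∈ convexHull ℝ (f : Set (E 3))) (hν : ν ∈ vectorSpan ℝ (f : Set (E 3)))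
    (he : ∀ p ∈ f, ∀ q ∈ f, m ∉ segment ℝ p q) :
    ∀ᶠ t : ℝ in 𝓝[>] 0, m + t • ν ∈ convexHull ℝ (f : Set (E 3)) := by
  classical
  obtain ⟨p, hp⟩ : f.Nonempty := Finset.card_pos.1 (by omega)
  obtain ⟨u, w, rfl⟩ := exists_eq_triple hc hp
  rw [Finset.coe_insert, Finset.coe_insert, Finset.coe_singleton] at hm hν ⊢
  rw [vectorSpan_triple] at hν
  obtain ⟨x, y, rfl⟩ := Submodule.mem_span_pair.1 hν
  obtain ⟨α, β, hα, hβ, hαβ, rfl⟩ := mem_convexHull_triple.1 hm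
  have hα' : 0 < α := by
    refine hα.lt_of_ne fun h => he p (by simp) (p + w) (by simp) ?_
    rw [← convexHull_pair, mem_convexHull_pair]
    exact ⟨β, hβ, by linarith, by rw [← h]; simp⟩
  have hβ' : 0 < β := by
    refine hβ.lt_of_ne fun h => he p (by simp) (p + u) (by simp) ?_
    rw [← convexHull_pair, mem_convexHull_pair]
    exact ⟨α, hα, by linarith, by rw [← h]; simp⟩
  have hαβ' : α + β < 1 := by
    refine hαβ.lt_of_ne fun h => he (p + u) (by simp) (p + w) (by simp) ?_
    refine ⟨α, β, hα, hβ, h, ?_⟩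
    obtain rfl : α = 1 - β := by linarith
    module
  have e1 : ∀ᶠ t : ℝ in 𝓝 0, 0 < α + t * x :=
    (show Continuous fun t : ℝ => α + t * x by fun_prop).continuousAt.eventually
      (lt_mem_nhds (by simpa using hα'))
  have e2 : ∀ᶠ t : ℝ in 𝓝 0, 0 < β + t * y :=
    (show Continuous fun t : ℝ => β + t * y by fun_prop).continuousAt.eventually
      (lt_mem_nhds (by simpa using hβ'))
  have e3 : ∀ᶠ t : ℝ in 𝓝 0, (α + t * x) + (β + t * y) < 1 :=
    (show Continuous fun t : ℝ => (α + t * x) + (β + t * y) by fun_prop).continuousAt.eventually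
      (gt_mem_nhds (by simpa using hαβ'))
  filter_upwards [nhdsWithin_le_nhds e1, nhdsWithin_le_nhds e2, nhdsWithin_le_nhds e3] with t h1 h2 h3
  exact mem_convexHull_triple.2 ⟨_, _, h1.le, h2.le, h3.le, by module⟩

open scoped Classical in
/-- Across an edge whose line is not spanned by an edge of `F` the triangulation continues in the
same plane. -/
lemma exists_continuation (hK : IsTriangulation K Γ)
    (hFi : ∀ t ∈ F, t.card = 3 ∧ AffineIndependent ℝ ((↑) : t → E 3))
    (hF : closure Γ = ⋃ t ∈ F, convexHull ℝ (t : Set (E 3))) {z a b : E 3}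
    (ht : ({z, z + a, z + b} : Finset (E 3)) ∈ K.faces)
    (hc : ({z, z + a, z + b} : Finset (E 3)).card = 3) (ha : Submodule.span ℝ {a} ∉ edgeLines F) :
    ∃ (c' : E 3) (γ₁ γ₂ : ℝ), ({z, z + a, z + c'} : Finset (E 3)) ∈ K.faces ∧
      ({z, z + a, z + c'} : Finset (E 3)).card = 3 ∧ γ₂ < 0 ∧ c' = γ₁ • a + γ₂ • b := by
  have hind := linearIndependent_of_triple hc (K.indep ht)
  have hcoord : ∀ {α β : ℝ}, α • a + β • b = 0 → α = 0 ∧ β = 0 :=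
    fun {α β} => LinearIndependent.pair_iff.1 hind α β
  have ha0 : a ≠ 0 := hind.ne_zero 0
  set V := Submodule.span ℝ {a, b} with hVdef
  have hV : V ∈ directions F := span_mem_directions hK hFi hF ht hc
  have hVf : Module.finrank ℝ V = 2 := by
    have h3 := finrank_vectorSpan_finset (n := 2) hc (K.indep ht)
    rwa [Finset.coe_insert, Finset.coe_insert, Finset.coe_singleton, vectorSpan_triple] at h3
  have hfin : ∀ V' ∈ directions F, Module.finrank ℝ V' = 2 := by
    rintro _ ⟨f, hf, rfl⟩
    exact finrank_vectorSpan_finset (hFi f hf).1 (hFi f hf).2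
  -- a direction that identifies the plane of the triangle
  obtain ⟨σ, hσ⟩ : ∃ σ : ℕ, ∀ V' ∈ directions F, b + (σ : ℝ) • a ∈ V' → V' = V := by
    by_contra! hcon
    have : ∃ V' ∈ directions F \ {V}, a ∈ V' ∧ b ∈ V' := by
      refine exists_mem_of_forall_add_smul ((finite_directions F).subset sdiff_subset) fun σ => ?_
      obtain ⟨V', h1, h2, h3⟩ := hcon σ
      exact ⟨V', ⟨h1, h3⟩, h2⟩
    obtain ⟨V', ⟨h1, h2⟩, h3, h4⟩ := this
    refine h2 (Submodule.eq_of_le_of_finrank_eq ?_ (hVf.trans (hfin V' h1).symm)).symm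
    rw [hVdef, Submodule.span_le]
    rintro x (rfl | rfl)
    · exact h3
    · exact h4
  set ν := b + (σ : ℝ) • a with hν
  -- a point on the edge away from the edges of `F`
  obtain ⟨k, hk⟩ : ∃ k : ℕ, ∀ f ∈ F, ∀ p ∈ f, ∀ q ∈ f,
      z + (1 / ((k : ℝ) + 2)) • a ∉ segment ℝ p q := by
    by_contra! hcon
    choose f hf p hp q hq hseg using hcon
    let S : Finset (E 3 × E 3) := F.biUnion fun f => f ×ˢ f
    have hS : ∀ k, (p k, q k) ∈ S := fun k =>
      Finset.mem_biUnion.2 ⟨f k, hf k, Finset.mem_product.2 ⟨hp k, hq k⟩⟩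
    obtain ⟨i, j, hij, h1⟩ := Finite.exists_ne_map_eq_of_infinite fun k => (⟨_, hS k⟩ : S)
    have h1 : (p i, q i) = (p j, q j) := congrArg Subtype.val h1
    have h2 := hseg i
    have h3 := hseg j
    obtain ⟨hpq, hpq'⟩ := Prod.ext_iff.1 h1
    simp only at hpq hpq'
    rw [← hpq, ← hpq'] at h3
    rw [segment_eq_image'] at h2 h3
    obtain ⟨x, -, hx⟩ := h2
    obtain ⟨y, -, hy⟩ := h3
    have h4 : (1 / ((i : ℝ) + 2) - 1 / ((j : ℝ) + 2)) • a = (x - y) • (q i - p i) := by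
      have : (1 / ((i : ℝ) + 2) - 1 / ((j : ℝ) + 2)) • a =
          (z + (1 / ((i : ℝ) + 2)) • a) - (z + (1 / ((j : ℝ) + 2)) • a) := by module
      rw [this, ← hx, ← hy]
      module
    have h5 : 1 / ((i : ℝ) + 2) - 1 / ((j : ℝ) + 2) ≠ 0 := by
      rw [sub_ne_zero]
      intro h
      rw [one_div, one_div, inv_inj, add_left_inj] at h
      exact hij (Nat.cast_injective h)
    have h6 : x - y ≠ 0 := by
      intro h
      rw [h, zero_smul] at h4
      exact (smul_ne_zero h5 ha0) h4
    refine ha (mem_iUnion₂.2 ⟨f i, hf i, p i, hp i, q i, hq i, ?_⟩)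
    change Submodule.span ℝ {q i - p i} = _
    rw [← Submodule.span_singleton_smul_eq (IsUnit.mk0 _ h6), ← h4,
      Submodule.span_singleton_smul_eq (IsUnit.mk0 _ h5)]
  set m₀ : ℝ := 1 / ((k : ℝ) + 2) with hm₀
  have hm0 : 0 < m₀ := by positivity
  have hm1 : m₀ < 1 := by
    rw [hm₀, div_lt_one (by positivity)]
    have : (0 : ℝ) ≤ k := Nat.cast_nonneg k
    linarith
  obtain ⟨f, hf, hmf, hνf⟩ := exists_ray_direction hF (m := z + m₀ • a) (ν := ν)
    ((eventually_mem_triangle hm0.le hm1 (Nat.cast_nonneg σ)).mono fun t h =>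
      hK.space_eq ▸ K.convexHull_subset_space ht h)
  have hback := eventually_mem_of_notMem_edges (hFi f hf).1 hmf
    ((vectorSpan ℝ (f : Set (E 3))).neg_mem hνf) (hk f hf)
  have hback' : ∀ᶠ t : ℝ in 𝓝[>] 0, z + m₀ • a + t • -ν ∈
      ⋃ t ∈ elementFinset hK, convexHull ℝ (t : Set (E 3)) := by
    rw [biUnion_elementFinset hK, hF]
    exact hback.mono fun t h => mem_iUnion₂.2 ⟨f, hf, h⟩
  obtain ⟨T, hT, hmT, τ, hτ, hτT⟩ := exists_mem_of_ray _
    (fun f _ => isClosed_convexHull_finset f) hback'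
  obtain ⟨hTK, hTc⟩ := (mem_elementFinset hK).1 hT
  have hmt : z + m₀ • a ∈ convexHull ℝ (({z, z + a, z + b} : Finset (E 3)) : Set (E 3)) := by
    rw [Finset.coe_insert, Finset.coe_insert, Finset.coe_singleton, mem_convexHull_triple]
    exact ⟨m₀, 0, hm0.le, le_rfl, by linarith, by simp⟩
  have hinter : z + m₀ • a ∈
      convexHull ℝ ((({z, z + a, z + b} : Finset (E 3)) : Set (E 3)) ∩ (T : Set (E 3))) := by
    rw [← K.convexHull_inter_convexHull ht hTK]
    exact ⟨hmt, hmT⟩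
  have hzT : z ∈ T := by
    by_contra hzT
    have h1 : (({z, z + a, z + b} : Finset (E 3)) : Set (E 3)) ∩ (T : Set (E 3)) ⊆
        {z + a, z + b} := by
      rintro x ⟨hx, hxT⟩
      rw [Finset.coe_insert, Finset.coe_insert, Finset.coe_singleton] at hx
      rcases hx with rfl | hx
      · exact absurd hxT hzT
      · exact hx
    have h2 := convexHull_mono h1 hinter
    rw [convexHull_pair] at h2
    obtain ⟨x, y, hx, hy, hxy, h3⟩ := h2
    have h4 : (x - m₀) • a + y • b = 0 := by
      have : (x - m₀) • a + y • b = (x • (z + a) + y • (z + b)) - (z + m₀ • a) := by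
        obtain rfl : y = 1 - x := by linarith
        module
      rw [this, h3, sub_self]
    have := hcoord h4
    linarith [this.1, this.2]
  have haT : z + a ∈ T := by
    by_contra haT
    have h1 : (({z, z + a, z + b} : Finset (E 3)) : Set (E 3)) ∩ (T : Set (E 3)) ⊆
        {z, z + b} := by
      rintro x ⟨hx, hxT⟩
      rw [Finset.coe_insert, Finset.coe_insert, Finset.coe_singleton] at hx
      rcases hx with rfl | rfl | hx
      · exact Or.inl rfl
      · exact absurd hxT haT
      · exact Or.inr hx
    obtain ⟨x, -, -, h3⟩ := mem_convexHull_pair.1 (convexHull_mono h1 hinter)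
    have h4 : m₀ • a + (-x) • b = 0 := by
      rw [add_right_inj] at h3
      rw [h3]; module
    exact hm0.ne' (hcoord h4).1
  obtain ⟨a', c', haa', hTeq⟩ := exists_eq_of_mem hTc hzT haT (by simpa using ha0)
  obtain rfl : a = a' := add_left_cancel haa'
  subst hTeq
  have hνT := mem_vectorSpan_of_ray hτ hmT hτT
  rw [Finset.coe_insert, Finset.coe_insert, Finset.coe_singleton, vectorSpan_triple] at hνT
  have hVT := hσ _ (span_mem_directions hK hFi hF hTK hTc) (by simpa using hνT)
  have hc' : c' ∈ V := by
    rw [← hVT]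
    exact Submodule.subset_span (by simp)
  obtain ⟨γ₁, γ₂, hγ⟩ := Submodule.mem_span_pair.1 hc'
  refine ⟨c', γ₁, γ₂, hTK, hTc, ?_, hγ.symm⟩
  rw [Finset.coe_insert, Finset.coe_insert, Finset.coe_singleton, mem_convexHull_triple] at hτT
  obtain ⟨α, β, -, hβ, -, h1⟩ := hτT
  have h2 : (α + β * γ₁ - m₀ + τ * σ) • a + (β * γ₂ + τ) • b = 0 := by
    have : (α + β * γ₁ - m₀ + τ * σ) • a + (β * γ₂ + τ) • b =
        (z + α • a + β • (γ₁ • a + γ₂ • b)) - (z + m₀ • a + τ • -(b + (σ : ℝ) • a)) := by module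
    rw [this, hγ, ← h1, hν, sub_self]
  have h3 := (hcoord h2).2
  by_contra! h4
  nlinarith [mul_nonneg hβ h4]

open scoped Classical in
/-- Two triangles at the node `z` meet in the convex hull of their common vertices, also if they are
extended to cones. -/
lemma eq_or_eq_of_cone_inter {z a b a' b' : E 3}
    (ht : ({z, z + a, z + b} : Finset (E 3)) ∈ K.faces)
    (hc : ({z, z + a, z + b} : Finset (E 3)).card = 3)
    (ht' : ({z, z + a', z + b'} : Finset (E 3)) ∈ K.faces)
    {α β α' β' : ℝ} (hα : 0 < α) (hβ : 0 ≤ β) (hα' : 0 ≤ α') (hβ' : 0 ≤ β')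
    (h : α • a + β • b = α' • a' + β' • b') : a = a' ∨ a = b' := by
  have hind := linearIndependent_of_triple hc (K.indep ht)
  have hcoord : ∀ {α β : ℝ}, α • a + β • b = 0 → α = 0 ∧ β = 0 :=
    fun {α β} => LinearIndependent.pair_iff.1 hind α β
  have ha0 : a ≠ 0 := hind.ne_zero 0
  by_contra hne
  push Not at hne
  set s : ℝ := (1 + α + β + α' + β')⁻¹ with hs
  have hs0 : 0 < s := by positivity
  have hs1 : s * (1 + α + β + α' + β') = 1 := inv_mul_cancel₀ (by positivity)
  have hinter : z + (s * α) • a + (s * β) • b ∈ convexHull ℝ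
      ((({z, z + a, z + b} : Finset (E 3)) : Set (E 3)) ∩
        (({z, z + a', z + b'} : Finset (E 3)) : Set (E 3))) := by
    rw [← K.convexHull_inter_convexHull ht ht']
    simp only [Finset.coe_insert, Finset.coe_singleton]
    refine ⟨mem_convexHull_triple.2 ⟨s * α, s * β, by positivity, by positivity, by nlinarith, rfl⟩,
      mem_convexHull_triple.2 ⟨s * α', s * β', by positivity, by positivity, by nlinarith, ?_⟩⟩
    rw [add_assoc, add_assoc, mul_smul, mul_smul, mul_smul, mul_smul, ← smul_add, ← smul_add, h]
  have h1 : (({z, z + a, z + b} : Finset (E 3)) : Set (E 3)) ∩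
      (({z, z + a', z + b'} : Finset (E 3)) : Set (E 3)) ⊆ {z, z + b} := by
    rintro x ⟨hx, hxT⟩
    simp only [Finset.coe_insert, Finset.coe_singleton] at hx hxT
    rcases hx with rfl | rfl | hx
    · exact Or.inl rfl
    · rcases hxT with h2 | h2 | h2
      · exact absurd (by simpa using h2) ha0
      · exact absurd (add_left_cancel h2) hne.1
      · exact absurd (add_left_cancel h2) hne.2
    · exact Or.inr hx
  obtain ⟨x, -, -, h3⟩ := mem_convexHull_pair.1 (convexHull_mono h1 hinter)
  have h4 : (s * α) • a + (s * β - x) • b = 0 := by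
    rw [add_assoc, add_right_inj] at h3
    rw [sub_smul, ← add_sub_assoc, h3, sub_self]
  have h5 := (hcoord h4).1
  have h6 : 0 < s * α := by positivity
  linarith

end Triangles

/-! ### Shape regular triangles -/

/-- The component of `b` orthogonal to `a` is the shortest vector from the line of `a` to `b`. -/
lemma exists_orthogonal {X : Type*} [NormedAddCommGroup X] [InnerProductSpace ℝ X] {a b : X}
    (hind : LinearIndependent ℝ ![a, b]) :
    ∃ (w : X) (τ : ℝ), b = τ • a + w ∧ inner ℝ a w = 0 ∧ w ≠ 0 ∧ ∀ t : ℝ, ‖w‖ ≤ ‖b - t • a‖ := by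
  have ha : a ≠ 0 := hind.ne_zero 0
  have ha' : inner ℝ a a ≠ 0 := inner_self_ne_zero.2 ha
  set τ : ℝ := inner ℝ a b / inner ℝ a a with hτ
  have horth : inner ℝ a (b - τ • a) = 0 := by
    rw [inner_sub_right, inner_smul_right, hτ, div_mul_cancel₀ _ ha', sub_self]
  refine ⟨b - τ • a, τ, by simp, horth, fun h0 => ?_, fun t => ?_⟩
  · have := (LinearIndependent.pair_iff.1 hind (-τ) 1 (by rw [← h0]; module)).2
    norm_num at this
  · have h1 : b - t • a = (b - τ • a) + (τ - t) • a := by module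
    have h3 : inner ℝ (b - τ • a) ((τ - t) • a) = 0 := by
      rw [inner_smul_right, real_inner_comm, horth, mul_zero]
    have h2 := norm_add_sq_eq_norm_sq_add_norm_sq_of_inner_eq_zero _ _ h3
    rw [← h1] at h2
    exact (mul_self_le_mul_self_iff (norm_nonneg _) (norm_nonneg _)).2 (by nlinarith [norm_nonneg ((τ - t) • a)])

lemma volume_box_eq (D h : ℝ) :
    volume {x : E 2 | x 0 ∈ Icc (-D) D ∧ x 1 ∈ Icc 0 h} = ENNReal.ofReal (2 * D) * ENNReal.ofReal h := by
  have h1 : {x : E 2 | x 0 ∈ Icc (-D) D ∧ x 1 ∈ Icc 0 h} =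
      (MeasurableEquiv.toLp 2 (Fin 2 → ℝ)).symm ⁻¹' (Set.pi univ ![Icc (-D) D, Icc 0 h]) := by
    ext x
    simp [Set.mem_pi, Fin.forall_fin_two]
  rw [h1, (EuclideanSpace.volume_preserving_symm_measurableEquiv_toLp (Fin 2)).measure_preimage_equiv,
    volume_pi_pi]
  simp [Fin.prod_univ_two, Real.volume_Icc, two_mul]

/-- The affine isometry onto the plane through `z` spanned by two orthonormal vectors. -/
lemma isBiLipschitz_of_orthonormal {d : ℕ} {z u w : E d} (hu : ‖u‖ = 1) (hw : ‖w‖ = 1)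
    (huw : inner ℝ u w = 0) : IsBiLipschitz (fun x : E 2 => z + x 0 • u + x 1 • w) 1 1 := by
  have key : ∀ x y : E 2, ‖(z + x 0 • u + x 1 • w) - (z + y 0 • u + y 1 • w)‖ = ‖x - y‖ := by
    intro x y
    have h1 : (z + x 0 • u + x 1 • w) - (z + y 0 • u + y 1 • w) =
        (x 0 - y 0) • u + (x 1 - y 1) • w := by module
    have h3 : inner ℝ ((x 0 - y 0) • u) ((x 1 - y 1) • w) = 0 := by
      rw [inner_smul_left, inner_smul_right, huw, mul_zero, mul_zero]
    have h2 := norm_add_sq_eq_norm_sq_add_norm_sq_of_inner_eq_zero _ _ h3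
    rw [← h1, norm_smul, norm_smul, hu, hw, mul_one, mul_one] at h2
    rw [EuclideanSpace.norm_eq (x - y), Fin.sum_univ_two,
      ← Real.sqrt_mul_self (norm_nonneg (_ - (z + y 0 • u + y 1 • w))), h2]
    simp only [PiLp.sub_apply, sq]
  exact ⟨one_pos, fun x y => by rw [key, one_mul], fun x y => by rw [key, one_mul]⟩

/-- The area of a triangle is bounded by its diameter and each of its heights. -/
lemma measure_triangle_le {d : ℕ} {z a b : E d} (hind : LinearIndependent ℝ ![a, b]) (t : ℝ) :
    μHE[2] (convexHull ℝ ({z, z + a, z + b} : Set (E d))) ≤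
      ENNReal.ofReal (2 * Metric.diam (convexHull ℝ ({z, z + a, z + b} : Set (E d))) *
        ‖b - t • a‖) := by
  set T := convexHull ℝ ({z, z + a, z + b} : Set (E d)) with hT
  have hTb : Bornology.IsBounded T :=
    (isBounded_convexHull.2 (Set.toFinite _).isBounded)
  obtain ⟨w, τ, hb, haw, hw0, hw⟩ := exists_orthogonal hind
  have ha0 : a ≠ 0 := hind.ne_zero 0
  have hna : ‖a‖ ≠ 0 := norm_ne_zero_iff.2 ha0
  have hnw : ‖w‖ ≠ 0 := norm_ne_zero_iff.2 hw0
  set u := ‖a‖⁻¹ • a with hu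
  set w' := ‖w‖⁻¹ • w with hw'
  have hu1 : ‖u‖ = 1 := norm_smul_inv_norm (𝕜 := ℝ) ha0
  have hw1 : ‖w'‖ = 1 := norm_smul_inv_norm (𝕜 := ℝ) hw0
  have huw : inner ℝ u w' = 0 := by
    rw [hu, hw', inner_smul_left, inner_smul_right, haw, mul_zero, mul_zero]
  have hΨ := isBiLipschitz_of_orthonormal (z := z) hu1 hw1 huw
  have hzT : z ∈ T := subset_convexHull ℝ _ (by simp)
  have hsub : T ⊆ (fun x : E 2 => z + x 0 • u + x 1 • w') ''
      {x : E 2 | x 0 ∈ Icc (-Metric.diam T) (Metric.diam T) ∧ x 1 ∈ Icc 0 ‖w‖} := by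
    intro x hx
    obtain ⟨α, β, hα, hβ, hαβ, hxe⟩ := mem_convexHull_triple.1 hx
    have hxe' : x = z + ((α + β * τ) * ‖a‖) • u + (β * ‖w‖) • w' := by
      rw [hxe, hu, hw', smul_smul, smul_smul, mul_assoc, mul_assoc, mul_inv_cancel₀ hna,
        mul_inv_cancel₀ hnw, hb]
      module
    refine ⟨!₂[(α + β * τ) * ‖a‖, β * ‖w‖], ⟨?_, ?_, ?_⟩, ?_⟩
    · refine abs_le.1 ?_
      have h1 := Metric.dist_le_diam_of_mem hTb hx hzT
      refine le_trans ?_ h1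
      have h3 : inner ℝ (((α + β * τ) * ‖a‖) • u) ((β * ‖w‖) • w') = 0 := by
        rw [inner_smul_left, inner_smul_right, huw, mul_zero, mul_zero]
      have h2 := norm_add_sq_eq_norm_sq_add_norm_sq_of_inner_eq_zero _ _ h3
      rw [dist_eq_norm, show x - z = ((α + β * τ) * ‖a‖) • u + (β * ‖w‖) • w' by rw [hxe']; module]
      have h4 : ‖((α + β * τ) * ‖a‖) • u‖ = |(α + β * τ) * ‖a‖| := by
        rw [norm_smul, hu1, mul_one, Real.norm_eq_abs]
      change |(α + β * τ) * ‖a‖| ≤ _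
      rw [← h4]
      exact (mul_self_le_mul_self_iff (norm_nonneg _) (norm_nonneg _)).2 (by nlinarith [norm_nonneg ((β * ‖w‖) • w')])
    · change 0 ≤ β * ‖w‖
      positivity
    · change β * ‖w‖ ≤ ‖w‖
      exact mul_le_of_le_one_left (norm_nonneg _) (by linarith)
    · simp only [Matrix.cons_val_zero, Matrix.cons_val_one]
      exact hxe'.symm
  refine (measure_mono hsub).trans ((hΨ.measure_image_le _).trans ?_)
  rw [volume_box_eq, ENNReal.ofReal_one, one_pow, one_mul,
    ← ENNReal.ofReal_mul (by have := Metric.diam_nonneg (s := T); positivity)]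
  refine ENNReal.ofReal_le_ofReal ?_
  exact mul_le_mul_of_nonneg_left (hw t) (by have := Metric.diam_nonneg (s := T); positivity)

lemma measure_triangle_pos {d : ℕ} {z a b : E d} (hind : LinearIndependent ℝ ![a, b]) :
    0 < μHE[2] (convexHull ℝ ({z, z + a, z + b} : Set (E d))) := by
  set M : (Fin 2 → ℝ) →ₗ[ℝ] E d := Fintype.linearCombination ℝ ![a, b] with hM
  have hker : LinearMap.ker M = ⊥ := by
    rw [LinearMap.ker_eq_bot]
    exact linearIndependent_iff_injective_fintypeLinearCombination.1 hind
  obtain ⟨κ, hκ, hanti⟩ := LinearMap.exists_antilipschitzWith _ hker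
  have hlow : ∀ t β : ℝ, (2 * (κ : ℝ))⁻¹ * (|t| + |β|) ≤ ‖t • a + β • b‖ := by
    intro t β
    have h1 := hanti.le_mul_norm (f := M) (map_zero _) ![t, β]
    have h2 : M ![t, β] = t • a + β • b := by
      rw [hM, Fintype.linearCombination_apply, Fin.sum_univ_two]; rfl
    rw [h2] at h1
    have h3 : |t| ≤ ‖![t, β]‖ := norm_le_pi_norm (![t, β]) 0
    have h4 : |β| ≤ ‖![t, β]‖ := norm_le_pi_norm (![t, β]) 1
    have hκ' : (0 : ℝ) < κ := hκ
    rw [inv_mul_le_iff₀ (by positivity)]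
    linarith
  have hκ' : (0 : ℝ) < κ := hκ
  have hΦ : IsBiLipschitz (foldMap z a b (-b)) (2 * (κ : ℝ))⁻¹ (2 * max ‖a‖ ‖b‖) := by
    refine isBiLipschitz_foldMap (by positivity) hlow (fun t β => ?_) (fun t β ν hβ hν => ?_)
      (le_max_left _ _) (le_max_right _ _) (by rw [norm_neg]; exact le_max_right _ _)
    · have := hlow t (-β)
      rwa [abs_neg, neg_smul, ← smul_neg] at this
    · have := hlow t (β + ν)
      rw [abs_of_nonneg (add_nonneg hβ hν), ← add_assoc] at this
      refine this.trans_eq ?_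
      congr 1; module
  have h1 := hΦ.volume_le refTriangle
  rw [foldMap_image_refTriangle] at h1
  rw [pos_iff_ne_zero]
  intro h0
  rw [h0, mul_zero, nonpos_iff_eq_zero] at h1
  exact (Measure.measure_pos_of_nonempty_interior volume interior_refTriangle_nonempty).ne' h1

/-- In a shape regular triangle, the heights are comparable to the diameter. -/
lemma diam_le_of_shape {d : ℕ} {z a b : E d} (hind : LinearIndependent ℝ ![a, b]) {γ : ℝ}
    (h : Metric.diam (convexHull ℝ ({z, z + a, z + b} : Set (E d))) ^ 2 /
      (μHE[2] : Measure (E d)).real (convexHull ℝ ({z, z + a, z + b} : Set (E d))) ≤ γ) (t : ℝ) :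
    Metric.diam (convexHull ℝ ({z, z + a, z + b} : Set (E d))) ≤ 2 * max γ 1 * ‖b - t • a‖ := by
  set T := convexHull ℝ ({z, z + a, z + b} : Set (E d)) with hT
  have hle := measure_triangle_le (z := z) hind t
  rw [← hT] at hle
  have hpos : 0 < (μHE[2] : Measure (E d)).real T :=
    ENNReal.toReal_pos (measure_triangle_pos hind).ne' (hle.trans_lt ENNReal.ofReal_lt_top).ne
  have hle' : (μHE[2] : Measure (E d)).real T ≤ 2 * Metric.diam T * ‖b - t • a‖ :=
    ENNReal.toReal_le_of_le_ofReal
      (by have := Metric.diam_nonneg (s := T); positivity) hle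
  rw [div_le_iff₀ hpos] at h
  have hD := Metric.diam_nonneg (s := T)
  have hD' : 0 < Metric.diam T := by
    refine hD.lt_of_ne fun h0 => ?_
    rw [← h0] at hle'
    linarith
  have h1 : Metric.diam T ^ 2 ≤ max γ 1 * (2 * Metric.diam T * ‖b - t • a‖) := by
    refine h.trans (mul_le_mul (le_max_left _ _) hle' hpos.le ?_)
    exact zero_le_one.trans (le_max_right _ _)
  nlinarith

open scoped Classical in
/-- The elements at a node of a shape regular triangulation form a fan, with respect to the planes
and lines of any decomposition of the surface into triangles. -/
theorem isFan_nodeElements {K : Geometry.SimplicialComplex ℝ (E 3)} {Γ : Set (E 3)}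
    {F : Finset (Finset (E 3))} (hK : IsTriangulation K Γ) {γ : ℝ} (hγ : IsShapeRegular K γ)
    (hFi : ∀ t ∈ F, t.card = 3 ∧ AffineIndependent ℝ ((↑) : t → E 3))
    (hF : closure Γ = ⋃ t ∈ F, convexHull ℝ (t : Set (E 3))) (z : E 3) :
    IsFan (2 * max γ 1)⁻¹ (directions F) (edgeLines F) (fanTri (nodeElements hK z) z) := by
  have hmem : ∀ {a b}, fanTri (nodeElements hK z) z a b ↔
      ({z, z + a, z + b} : Finset (E 3)) ∈ K.faces ∧
        ({z, z + a, z + b} : Finset (E 3)).card = 3 := by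
    intro a b
    rw [fanTri, mem_nodeElements]
    simp
  have hγ1 : 1 ≤ max γ 1 := le_max_right _ _
  have hγ0 : 0 < 2 * max γ 1 := by linarith
  refine ⟨by positivity, inv_le_one_of_one_le₀ (by linarith), ?_, ?_, ?_, ?_, ?_, ?_⟩
  · intro a b h
    rw [fanTri, Finset.pair_comm]
    exact h
  · intro a b h
    exact linearIndependent_of_triple (hmem.1 h).2 (K.indep (hmem.1 h).1)
  · intro a b h t
    obtain ⟨h1, h2⟩ := hmem.1 h
    have hind := linearIndependent_of_triple h2 (K.indep h1)
    have h3 := hγ.1 rfl _ ⟨_, h1, h2, rfl⟩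
    rw [Finset.coe_insert, Finset.coe_insert, Finset.coe_singleton] at h3
    have h4 := diam_le_of_shape hind h3 t
    have hb : Bornology.IsBounded (convexHull ℝ ({z, z + a, z + b} : Set (E 3))) :=
      isBounded_convexHull.2 (Set.toFinite _).isBounded
    have hm : ∀ y ∈ ({z, z + a, z + b} : Set (E 3)), y ∈ convexHull ℝ {z, z + a, z + b} :=
      fun y hy => subset_convexHull ℝ _ hy
    have h5 := Metric.dist_le_diam_of_mem hb (hm (z + a) (by simp)) (hm z (by simp))
    have h6 := Metric.dist_le_diam_of_mem hb (hm (z + b) (by simp)) (hm z (by simp))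
    rw [dist_eq_norm, add_sub_cancel_left] at h5 h6
    rw [inv_mul_le_iff₀ hγ0, inv_mul_le_iff₀ hγ0]
    exact ⟨h5.trans h4, h6.trans h4⟩
  · intro a b h
    exact span_mem_directions hK hFi hF (hmem.1 h).1 (hmem.1 h).2
  · intro a b a' b' h h' α β α' β' hα hβ hα' hβ' heq
    exact eq_or_eq_of_cone_inter (hmem.1 h).1 (hmem.1 h).2 (hmem.1 h').1 hα hβ hα' hβ' heq
  · intro a b h ha
    obtain ⟨c', γ₁, γ₂, h1, h2, h3, h4⟩ :=
      exists_continuation hK hFi hF (hmem.1 h).1 (hmem.1 h).2 ha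
    exact ⟨c', γ₁, γ₂, hmem.2 ⟨h1, h2⟩, h3, h4⟩

/-! ### Local connectedness of the surface around a node -/

section Graph

variable {d : ℕ} {Ω Γ : Set (E d)} {z e : E d} {φ : E d → ℝ}

/-- Where an open set is the strict subgraph of a function, its boundary is the graph. -/
lemma eventually_mem_frontier_iff (hΩ : IsOpen Ω) (h : IsLipschitzSubgraphAt Ω z e φ) :
    ∀ᶠ y in 𝓝 z, (y ∈ frontier Ω ↔ inner ℝ e y = φ (y - inner ℝ e y • e)) := by
  obtain ⟨he, ⟨L, hL⟩, h⟩ := h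
  have hφ := hL.continuous
  filter_upwards [eventually_eventually_nhds.2 h] with y hy
  have hcont : Continuous fun y : E d => φ (y - inner ℝ e y • e) := by fun_prop
  have hcont' : Continuous fun y : E d => inner ℝ e y := by fun_prop
  rw [hΩ.frontier_eq]
  constructor
  · rintro ⟨hc, hy'⟩
    have h1 : ∃ᶠ y' in 𝓝 y, inner ℝ e y' ≤ φ (y' - inner ℝ e y' • e) :=
      ((mem_closure_iff_frequently.1 hc).and_eventually hy).mono fun y' h => (h.2.1 h.1).le
    have h2 : inner ℝ e y ≤ φ (y - inner ℝ e y • e) :=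
      (isClosed_le hcont' hcont).mem_of_frequently_of_tendsto h1 tendsto_id
    exact le_antisymm h2 (not_lt.1 fun h3 => hy' (hy.self_of_nhds.2 h3))
  · intro h1
    refine ⟨?_, fun h2 => (hy.self_of_nhds.1 h2).ne h1⟩
    have hray : Tendsto (fun t : ℝ => y - t • e) (𝓝[>] 0) (𝓝 y) := by
      have : Continuous fun t : ℝ => y - t • e := by fun_prop
      have h3 := this.tendsto 0
      simp only [zero_smul, sub_zero] at h3
      exact h3.mono_left nhdsWithin_le_nhds
    refine mem_closure_of_tendsto hray ?_
    filter_upwards [hray.eventually hy, self_mem_nhdsWithin] with t ht ht0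
    have ht0 : 0 < t := ht0
    rw [ht]
    have h2 : inner ℝ e (y - t • e) = inner ℝ e y - t := by
      rw [inner_sub_right, inner_smul_right, real_inner_self_eq_norm_sq, he]; ring
    rw [h2, show y - t • e - (inner ℝ e y - t) • e = y - inner ℝ e y • e by module, ← h1]
    linarith

lemma inner_sub_inner_smul (he : ‖e‖ = 1) (y : E d) : inner ℝ e (y - inner ℝ e y • e) = 0 := by
  rw [inner_sub_right, inner_smul_right, real_inner_self_eq_norm_sq, he]; ring

lemma inner_add_smul (he : ‖e‖ = 1) {p : E d} (hp : inner ℝ e p = 0) (t : ℝ) :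
    inner ℝ e (p + t • e) = t := by
  rw [inner_add_right, inner_smul_right, real_inner_self_eq_norm_sq, he, hp]; ring

/-- Around a point of a relatively open part of a Lipschitz surface, the surface without this point
is connected: it is the image of a punctured disc. -/
lemma exists_isPreconnected_of_mem {Ω Γ U V : Set (E 3)} {z : E 3}
    (hΩ : IsBoundedLipschitzDomain Ω) (hU : IsOpen U) (hΓ : Γ = U ∩ frontier Ω) (hz : z ∈ Γ)
    (hV : V ∈ 𝓝 z) :
    ∃ P W : Set (E 3), IsPreconnected P ∧ P ⊆ (closure Γ ∩ V) \ {z} ∧ W ∈ 𝓝 z ∧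
      (Γ ∩ W) \ {z} ⊆ P := by
  rw [hΓ] at hz
  obtain ⟨e, φ, hg⟩ := hΩ.lipschitz z hz.2
  have hfr := eventually_mem_frontier_iff hΩ.isOpen hg
  obtain ⟨he, ⟨L, hL⟩, -⟩ := hg
  have hφ := hL.continuous
  set p₀ : E 3 := z - inner ℝ e z • e with hp₀
  have hp₀e : inner ℝ e p₀ = 0 := inner_sub_inner_smul he z
  let G : E 3 → E 3 := fun p => p + φ p • e
  have hG : Continuous G := by fun_prop
  have hGz : G p₀ = z := by
    have := hfr.self_of_nhds.1 hz.2
    change p₀ + φ p₀ • e = z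
    rw [hp₀, ← this]; module
  have hGinner : ∀ {p}, inner ℝ e p = 0 → inner ℝ e (G p) = φ p := fun hp => inner_add_smul he hp _
  have hGproj : ∀ {p}, inner ℝ e p = 0 → G p - inner ℝ e (G p) • e = p := by
    intro p hp
    rw [hGinner hp]
    change p + φ p • e - φ p • e = p
    module
  have hnhds : ∀ᶠ y in 𝓝 z, (y ∈ frontier Ω ↔ inner ℝ e y = φ (y - inner ℝ e y • e)) ∧ y ∈ U ∧
      y ∈ V := hfr.and ((hU.eventually_mem hz.1).and hV)
  have hGn : ∀ᶠ p in 𝓝 p₀, (G p ∈ frontier Ω ↔ inner ℝ e (G p) = φ (G p - inner ℝ e (G p) • e)) ∧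
      G p ∈ U ∧ G p ∈ V := by
    have := hG.tendsto p₀
    rw [hGz] at this
    exact this.eventually hnhds
  obtain ⟨r, hr, hball⟩ := Metric.eventually_nhds_iff.1 hGn
  have he0 : e ≠ 0 := by
    rintro rfl
    simp at he
  have hrank : 1 < Module.rank ℝ (Submodule.span ℝ {e})ᗮ := by
    have : Fact (Module.finrank ℝ (E 3) = 2 + 1) := ⟨by simp⟩
    have h1 := Submodule.finrank_orthogonal_span_singleton (n := 2) (𝕜 := ℝ) he0
    exact_mod_cast Module.lt_rank_of_lt_finrank (n := 1) (by rw [h1]; norm_num)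
  refine ⟨(fun q : ℝ × (Submodule.span ℝ {e})ᗮ => G (p₀ + q.1 • (q.2 : E 3))) ''
      (Ioo 0 r ×ˢ Metric.sphere 0 1),
    {y | (y ∈ frontier Ω ↔ inner ℝ e y = φ (y - inner ℝ e y • e)) ∧
      ‖(y - inner ℝ e y • e) - p₀‖ < r}, ?_, ?_, ?_, ?_⟩
  · refine (isPreconnected_Ioo.prod (isPreconnected_sphere hrank 0 1)).image _ ?_
    exact Continuous.continuousOn (by fun_prop)
  · rintro _ ⟨⟨ρ, u⟩, ⟨⟨hρ, hρr⟩, hu⟩, rfl⟩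
    have hu1 : ‖(u : E 3)‖ = 1 := by simpa using hu
    have hue : inner ℝ e (u : E 3) = 0 := Submodule.mem_orthogonal_singleton_iff_inner_right.1 u.2
    have hpe : inner ℝ e (p₀ + ρ • (u : E 3)) = 0 := by
      rw [inner_add_right, inner_smul_right, hue, hp₀e]; ring
    have hdist : dist (p₀ + ρ • (u : E 3)) p₀ < r := by
      rw [dist_eq_norm, add_sub_cancel_left, norm_smul, hu1, mul_one, Real.norm_of_nonneg hρ.le]
      exact hρr
    obtain ⟨h1, h2, h3⟩ := hball hdist
    have h4 : G (p₀ + ρ • (u : E 3)) ∈ frontier Ω := by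
      rw [h1, hGproj hpe, hGinner hpe]
    refine ⟨⟨subset_closure (hΓ ▸ ⟨h2, h4⟩), h3⟩, fun h5 => ?_⟩
    have h6 := hGproj hpe
    have h5 : G (p₀ + ρ • (u : E 3)) = z := h5
    rw [h5, ← hp₀] at h6
    have h7 : ρ • (u : E 3) = 0 := by simpa using h6.symm
    rw [← norm_eq_zero, norm_smul, hu1, mul_one, norm_eq_zero] at h7
    exact hρ.ne' h7
  · have hc : Continuous fun y : E 3 => ‖(y - inner ℝ e y • e) - p₀‖ := by fun_prop
    refine hfr.and (hc.continuousAt.eventually (gt_mem_nhds ?_))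
    change ‖p₀ - p₀‖ < r
    rw [sub_self, norm_zero]
    exact hr
  · rintro y ⟨⟨hyΓ, hy1, hy2⟩, hyz⟩
    rw [hΓ] at hyΓ
    have h1 := hy1.1 hyΓ.2
    set p := y - inner ℝ e y • e with hp
    have hGp : G p = y := by
      change p + φ p • e = y
      rw [← h1, hp]; module
    have hpp : p - p₀ ≠ 0 := by
      intro h
      rw [sub_eq_zero] at h
      rw [h, hGz] at hGp
      exact hyz hGp.symm
    have hpn : ‖p - p₀‖ ≠ 0 := norm_ne_zero_iff.2 hpp
    have hpe : inner ℝ e p = 0 := inner_sub_inner_smul he y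
    have hmem : ‖p - p₀‖⁻¹ • (p - p₀) ∈ (Submodule.span ℝ {e})ᗮ := by
      rw [Submodule.mem_orthogonal_singleton_iff_inner_right, inner_smul_right, inner_sub_right,
        hp₀e, hpe, sub_zero, mul_zero]
    have hGu : G (p₀ + ‖p - p₀‖ • (‖p - p₀‖⁻¹ • (p - p₀))) = y := by
      rw [smul_smul, mul_inv_cancel₀ hpn, one_smul, add_sub_cancel, hGp]
    have hu1 : ‖‖p - p₀‖⁻¹ • (p - p₀)‖ = 1 := norm_smul_inv_norm (𝕜 := ℝ) hpp
    generalize ‖p - p₀‖⁻¹ • (p - p₀) = u at hmem hGu hu1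
    exact ⟨(‖p - p₀‖, ⟨u, hmem⟩), ⟨⟨norm_pos_iff.2 hpp, hy2⟩, mem_sphere_zero_iff_norm.2 hu1⟩, hGu⟩

/-- Around a point of the Lipschitz relative boundary of a surface, the surface is connected: it is
the image of a rectangle. -/
lemma exists_isPreconnected_of_notMem {d : ℕ} {Ω Γ V : Set (E d)} {z : E d}
    (hΩ : IsOpen Ω) (hΓ : Γ ⊆ frontier Ω) (hb : HasLipschitzRelBoundary Ω Γ)
    (hz : z ∈ closure Γ \ Γ) (hV : V ∈ 𝓝 z) :
    ∃ P W : Set (E d), IsPreconnected P ∧ P ⊆ (closure Γ ∩ V) \ {z} ∧ W ∈ 𝓝 z ∧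
      (Γ ∩ W) \ {z} ⊆ P := by
  obtain ⟨e, e', φ, ψ, hg, he', hee', ⟨L', hL'⟩, hsub⟩ := hb z hz
  have hfr := eventually_mem_frontier_iff hΩ hg
  obtain ⟨he, ⟨L, hL⟩, -⟩ := hg
  have hφ := hL.continuous
  have hψ := hL'.continuous
  have hzf : z ∈ frontier Ω := closure_minimal hΓ isClosed_frontier hz.1
  -- the coordinates of a point of the surface, and the point with given coordinates
  let π : E d → E d := fun y => y - inner ℝ e y • e - inner ℝ e' y • e'
  have hπ : Continuous π := by fun_prop
  let B : E d × ℝ → E d := fun q => q.1 + (ψ q.1 - q.2) • e'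
  have hB : Continuous B := by fun_prop
  let G : E d × ℝ → E d := fun q => B q + φ (B q) • e
  have hG : Continuous G := by fun_prop
  have he'e : inner ℝ e' e = 0 := by rw [real_inner_comm, hee']
  have hBe : ∀ {w t}, inner ℝ e w = 0 → inner ℝ e (B (w, t)) = 0 := by
    intro w t hw
    change inner ℝ e (w + (ψ w - t) • e') = 0
    rw [inner_add_right, inner_smul_right, hw, hee']; ring
  have hGe : ∀ {w t}, inner ℝ e w = 0 → inner ℝ e (G (w, t)) = φ (B (w, t)) :=
    fun hw => inner_add_smul he (hBe hw) _
  have hGB : ∀ {w t}, inner ℝ e w = 0 → G (w, t) - inner ℝ e (G (w, t)) • e = B (w, t) := by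
    intro w t hw
    rw [hGe hw]
    change B (w, t) + φ (B (w, t)) • e - _ = _
    module
  have hGe' : ∀ {w t}, inner ℝ e' w = 0 → inner ℝ e' (G (w, t)) = ψ w - t := by
    intro w t hw
    change inner ℝ e' ((w + (ψ w - t) • e') + φ (B (w, t)) • e) = _
    rw [inner_add_right, inner_add_smul he' hw, inner_smul_right, he'e]; ring
  have hGπ : ∀ {w t}, inner ℝ e w = 0 → inner ℝ e' w = 0 → π (G (w, t)) = w := by
    intro w t hw hw'
    change G (w, t) - inner ℝ e (G (w, t)) • e - inner ℝ e' (G (w, t)) • e' = w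
    rw [hGB hw, hGe' hw']
    change w + (ψ w - t) • e' - _ = w
    module
  have hπe : ∀ y, inner ℝ e (π y) = 0 := by
    intro y
    change inner ℝ e (y - inner ℝ e y • e - inner ℝ e' y • e') = 0
    rw [inner_sub_right, inner_sub_inner_smul he, inner_smul_right, hee']; ring
  have hπe' : ∀ y, inner ℝ e' (π y) = 0 := by
    intro y
    change inner ℝ e' (y - inner ℝ e y • e - inner ℝ e' y • e') = 0
    rw [sub_right_comm, inner_sub_right, inner_sub_inner_smul he', inner_smul_right, he'e]; ring
  have hrec : ∀ y, inner ℝ e y = φ (y - inner ℝ e y • e) → G (π y, ψ (π y) - inner ℝ e' y) = y := by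
    intro y hy
    have h1 : B (π y, ψ (π y) - inner ℝ e' y) = y - inner ℝ e y • e := by
      change π y + (ψ (π y) - (ψ (π y) - inner ℝ e' y)) • e' = _
      change (y - inner ℝ e y • e - inner ℝ e' y • e') + _ = _
      module
    change B _ + φ (B _) • e = y
    rw [h1, ← hy]; module
  -- the node itself lies on the curve
  have hz1 : inner ℝ e' z = ψ (π z) := by
    apply le_antisymm
    · have h1 : ∃ᶠ y in 𝓝 z, inner ℝ e' y ≤ ψ (π y) :=
        ((mem_closure_iff_frequently.1 hz.1).and_eventually hsub).mono fun y h =>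
          ((h.2 (hΓ h.1)).1 h.1).le
      have hc : Continuous fun y : E d => inner ℝ e' y := by fun_prop
      exact (isClosed_le hc (hψ.comp hπ)).mem_of_frequently_of_tendsto h1 tendsto_id
    · exact not_lt.1 fun h => hz.2 ((hsub.self_of_nhds hzf).2 h)
  have hGz : G (π z, 0) = z := by
    have := hrec z (hfr.self_of_nhds.1 hzf)
    rwa [hz1, sub_self] at this
  have hGn : ∀ᶠ q in 𝓝 (π z, (0 : ℝ)),
      (G q ∈ frontier Ω ↔ inner ℝ e (G q) = φ (G q - inner ℝ e (G q) • e)) ∧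
      (G q ∈ frontier Ω → (G q ∈ Γ ↔ inner ℝ e' (G q) < ψ (π (G q)))) ∧ G q ∈ V := by
    have := hG.tendsto (π z, 0)
    rw [hGz] at this
    exact this.eventually (hfr.and (hsub.and hV))
  obtain ⟨r, hr, hball⟩ := Metric.eventually_nhds_iff.1 hGn
  let D : Set (E d) := Metric.ball (π z) r ∩ {w | inner ℝ e w = 0} ∩ {w | inner ℝ e' w = 0}
  have hlin : ∀ f : E d, Convex ℝ {w : E d | inner ℝ f w = 0} := fun f =>
    convex_hyperplane (f := fun w : E d => inner ℝ f w) (innerₛₗ ℝ f).isLinear 0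
  have hD : Convex ℝ D := ((convex_ball _ _).inter (hlin e)).inter (hlin e')
  refine ⟨G '' (D ×ˢ Ioo 0 r),
    {y | (y ∈ frontier Ω ↔ inner ℝ e y = φ (y - inner ℝ e y • e)) ∧
      (y ∈ frontier Ω → (y ∈ Γ ↔ inner ℝ e' y < ψ (π y))) ∧
      ‖π y - π z‖ < r ∧ ψ (π y) - inner ℝ e' y < r}, ?_, ?_, ?_, ?_⟩
  · exact (hD.isPreconnected.prod isPreconnected_Ioo).image _ hG.continuousOn
  · rintro _ ⟨⟨w, t⟩, ⟨⟨⟨hwr, hwe⟩, hwe'⟩, ht0, htr⟩, rfl⟩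
    have hwe : inner ℝ e w = 0 := hwe
    have hwe' : inner ℝ e' w = 0 := hwe'
    have hdist : dist (w, t) (π z, (0 : ℝ)) < r := by
      rw [Prod.dist_eq, max_lt_iff]
      refine ⟨hwr, ?_⟩
      rw [Real.dist_eq, sub_zero, abs_of_pos ht0]
      exact htr
    obtain ⟨h1, h2, h3⟩ := hball hdist
    have h4 : G (w, t) ∈ frontier Ω := by rw [h1, hGB hwe, hGe hwe]
    have h5 : G (w, t) ∈ Γ := by
      rw [h2 h4, hGπ hwe hwe', hGe' hwe']
      have ht0 : 0 < t := ht0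
      linarith
    exact ⟨⟨subset_closure h5, h3⟩, fun h6 => hz.2 (h6 ▸ h5)⟩
  · refine hfr.and (hsub.and (Filter.Eventually.and ?_ ?_))
    · have hc : Continuous fun y : E d => ‖π y - π z‖ := by fun_prop
      refine hc.continuousAt.eventually (gt_mem_nhds ?_)
      change ‖π z - π z‖ < r
      rw [sub_self, norm_zero]
      exact hr
    · have hc : Continuous fun y : E d => ψ (π y) - inner ℝ e' y := by fun_prop
      refine hc.continuousAt.eventually (gt_mem_nhds ?_)
      change ψ (π z) - inner ℝ e' z < r
      rw [hz1, sub_self]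
      exact hr
  · rintro y ⟨⟨hyΓ, hy1, hy2, hy3, hy4⟩, -⟩
    have hyf := hΓ hyΓ
    refine ⟨(π y, ψ (π y) - inner ℝ e' y), ⟨⟨⟨?_, hπe y⟩, hπe' y⟩, ?_, hy4⟩, hrec y (hy1.1 hyf)⟩
    · rw [mem_ball_iff_norm]
      exact hy3
    · have := (hy2 hyf).1 hyΓ
      change 0 < ψ (π y) - inner ℝ e' y
      linarith

end Graph

/-- The elements at a node are connected via common edges: otherwise two groups of elements which
only meet at the node would disconnect the surface around the node. -/
theorem nodeElements_connected {Ω Γ : Set (E 3)} (hΓ : IsPolygonalBoundaryPart Ω Γ)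
    {K : Geometry.SimplicialComplex ℝ (E 3)} (hK : IsTriangulation K Γ) {z : E 3}
    (hz : z ∈ K.vertices) [DecidableEq (E 3)] {J : Finset (Finset (E 3))}
    (hJ : J ⊆ nodeElements hK z) (hne : J.Nonempty)
    (hcl : ∀ t ∈ J, ∀ t' ∈ nodeElements hK z, 2 ≤ (t ∩ t').card → t' ∈ J) :
    nodeElements hK z ⊆ J := by
  intro t₁ ht₁
  by_contra ht₁J
  obtain ⟨t₀, ht₀⟩ := hne
  have hcompact : ∀ I : Finset (Finset (E 3)),
      IsClosed (⋃ t ∈ I, convexHull ℝ (t : Set (E 3))) := fun I =>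
    I.finite_toSet.isClosed_biUnion fun t _ => isClosed_convexHull_finset t
  set A : Set (E 3) := ⋃ t ∈ J, convexHull ℝ (t : Set (E 3)) with hA
  set B : Set (E 3) := ⋃ t ∈ nodeElements hK z \ J, convexHull ℝ (t : Set (E 3)) with hB
  have hAB : ∀ x ∈ A, x ∈ B → x = z := by
    intro x hxA hxB
    obtain ⟨t, ht, hxt⟩ := mem_iUnion₂.1 hxA
    obtain ⟨t', ht', hxt'⟩ := mem_iUnion₂.1 hxB
    obtain ⟨ht'I, ht'J⟩ := Finset.mem_sdiff.1 ht'
    obtain ⟨h1, h2, h3⟩ := (mem_nodeElements hK).1 (hJ ht)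
    obtain ⟨k1, k2, k3⟩ := (mem_nodeElements hK).1 ht'I
    have hcard : (t ∩ t').card ≤ 1 := by
      by_contra! h
      exact ht'J (hcl t ht t' ht'I h)
    have hint : t ∩ t' = {z} :=
      Finset.eq_singleton_iff_unique_mem.2 ⟨Finset.mem_inter.2 ⟨h3, k3⟩, fun y hy =>
        Finset.card_le_one.1 hcard y hy z (Finset.mem_inter.2 ⟨h3, k3⟩)⟩
    have : x ∈ convexHull ℝ ((t : Set (E 3)) ∩ (t' : Set (E 3))) := by
      rw [← K.convexHull_inter_convexHull h1 k1]
      exact ⟨hxt, hxt'⟩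
    rw [← Finset.coe_inter, hint, Finset.coe_singleton, convexHull_singleton] at this
    exact this
  -- the elements away from the node
  set V : Set (E 3) := (⋃ t ∈ elementFinset hK \ nodeElements hK z,
    convexHull ℝ (t : Set (E 3)))ᶜ with hV
  have hVn : V ∈ 𝓝 z := by
    refine (hcompact _).isOpen_compl.mem_nhds fun h => ?_
    obtain ⟨t, ht, hzt⟩ := mem_iUnion₂.1 h
    obtain ⟨h1, h2⟩ := Finset.mem_sdiff.1 ht
    obtain ⟨h3, h4⟩ := (mem_elementFinset hK).1 h1
    exact h2 ((mem_nodeElements hK).2 ⟨h3, h4, (K.vertex_mem_convexHull_iff hz h3).1 hzt⟩)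
  have hcover : ∀ x ∈ closure Γ, x ∈ V → x ∈ A ∪ B := by
    intro x hx hxV
    rw [← biUnion_elementFinset hK] at hx
    obtain ⟨t, ht, hxt⟩ := mem_iUnion₂.1 hx
    by_cases h1 : t ∈ nodeElements hK z
    · by_cases h2 : t ∈ J
      · exact Or.inl (mem_iUnion₂.2 ⟨t, h2, hxt⟩)
      · exact Or.inr (mem_iUnion₂.2 ⟨t, Finset.mem_sdiff.2 ⟨h1, h2⟩, hxt⟩)
    · exact absurd (mem_iUnion₂.2 ⟨t, Finset.mem_sdiff.2 ⟨ht, h1⟩, hxt⟩) hxV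
  have hPW : ∃ P W : Set (E 3), IsPreconnected P ∧ P ⊆ (closure Γ ∩ V) \ {z} ∧ W ∈ 𝓝 z ∧
      (Γ ∩ W) \ {z} ⊆ P := by
    obtain ⟨U, hU, hΓU⟩ := hΓ.relatively_open
    by_cases hzΓ : z ∈ Γ
    · exact exists_isPreconnected_of_mem hΓ.lipschitz_domain hU hΓU hzΓ hVn
    · refine exists_isPreconnected_of_notMem hΓ.lipschitz_domain.isOpen
        (hΓU ▸ inter_subset_right) (hΓ.lipschitz_boundary rfl) ⟨?_, hzΓ⟩ hVn
      rw [← hK.space_eq]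
      exact K.vertices_subset_space hz
  obtain ⟨P, W, hP, hPsub, hW, hWP⟩ := hPW
  -- both groups of elements contain points of `Γ` near the node
  have hpoint : ∀ I I' : Finset (Finset (E 3)),
      (∀ x ∈ ⋃ t ∈ I, convexHull ℝ (t : Set (E 3)),
        x ∈ ⋃ t ∈ I', convexHull ℝ (t : Set (E 3)) → x = z) →
      ∀ t ∈ I, t ∈ nodeElements hK z → ∃ x ∈ P, x ∉ ⋃ t ∈ I', convexHull ℝ (t : Set (E 3)) := by
    intro I I' hII t ht htI
    obtain ⟨h1, h2, h3⟩ := (mem_nodeElements hK).1 htI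
    obtain ⟨p, hp, hpz⟩ := Finset.exists_mem_ne (by omega : 1 < t.card) z
    have hline : Tendsto (fun τ : ℝ => z + τ • (p - z)) (𝓝[>] 0) (𝓝 z) := by
      have : Continuous fun τ : ℝ => z + τ • (p - z) := by fun_prop
      have h4 := this.tendsto 0
      simp only [zero_smul, add_zero] at h4
      exact h4.mono_left nhdsWithin_le_nhds
    have hlt : ∀ᶠ τ : ℝ in 𝓝[>] 0, τ < 1 :=
      (eventually_lt_nhds one_pos).filter_mono nhdsWithin_le_nhds
    obtain ⟨τ, hτW, hτ1, hτ0⟩ := ((hline.eventually (eventually_mem_nhds_iff.2 hW)).and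
      (hlt.and self_mem_nhdsWithin)).exists
    have hτ0 : 0 < τ := hτ0
    set x := z + τ • (p - z) with hx
    have hxz : x ≠ z := by
      rw [hx, Ne, add_eq_left]
      exact smul_ne_zero hτ0.ne' (sub_ne_zero.2 hpz)
    have hxt : x ∈ convexHull ℝ (t : Set (E 3)) :=
      (convex_convexHull ℝ _).add_smul_sub_mem (subset_convexHull ℝ _ h3)
        (subset_convexHull ℝ _ hp) ⟨hτ0.le, hτ1.le⟩
    have hxI' : x ∉ ⋃ t ∈ I', convexHull ℝ (t : Set (E 3)) := fun h =>
      hxz (hII x (mem_iUnion₂.2 ⟨t, ht, hxt⟩) h)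
    have hxcl : x ∈ closure Γ := by
      rw [← hK.space_eq]
      exact K.convexHull_subset_space h1 hxt
    have hn : W ∩ ({z}ᶜ ∩ (⋃ t ∈ I', convexHull ℝ (t : Set (E 3)))ᶜ) ∈ 𝓝 x :=
      inter_mem hτW (inter_mem (isOpen_compl_singleton.mem_nhds hxz)
        ((hcompact I').isOpen_compl.mem_nhds hxI'))
    obtain ⟨y, ⟨hyW, hyz, hyI'⟩, hyΓ⟩ := mem_closure_iff_nhds.1 hxcl _ hn
    exact ⟨y, hWP ⟨⟨hyΓ, hyW⟩, hyz⟩, hyI'⟩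
  obtain ⟨x, hxP, hxB⟩ := hpoint J (nodeElements hK z \ J) hAB t₀ ht₀ (hJ ht₀)
  obtain ⟨y, hyP, hyA⟩ := hpoint (nodeElements hK z \ J) J (fun x hx hx' => hAB x hx' hx) t₁
    (Finset.mem_sdiff.2 ⟨ht₁, ht₁J⟩) ht₁
  have hPAB : P ⊆ A ∪ B := fun q hq => hcover q (hPsub hq).1.1 (hPsub hq).1.2
  obtain ⟨q, hqP, hqA, hqB⟩ := isPreconnected_closed_iff.1 hP A B (hcompact _) (hcompact _) hPAB
    ⟨x, hxP, (hPAB hxP).resolve_right hxB⟩ ⟨y, hyP, (hPAB hyP).resolve_left hyA⟩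
  exact (hPsub hqP).2 (hAB q hqA hqB)

/-! ### Node patches of polygonal curves -/

/-- The reference segment. -/
def refSegment : Set (E 1) := {x | x 0 ∈ Icc 0 1}

lemma convex_refSegment : Convex ℝ refSegment := by
  intro x hx y hy a b ha hb hab
  exact convex_Icc (0 : ℝ) 1 hx hy ha hb hab

lemma isClosed_refSegment : IsClosed refSegment := isClosed_Icc.preimage (continuous_coord 0)

lemma norm_eq_abs_coord (x : E 1) : ‖x‖ = |x 0| := by
  rw [EuclideanSpace.norm_eq, Fin.sum_univ_one, Real.norm_eq_abs, sq_abs, Real.sqrt_sq_eq_abs]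

lemma volume_refSegment_ne_top : volume refSegment ≠ ∞ := by
  refine ((measure_mono fun x hx => ?_).trans_lt
    (measure_closedBall_lt_top (x := (0 : E 1)) (r := 1))).ne
  rw [mem_closedBall_zero_iff, norm_eq_abs_coord, abs_of_nonneg hx.1]
  exact hx.2

/-- The piecewise affine map that sends the two half lines to those spanned by `a` and `b` at the
point `z`. -/
noncomputable def lineFold {d : ℕ} (z a b : E d) (x : E 1) : E d :=
  z + max (x 0) 0 • a + max (-x 0) 0 • b

lemma isBiLipschitz_lineFold {d : ℕ} {z a b : E d} {m M : ℝ} (hm : 0 < m)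
    (h : ∀ β ν : ℝ, 0 ≤ β → 0 ≤ ν → m * (β + ν) ≤ ‖β • a - ν • b‖)
    (ha : ‖a‖ ≤ M) (hb : ‖b‖ ≤ M) : IsBiLipschitz (lineFold z a b) m (2 * M) := by
  have hM : 0 ≤ M := (norm_nonneg _).trans ha
  have hma : m ≤ ‖a‖ := by simpa using h 1 0 zero_le_one le_rfl
  have hmb : m ≤ ‖b‖ := by simpa using h 0 1 le_rfl zero_le_one
  have key : ∀ x y : E 1, y 0 ≤ x 0 → m * ‖x - y‖ ≤ ‖lineFold z a b x - lineFold z a b y‖ := by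
    intro x y hxy
    rw [norm_eq_abs_coord, PiLp.sub_apply, abs_of_nonneg (sub_nonneg.2 hxy), lineFold, lineFold]
    rcases le_total 0 (y 0) with hy | hy
    · have hx := hy.trans hxy
      rw [max_eq_left hx, max_eq_left hy, max_eq_right (neg_nonpos.2 hx),
        max_eq_right (neg_nonpos.2 hy),
        show z + x 0 • a + (0 : ℝ) • b - (z + y 0 • a + (0 : ℝ) • b) = (x 0 - y 0) • a by module,
        norm_smul, Real.norm_of_nonneg (sub_nonneg.2 hxy), mul_comm]
      exact mul_le_mul_of_nonneg_left hma (sub_nonneg.2 hxy)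
    rcases le_total 0 (x 0) with hx | hx
    · rw [max_eq_left hx, max_eq_right hy, max_eq_right (neg_nonpos.2 hx),
        max_eq_left (neg_nonneg.2 hy), show z + x 0 • a + (0 : ℝ) • b - (z + (0 : ℝ) • a + -y 0 • b) =
          x 0 • a - (-y 0) • b by module]
      exact h _ _ hx (neg_nonneg.2 hy)
    · rw [max_eq_right hx, max_eq_right hy, max_eq_left (neg_nonneg.2 hx),
        max_eq_left (neg_nonneg.2 hy),
        show z + (0 : ℝ) • a + -x 0 • b - (z + (0 : ℝ) • a + -y 0 • b) = -((x 0 - y 0) • b) by module,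
        norm_neg, norm_smul, Real.norm_of_nonneg (sub_nonneg.2 hxy), mul_comm]
      exact mul_le_mul_of_nonneg_left hmb (sub_nonneg.2 hxy)
  refine ⟨hm, fun x y => ?_, fun x y => ?_⟩
  · rcases le_total (y 0) (x 0) with hxy | hxy
    · exact key x y hxy
    · rw [norm_sub_rev, norm_sub_rev (lineFold z a b x)]
      exact key y x hxy
  · rw [norm_eq_abs_coord, PiLp.sub_apply, lineFold, lineFold,
      show z + max (x 0) 0 • a + max (-x 0) 0 • b - (z + max (y 0) 0 • a + max (-y 0) 0 • b) =
        (max (x 0) 0 - max (y 0) 0) • a + (max (-x 0) 0 - max (-y 0) 0) • b by module]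
    have h1 : |max (x 0) 0 - max (y 0) 0| ≤ |x 0 - y 0| := abs_max_sub_max_le_abs _ _ _
    have h2 : |max (-x 0) 0 - max (-y 0) 0| ≤ |x 0 - y 0| := by
      refine (abs_max_sub_max_le_abs _ _ _).trans_eq ?_
      rw [neg_sub_neg, abs_sub_comm]
    refine (norm_add_le _ _).trans ?_
    rw [norm_smul, norm_smul, Real.norm_eq_abs, Real.norm_eq_abs]
    nlinarith [mul_le_mul h1 ha (norm_nonneg _) (abs_nonneg _),
      mul_le_mul h2 hb (norm_nonneg _) (abs_nonneg _)]

lemma lineFold_image_refSegment {d : ℕ} (z a b : E d) :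
    lineFold z a b '' refSegment = convexHull ℝ ({z, z + a} : Set (E d)) := by
  ext x
  rw [mem_convexHull_pair]
  constructor
  · rintro ⟨y, ⟨h1, h2⟩, rfl⟩
    refine ⟨y 0, h1, h2, ?_⟩
    rw [lineFold, max_eq_left h1, max_eq_right (neg_nonpos.2 h1)]
    simp
  · rintro ⟨α, h1, h2, rfl⟩
    refine ⟨!₂[α], ⟨h1, h2⟩, ?_⟩
    change z + max α 0 • a + max (-α) 0 • b = z + α • a
    rw [max_eq_left h1, max_eq_right (neg_nonpos.2 h1)]
    simp

lemma lineFold_image_closedBall {d : ℕ} (z a b : E d) :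
    lineFold z a b '' Metric.closedBall 0 1 =
      convexHull ℝ ({z, z + a} : Set (E d)) ∪ convexHull ℝ ({z, z + b} : Set (E d)) := by
  ext x
  rw [mem_union, mem_convexHull_pair, mem_convexHull_pair]
  constructor
  · rintro ⟨y, hy, rfl⟩
    rw [mem_closedBall_zero_iff, norm_eq_abs_coord, abs_le] at hy
    rcases le_total 0 (y 0) with h | h
    · refine Or.inl ⟨y 0, h, hy.2, ?_⟩
      rw [lineFold, max_eq_left h, max_eq_right (neg_nonpos.2 h)]
      simp
    · refine Or.inr ⟨-y 0, neg_nonneg.2 h, by linarith, ?_⟩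
      rw [lineFold, max_eq_right h, max_eq_left (neg_nonneg.2 h)]
      simp
  · rintro (⟨α, h1, h2, rfl⟩ | ⟨α, h1, h2, rfl⟩)
    · refine ⟨!₂[α], ?_, ?_⟩
      · rw [mem_closedBall_zero_iff, norm_eq_abs_coord]
        change |α| ≤ 1
        rwa [abs_of_nonneg h1]
      · change z + max α 0 • a + max (-α) 0 • b = z + α • a
        rw [max_eq_left h1, max_eq_right (neg_nonpos.2 h1)]
        simp
    · refine ⟨!₂[-α], ?_, ?_⟩
      · rw [mem_closedBall_zero_iff, norm_eq_abs_coord]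
        change |-α| ≤ 1
        rwa [abs_neg, abs_of_nonneg h1]
      · change z + max (-α) 0 • a + max (- -α) 0 • b = z + α • b
        rw [neg_neg, max_eq_left h1, max_eq_right (neg_nonpos.2 h1)]
        simp

section Segments

variable {K : Geometry.SimplicialComplex ℝ (E 2)} {Γ : Set (E 2)} {F : Finset (Finset (E 2))}

lemma span_mem_directions_of_segment (hK : IsTriangulation K Γ)
    (hFi : ∀ t ∈ F, t.card = 2 ∧ AffineIndependent ℝ ((↑) : t → E 2))
    (hF : closure Γ = ⋃ t ∈ F, convexHull ℝ (t : Set (E 2))) {z a : E 2}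
    (ht : convexHull ℝ {z, z + a} ⊆ K.space) (ha : a ≠ 0) :
    Submodule.span ℝ {a} ∈ directions F := by
  have h1 : ∀ᶠ t : ℝ in 𝓝[>] 0, z + t • a ∈ closure Γ := by
    have h2 : ∀ᶠ t : ℝ in 𝓝[>] 0, t < 1 :=
      (eventually_lt_nhds one_pos).filter_mono nhdsWithin_le_nhds
    filter_upwards [h2, self_mem_nhdsWithin] with t ht1 ht0
    rw [← hK.space_eq]
    exact ht (mem_convexHull_pair.2 ⟨t, le_of_lt ht0, ht1.le, rfl⟩)
  obtain ⟨f, hf, -, h2⟩ := exists_ray_direction hF h1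
  rw [Submodule.eq_of_le_of_finrank_eq ((Submodule.span_singleton_le_iff_mem _ _).2 h2)
    ((finrank_span_singleton ha).trans
      (finrank_vectorSpan_finset (n := 1) (hFi f hf).1 (hFi f hf).2).symm)]
  exact ⟨f, hf, rfl⟩

open scoped Classical in
lemma eq_of_ray_inter {z a a' : E 2} (ht : ({z, z + a} : Finset (E 2)) ∈ K.faces)
    (ht' : ({z, z + a'} : Finset (E 2)) ∈ K.faces) (ha : a ≠ 0)
    {α α' : ℝ} (hα : 0 < α) (hα' : 0 ≤ α') (h : α • a = α' • a') : a = a' := by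
  by_contra hne
  set s : ℝ := (1 + α + α')⁻¹ with hs
  have hs0 : 0 < s := by positivity
  have hs1 : s * (1 + α + α') = 1 := inv_mul_cancel₀ (by positivity)
  have hinter : z + (s * α) • a ∈ convexHull ℝ ((({z, z + a} : Finset (E 2)) : Set (E 2)) ∩
      (({z, z + a'} : Finset (E 2)) : Set (E 2))) := by
    rw [← K.convexHull_inter_convexHull ht ht']
    simp only [Finset.coe_insert, Finset.coe_singleton]
    refine ⟨mem_convexHull_pair.2 ⟨s * α, by positivity, by nlinarith, rfl⟩,
      mem_convexHull_pair.2 ⟨s * α', by positivity, by nlinarith, ?_⟩⟩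
    rw [mul_smul, mul_smul, h]
  have h1 : (({z, z + a} : Finset (E 2)) : Set (E 2)) ∩
      (({z, z + a'} : Finset (E 2)) : Set (E 2)) ⊆ {z} := by
    rintro x ⟨hx, hxT⟩
    simp only [Finset.coe_insert, Finset.coe_singleton] at hx hxT
    rcases hx with rfl | rfl
    · rfl
    · rcases hxT with h2 | h2
      · exact absurd (by simpa using h2) ha
      · exact absurd (add_left_cancel h2) hne
  have h2 := convexHull_mono h1 hinter
  rw [convexHull_singleton, mem_singleton_iff, add_eq_left] at h2
  exact smul_ne_zero (by positivity) ha h2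

/-- The node patches of shape regular polygonal curves are regular: any two segments at a node form
a common chart. -/
theorem exists_isRegularPatch_segments {A : ℝ} (hA : 1 ≤ A) (γ : ℝ)
    (hFi : ∀ t ∈ F, t.card = 2 ∧ AffineIndependent ℝ ((↑) : t → E 2))
    (hF : closure Γ = ⋃ t ∈ F, convexHull ℝ (t : Set (E 2)))
    (hAF : AngleBound A (directions F) (directions F)) :
    ∃ (a b c : ℝ) (N : ℕ), 0 < a ∧ 0 < b ∧ 0 < c ∧
      ∀ (K : Geometry.SimplicialComplex ℝ (E 2)) (hK : IsTriangulation K Γ), IsShapeRegular K γ →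
      ∀ z ∈ K.vertices,
      0 < Metric.diam (⋃ t ∈ nodeElements hK z, convexHull ℝ (t : Set (E 2))) ∧
      IsRegularPatch (d := 2) a b c N refSegment z
        (Metric.diam (⋃ t ∈ nodeElements hK z, convexHull ℝ (t : Set (E 2))))
        (nodeElements hK z) (fun t => convexHull ℝ (t : Set (E 2))) (fun _ _ => True) := by
  classical
  set g : ℝ := max γ 1 with hg
  have hg1 : 1 ≤ g := le_max_right _ _
  have hA0 : 0 < A := by linarith
  have hg0 : 0 < g := by linarith
  obtain ⟨N, hN⟩ := exists_card_le_of_separated 2 (show 0 < A⁻¹ by positivity)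
  refine ⟨(4 * A * g)⁻¹, 2, 1, N + 1, by positivity, by norm_num, one_pos, ?_⟩
  intro K hK hγ z hz
  set I := nodeElements hK z with hI
  set S : Set (E 2) := ⋃ t ∈ I, convexHull ℝ (t : Set (E 2)) with hS
  have hvec : ∀ t ∈ I, ∃ a : E 2, t = {z, z + a} ∧ a ≠ 0 := by
    intro t ht
    obtain ⟨-, h2, h3⟩ := (mem_nodeElements hK).1 ht
    obtain ⟨p, hp⟩ := Finset.card_eq_one.1
      (show (t.erase z).card = 1 by rw [Finset.card_erase_of_mem h3, h2])
    have hpz : p ≠ z := by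
      have : p ∈ t.erase z := by rw [hp]; exact Finset.mem_singleton_self p
      exact Finset.ne_of_mem_erase this
    refine ⟨p - z, ?_, sub_ne_zero.2 hpz⟩
    rw [add_sub_cancel, ← hp, Finset.insert_erase h3]
  choose! e he he0 using hvec
  have hface : ∀ t ∈ I, ({z, z + e t} : Finset (E 2)) ∈ K.faces := fun t ht => by
    rw [← he t ht]; exact ((mem_nodeElements hK).1 ht).1
  have hhull : ∀ t ∈ I, convexHull ℝ (t : Set (E 2)) = convexHull ℝ ({z, z + e t} : Set (E 2)) := by
    intro t ht
    conv_lhs => rw [he t ht]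
    rw [Finset.coe_insert, Finset.coe_singleton]
  have hdir : ∀ t ∈ I, Submodule.span ℝ {e t} ∈ directions F := by
    intro t ht
    refine span_mem_directions_of_segment (z := z) hK hFi hF ?_ (he0 t ht)
    rw [← hhull t ht]
    exact K.convexHull_subset_space ((mem_nodeElements hK).1 ht).1
  -- two segments at the node do not form an arbitrarily small angle
  have hsep : ∀ t ∈ I, ∀ t' ∈ I, t ≠ t' → ∀ β ν : ℝ, 0 ≤ β → 0 ≤ ν →
      β * ‖e t‖ ≤ A * ‖β • e t - ν • e t'‖ := by
    intro t ht t' ht' hne β ν hβ hν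
    have hee : e t ≠ e t' := fun h => hne (by rw [he t ht, he t' ht', h])
    obtain ⟨w, hw, hle⟩ := hAF _ (hdir t ht) _ (hdir t' ht') (β • e t)
      (Submodule.smul_mem _ _ (Submodule.mem_span_singleton_self _)) (ν • e t')
      (Submodule.smul_mem _ _ (Submodule.mem_span_singleton_self _))
    by_cases hw0 : w = 0
    · rwa [hw0, sub_zero, norm_smul, Real.norm_of_nonneg hβ] at hle
    · -- the two segments lie on one line, hence on opposite sides of the node
      obtain ⟨x, hx⟩ := Submodule.mem_span_singleton.1 hw.1
      obtain ⟨y, hy⟩ := Submodule.mem_span_singleton.1 hw.2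
      have hx0 : x ≠ 0 := by rintro rfl; exact hw0 (by rw [← hx, zero_smul])
      have hμ : e t = (y / x) • e t' := by
        rw [div_eq_inv_mul, mul_smul, hy, ← hx, smul_smul, inv_mul_cancel₀ hx0, one_smul]
      have hneg : y / x ≤ 0 := by
        by_contra! h
        exact hee (eq_of_ray_inter (hface t ht) (hface t' ht') (he0 t ht) one_pos h.le
          (by rw [one_smul]; exact hμ))
      have h1 : ‖β • e t - ν • e t'‖ = (β * -(y / x) + ν) * ‖e t'‖ := by
        have : β • e t - ν • e t' = -((β * -(y / x) + ν) • e t') := by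
          rw [hμ]; module
        rw [this, norm_neg, norm_smul, Real.norm_of_nonneg]
        have := mul_nonneg hβ (neg_nonneg.2 hneg)
        linarith
      have h2 : ‖e t‖ = -(y / x) * ‖e t'‖ := by
        conv_lhs => rw [hμ]
        rw [norm_smul, Real.norm_of_nonpos hneg]
      rw [h1, h2]
      have h3 := norm_nonneg (e t')
      have h4 : 0 ≤ β * -(y / x) * ‖e t'‖ :=
        mul_nonneg (mul_nonneg hβ (neg_nonneg.2 hneg)) h3
      have h5 : 0 ≤ ν * ‖e t'‖ := mul_nonneg hν h3
      nlinarith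
  have hcard : I.card ≤ N := by
    have hpos : ∀ t ∈ I, ‖e t‖ ≠ 0 := fun t ht => norm_ne_zero_iff.2 (he0 t ht)
    refine hN _ I (fun t => ‖e t‖⁻¹ • e t) (fun t ht => norm_smul_inv_norm (𝕜 := ℝ) (he0 t ht))
      fun t ht t' ht' hne => ?_
    have := hsep t ht t' ht' hne ‖e t‖⁻¹ ‖e t'‖⁻¹ (by positivity) (by positivity)
    rw [inv_mul_cancel₀ (hpos t ht)] at this
    rwa [inv_le_iff_one_le_mul₀' hA0]
  -- the segments at the node are comparable
  have hdiam : ∀ t ∈ I, Metric.diam (convexHull ℝ (t : Set (E 2))) = ‖e t‖ := by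
    intro t ht
    rw [hhull t ht, convexHull_diam, Metric.diam_pair, dist_eq_norm, sub_add_cancel_left, norm_neg]
  have hzt : ∀ t ∈ I, z ∈ convexHull ℝ (t : Set (E 2)) := fun t ht =>
    subset_convexHull ℝ _ ((mem_nodeElements hK).1 ht).2.2
  have hsize : ∀ t ∈ I, ∀ t' ∈ I, ‖e t‖ ≤ g * ‖e t'‖ := by
    intro t ht t' ht'
    obtain ⟨h1, h2, -⟩ := (mem_nodeElements hK).1 ht
    obtain ⟨k1, k2, -⟩ := (mem_nodeElements hK).1 ht'
    have := hγ.2 rfl _ ⟨t, h1, h2, rfl⟩ _ ⟨t', k1, k2, rfl⟩ ⟨z, hzt t ht, hzt t' ht'⟩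
    rw [hdiam t ht, hdiam t' ht', div_le_iff₀ (norm_pos_iff.2 (he0 t' ht'))] at this
    exact this.trans (mul_le_mul_of_nonneg_right (le_max_left _ _) (norm_nonneg _))
  have hSb : Bornology.IsBounded S :=
    (Bornology.isBounded_biUnion_finset I).2 fun t _ =>
      isBounded_convexHull.2 t.finite_toSet.isBounded
  have hleH : ∀ t ∈ I, ‖e t‖ ≤ Metric.diam S := by
    intro t ht
    rw [← hdiam t ht]
    exact Metric.diam_mono (subset_biUnion_of_mem (u := fun t : Finset (E 2) =>
      convexHull ℝ (t : Set (E 2))) ht) hSb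
  have hHle : ∀ t ∈ I, Metric.diam S ≤ 2 * (g * ‖e t‖) := by
    intro t ht
    refine diam_le_of_forall (z := z) (by positivity) fun x hx => ?_
    obtain ⟨t', ht', hx⟩ := mem_iUnion₂.1 hx
    rw [hhull t' ht', mem_convexHull_pair] at hx
    obtain ⟨α, h1, h2, rfl⟩ := hx
    rw [add_sub_cancel_left, norm_smul, Real.norm_of_nonneg h1]
    exact (mul_le_of_le_one_left (norm_nonneg _) h2).trans (hsize t' ht' t ht)
  obtain ⟨t₀, ht₀⟩ := nodeElements_nonempty hK hz
  have hH : 0 < Metric.diam S := (norm_pos_iff.2 (he0 t₀ ht₀)).trans_le (hleH t₀ ht₀)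
  have hbil : ∀ t ∈ I, ∀ b : E 2, ‖b‖ ≤ Metric.diam S → Metric.diam S ≤ 2 * (g * ‖b‖) →
      (∀ β ν : ℝ, 0 ≤ β → 0 ≤ ν → β * ‖e t‖ + ν * ‖b‖ ≤ 2 * A * ‖β • e t - ν • b‖) →
      IsBiLipschitz (lineFold z (e t) b) ((4 * A * g)⁻¹ * Metric.diam S) (2 * Metric.diam S) := by
    intro t ht b hb hHb h
    refine isBiLipschitz_lineFold (by positivity) (fun β ν hβ hν => ?_) (hleH t ht) hb
    rw [mul_assoc, inv_mul_le_iff₀ (by positivity)]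
    have h1 := mul_le_mul_of_nonneg_left (hHle t ht) hβ
    have h2 := mul_le_mul_of_nonneg_left hHb hν
    have h3 := mul_le_mul_of_nonneg_left (h β ν hβ hν) hg0.le
    nlinarith
  have hline : ∀ t ∈ I, IsBiLipschitz (lineFold z (e t) (-e t)) ((4 * A * g)⁻¹ * Metric.diam S)
      (2 * Metric.diam S) := by
    intro t ht
    refine hbil t ht _ (by rw [norm_neg]; exact hleH t ht) (by rw [norm_neg]; exact hHle t ht) ?_
    intro β ν hβ hν
    rw [norm_neg, show β • e t - ν • -e t = (β + ν) • e t by module, norm_smul,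
      Real.norm_of_nonneg (add_nonneg hβ hν)]
    have h1 : 0 ≤ (β + ν) * ‖e t‖ := by positivity
    nlinarith
  refine ⟨hH, ⟨hcard.trans (Nat.le_succ N), fun _ _ => trivial, ?_, ?_, ?_, ?_⟩⟩
  · intro t ht t' ht' _
    by_cases hne : t = t'
    · subst hne
      have hball : ∀ x : E 1, ‖x - !₂[1 / 2]‖ = |x 0 - 1 / 2| := fun x => norm_eq_abs_coord _
      have himage : lineFold z (e t) (-e t) '' Metric.closedBall (!₂[1 / 2] : E 1) (1 / 2) =
          convexHull ℝ (t : Set (E 2)) := by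
        rw [hhull t ht, ← lineFold_image_refSegment z (e t) (-e t)]
        congr 1
        ext x
        rw [mem_closedBall_iff_norm, hball, abs_le]
        constructor
        · rintro ⟨h1, h2⟩
          exact ⟨by linarith, by linarith⟩
        · rintro ⟨h1, h2⟩
          exact ⟨by linarith, by linarith⟩
      refine ⟨Metric.ball (!₂[1 / 2] : E 1) (1 / 2), lineFold z (e t) (-e t), Metric.isOpen_ball,
        convex_ball _ _, ?_, ?_, hline t ht, ?_⟩
      · intro x hx
        rw [mem_ball_iff_norm] at hx
        replace hx := (hball x).symm.trans_lt hx
        rw [abs_lt] at hx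
        rw [mem_ball_zero_iff]
        refine (norm_eq_abs_coord x).trans_lt ?_
        rw [abs_lt]
        constructor <;> linarith [hx.1, hx.2]
      · intro x hx
        refine mem_iUnion₂.2 ⟨t, ht, ?_⟩
        rw [← himage]
        exact mem_image_of_mem _ (Metric.ball_subset_closedBall hx)
      · rw [union_self, closure_ball _ (by norm_num), himage]
    · refine ⟨Metric.ball 0 1, lineFold z (e t) (e t'), Metric.isOpen_ball, convex_ball _ _,
        Metric.ball_subset_ball one_le_two, ?_,
        hbil t ht _ (hleH t' ht') (hHle t' ht') fun β ν hβ hν => ?_, ?_⟩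
      · intro x hx
        have h1 : lineFold z (e t) (e t') x ∈
            convexHull ℝ (t : Set (E 2)) ∪ convexHull ℝ (t' : Set (E 2)) := by
          rw [hhull t ht, hhull t' ht', ← lineFold_image_closedBall]
          exact mem_image_of_mem _ (Metric.ball_subset_closedBall hx)
        rcases h1 with h1 | h1
        · exact mem_iUnion₂.2 ⟨t, ht, h1⟩
        · exact mem_iUnion₂.2 ⟨t', ht', h1⟩
      · have h1 := hsep t ht t' ht' hne β ν hβ hν
        have h2 := hsep t' ht' t ht (Ne.symm hne) ν β hν hβ
        rw [norm_sub_rev] at h2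
        linarith
      · rw [closure_ball _ one_ne_zero, hhull t ht, hhull t' ht']
        exact (lineFold_image_closedBall z (e t) (e t')).ge
  · intro t ht
    refine ⟨_, hline t ht, ?_, ?_⟩
    · change z + max (0 : ℝ) 0 • e t + max (-0 : ℝ) 0 • -e t = z
      simp
    · rw [hhull t ht]
      exact (lineFold_image_refSegment z (e t) (-e t)).symm
  · intro t _ t' _ h
    exact absurd trivial h
  · intro t ht t' ht'
    refine ⟨fun k => if k = 0 then t else t', if_pos rfl, if_neg (Nat.succ_ne_zero N), fun k => ?_,
      fun _ => trivial⟩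
    by_cases hk : k = 0
    · simpa [hk] using ht
    · simpa [hk] using ht'

end Segments

end BEM

theorem proposition3p3 (d : ℕ) (hd : d = 2 ∨ d = 3) (Ω Γ : Set (BEM.E d))
    (hΓ : BEM.IsPolygonalBoundaryPart Ω Γ) (γ s : ℝ) (hs₀ : 0 < s) (hs₁ : s < 1) :
    ∃ C : ℝ, 0 < C ∧
      ∀ K : Geometry.SimplicialComplex ℝ (BEM.E d),
        BEM.IsTriangulation K Γ → BEM.IsShapeRegular K γ →
      ∀ z ∈ K.vertices, ∀ (v : BEM.E d → ℝ) (g : BEM.E d → BEM.E d),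
        BEM.MemH1WithGradient (BEM.nodePatch K z) v g →
        BEM.slobodeckijSeminorm s (BEM.nodePatch K z) v ≤
          ENNReal.ofReal (C * Metric.diam (BEM.nodePatch K z) ^ (1 - s)) *
            MeasureTheory.eLpNorm g 2
              ((BEM.surfaceMeasure d).restrict (BEM.nodePatch K z)) := by
  obtain ⟨F, hFi, hF⟩ := hΓ.polygonal
  rcases hd with rfl | rfl
  · obtain ⟨A, hA, hAF⟩ := BEM.exists_angleBound (BEM.finite_directions F) (BEM.finite_directions F)
    obtain ⟨a, b, c, N, ha, hb, hc, hmain⟩ := BEM.exists_isRegularPatch_segments hA γ hFi hF hAF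
    obtain ⟨C, hC, hest⟩ := BEM.slobodeckijSeminorm_patch_le (d := 2) le_rfl hs₀ hs₁ ha hb hc N
      BEM.convex_refSegment BEM.isClosed_refSegment.measurableSet BEM.volume_refSegment_ne_top
    refine ⟨C, hC, fun K hK hγ z hz v g hvg => ?_⟩
    rw [BEM.nodePatch_eq hK hz] at hvg ⊢
    obtain ⟨hH, hP⟩ := hmain K hK hγ z hz
    exact hest _ z _ _ _ _ hH hP v g hvg
  · classical
    have h𝒱 := BEM.finite_directions F
    have hℰ := BEM.finite_edgeLines F
    obtain ⟨A₁, hA₁, h₁⟩ := BEM.exists_angleBound h𝒱 h𝒱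
    obtain ⟨A₂, -, h₂⟩ := BEM.exists_angleBound hℰ hℰ
    obtain ⟨A₃, -, h₃⟩ := BEM.exists_angleBound hℰ (h𝒱.image2 (· ⊓ ·) h𝒱)
    have hγ1 : 1 ≤ max γ 1 := le_max_right _ _
    have hγ0 : 0 < 2 * max γ 1 := by linarith
    obtain ⟨a, b, c, N, ha, hb, hc, hmain⟩ := BEM.exists_isRegularPatch_of_isFan
      (c := (2 * max γ 1)⁻¹) (A := max A₁ (max A₂ A₃)) (by positivity)
      (inv_le_one_of_one_le₀ (by linarith)) (hA₁.trans (le_max_left _ _))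
    obtain ⟨C, hC, hest⟩ := BEM.slobodeckijSeminorm_patch_le (d := 3) one_le_two hs₀ hs₁ ha hb hc N
      BEM.convex_refTriangle BEM.isClosed_refTriangle.measurableSet BEM.volume_refTriangle_ne_top
    refine ⟨C, hC, fun K hK hγ z hz v g hvg => ?_⟩
    rw [BEM.nodePatch_eq hK hz] at hvg ⊢
    obtain ⟨hH, hP⟩ := hmain z (BEM.nodeElements hK z) (BEM.directions F) (BEM.edgeLines F)
      (BEM.nodeElements_nonempty hK hz)
      (fun t ht => ⟨((BEM.mem_nodeElements hK).1 ht).2.2, ((BEM.mem_nodeElements hK).1 ht).2.1⟩)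
      (BEM.isFan_nodeElements hK hγ hFi hF z) (h₁.mono (le_max_left _ _))
      (h₂.mono ((le_max_left _ _).trans (le_max_right _ _)))
      (h₃.mono ((le_max_right _ _).trans (le_max_right _ _)))
      (fun J hJ hne hcl => BEM.nodeElements_connected hΓ hK hz hJ hne fun t ht t' ht' h =>
        hcl t ht t' ht' (by convert h))
    exact hest _ z _ _ _ _ hH hP v g hvg
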